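/- Let $\kappa>0$, let $B_1\subset\mathbb R^2$ be the open unit disk, and put $\|u\|_{\mathcal B}^2=\|u\|_{L^2(B_1)}^2+\kappa^{-2}\|\nabla u\|_{L^2(B_1)}^2$ on $H^1(B_1)$ (complex-valued functions). For $p\in\mathbb Z$ let $\tilde b_p(r,\theta)=J_p(\kappa r)e^{ip\theta}$ and $b_p=\tilde b_p/\|\tilde b_p\|_{\mathcal B}$, and let $\mathcal B$ be the closure of $\operatorname{span}\{b_p\}_{p\in\mathbb Z}$ in $H^1(B_1)$ (these are the $H^1$ solutions of $\Delta u+\kappa^2u=0$ in $B_1$). Let $Y=[0,2\pi)\times\mathbb R$, $w(\varphi,\zeta)=e^{-\kappa\sinh|\zeta|+|\zeta|/4}$, $(u,v)_{\mathcal A}=\int_Y u\overline v\,w^2\,d\varphi\,d\zeta$, $\tilde a_p(\varphi,\zeta)=e^{p\zeta}e^{ip\varphi}$, $a_p=\tilde a_p/\|\tilde a_p\|_{\mathcal A}$, $\mathcal A=\overline{\operatorname{span}}\{a_p\}_{p\in\mathbb Z}\subset L^2(Y;w^2)$ and, for $P\in\mathbb N=\{0,1,2,\dots\}$, $\mathcal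 A_P=\operatorname{span}\{a_p\}_{|p|\le P}$. Elements of $\mathcal A$ have continuous representatives, and for $\mathbf y\in Y$ let $K_{\mathbf y}\in\mathcal A$ be the Riesz representation of the evaluation at $\mathbf y$: $v(\mathbf y)=(v,K_{\mathbf y})_{\mathcal A}$ for all $v\in\mathcal A$. For $\mathbf y=(\varphi,\zeta)\in Y$ let $\phi_{\mathbf y}(\mathbf x)=e^{i\kappa\,\mathbf d(\mathbf y)\cdot\mathbf x}$ with $\mathbf d(\mathbf y)=(\cos(\varphi+i\zeta),\sin(\varphi+i\zeta))$, an evanescent plane wave. For $N=2P+1$ put $\mu_N(\mathbf y)=\big(\sum_{|p|\le P}|a_p(\mathbf y)|^2\big)^{-1}$. Given nodes $\mathbf y_{P,M,m}\in Y$ ($P,M\in\mathbb N$, $1\le m\le M$), let $$\psi_{P,M,m}=\sqrt{\mu_N(\mathbf y_{P,M,m})/M}\;K_{\mathbf y_{P,M,m}},\qquad \Phi_{P,M}=\Big\{\sqrt{\mu_N(\mathbf y_{P,M,m})/M}\;\phi_{\mathbf y_{P,M,m}}\Big\}_{m=1}^M .$$ For a finite family $\Theta=\{\theta_l\}_l$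 write $\mathcal T_\Theta\boldsymbol\mu=\sum_l\mu_l\theta_l$. A family $\{\Phi_k\}_k$ of finite subsets of $\mathcal B$ is a *stable approximation* for $\mathcal B$ if for every $\eta>0$ there are $s\ge0$ and $C_{\rm stb}\ge0$ such that $$\forall u\in\mathcal B\ \exists k,\ \boldsymbol\mu\in\mathbb C^{|\Phi_k|}:\quad \|u-\mathcal T_{\Phi_k}\boldsymbol\mu\|_{\mathcal B}\le\eta\|u\|_{\mathcal B},\qquad \|\boldsymbol\mu\|_{\ell^2}\le C_{\rm stb}|\Phi_k|^s\|u\|_{\mathcal B}.\tag{1}$$ **Conjecture (on the nodes).** For every $\eta>0$ there are $s(P)\ge0$ and $C(P)\ge0$, $P\in\mathbb N$, with $\sup_Ps(P)<\infty$ and $\sup_PC(P)<\infty$, such that for all $P$ and all $v\in\mathcal A_P$ there are $M\in\mathbb N$ and $\boldsymbol\mu\in\mathbb C^M$ with $\|v-\sum_m\mu_m\psi_{P,M,m}\|_{\mathcal A}\le\eta\|v\|_{\mathcal A}$ and $\|\boldsymbol\mu\|_{\ell^2}\le C(P)M^{s(P)}\|v\|_{\mathcal A}$. **Regularised sampling.**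 For a finite family $\Phi=\{\phi_l\}_{l=1}^{M}$ of functions and a function $u$, all continuous on $\overline{B_1}$, for an integer $S\ge M$, $S\geq 1$, and for $\epsilon\in(0,1]$, let $\mathbf x_j=(\cos\frac{2\pi j}S,\sin\frac{2\pi j}S)$ for $1\le j\le S$, $A=(\phi_l(\mathbf x_j))_{j,l}$, $\mathbf b=(u(\mathbf x_j))_j$. Let $A=U\Sigma V^*$ be a singular value decomposition, let $\sigma_{\max}$ be the largest singular value, let $\Sigma_\epsilon$ be $\Sigma$ with the singular values smaller than $\epsilon\sigma_{\max}$ replaced by $0$, and let $\boldsymbol\xi_{S,\epsilon}=V\Sigma_\epsilon^\dagger U^*\mathbf b$. **Proposition.** There is a constant $C_{\rm err}>0$, depending only on $\kappa$, such that the following holds for all nodes for which the Conjecture holds. The family $\{\Phi_{P,M}\}_{P,M\in\mathbb N}$ is a stable approximation for $\mathcal B$. Moreover, if $\kappa^2$ is not an eigenvalue of the Dirichlet Laplacian $-\Delta$ in $B_1$, then for every $\delta>0$: 1. for every $u\in\mathcal B\cap C^0(\overline{B_1})$ there are $P,M,S\in\mathbb N$ with $S\ge M$, $S\ge1$, and $\epsilon\in(0,1]$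 such that $\|u-\mathcal T_{\Phi_{P,M}}\boldsymbol\xi_{S,\epsilon}\|_{L^2(B_1)}\le\delta\|u\|_{\mathcal B}$; 2. if $s$ and $C_{\rm stb}$ are a stability exponent and a stability constant for which (1) holds with $\{\Phi_k\}_k = \{\Phi_{P,M}\}_{P,M}$ and tolerance $\eta=\delta/(2C_{\rm err})$, then for every $u\in\mathcal B\cap C^0(\overline{B_1})$ there are $P,M$ and $S_0\ge1$ such that $\|u-\mathcal T_{\Phi_{P,M}}\boldsymbol\xi_{S,\epsilon}\|_{L^2(B_1)}\le\delta\|u\|_{\mathcal B}$ for all $S\ge\max(S_0,M)$ and all $\epsilon\in(0,1]$ with $2C_{\rm err}\,\sigma_{\max}\,C_{\rm stb}\,M^s\,\epsilon\le\delta\sqrt S$. (Here $\sigma_{\max}$ refers to the matrix $A$ built from $\Phi_{P,M}$ and $S$.) -/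

import Mathlib

/-! Evanescent plane waves in the unit disk. The plane `ℝ²` is identified with `ℂ`
(Euclidean norm, Lebesgue measure); all functions are complex valued. -/

namespace EPW

open MeasureTheory Set
open scoped ContDiff ComplexConjugate

noncomputable section

/-! ### The Sobolev space `H¹` of the unit disk -/

/-- The open unit disk `B₁`. -/
def disk : Set ℂ := Metric.ball 0 1

/-- Lebesgue measure on `B₁`. -/
def diskMeasure : Measure ℂ := volume.restrict disk

/-- The canonical basis of `ℝ² = ℂ`. -/
def dir (j : Fin 2) : ℂ := if j = 0 then 1 else Complex.I

/-- The classical partial derivative in the `j`-th direction. -/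
def partialDeriv (j : Fin 2) (f : ℂ → ℂ) (x : ℂ) : ℂ := fderiv ℝ f x (dir j)

/-- Smooth functions with compact support contained in `B₁`. -/
def IsTestFunction (f : ℂ → ℂ) : Prop :=
  ContDiff ℝ ∞ f ∧ HasCompactSupport f ∧ tsupport f ⊆ disk

/-- `g` is a square integrable weak gradient of `u` in `B₁`. -/
def IsWeakGradient (u : ℂ → ℂ) (g : ℂ → EuclideanSpace ℂ (Fin 2)) : Prop :=
  MemLp g 2 diskMeasure ∧
    ∀ (j : Fin 2) (f : ℂ → ℂ), IsTestFunction f →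
      ∫ x, u x * partialDeriv j f x ∂diskMeasure = -∫ x, g x j * f x ∂diskMeasure

/-- `u ∈ H¹(B₁)`. -/
def MemH1 (u : ℂ → ℂ) : Prop :=
  MemLp u 2 diskMeasure ∧ ∃ g, IsWeakGradient u g

open Classical in
/-- The weak gradient of an element of `H¹(B₁)` (unique almost everywhere in `B₁`). -/
def weakGradient (u : ℂ → ℂ) : ℂ → EuclideanSpace ℂ (Fin 2) :=
  if h : ∃ g, IsWeakGradient u g then h.choose else 0

/-- The norm of `L²(B₁)`. -/
def l2Norm (u : ℂ → ℂ) : ℝ := Real.sqrt (∫ x, ‖u x‖ ^ 2 ∂diskMeasure)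

/-- The `κ`-dependent norm on `H¹(B₁)`:
`‖u‖_B² = ‖u‖²_{L²(B₁)} + κ⁻² ‖∇u‖²_{L²(B₁)}`. For `κ = 1` it is the usual `H¹` norm. -/
def normB (κ : ℝ) (u : ℂ → ℂ) : ℝ :=
  Real.sqrt ((∫ x, ‖u x‖ ^ 2 ∂diskMeasure)
    + (κ ^ 2)⁻¹ * ∫ x, ‖weakGradient u x‖ ^ 2 ∂diskMeasure)

/-- `u ∈ H¹₀(B₁)`: the closure of the test functions in `H¹(B₁)`. -/
def MemH10 (u : ℂ → ℂ) : Prop :=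
  MemH1 u ∧ ∀ ε : ℝ, 0 < ε → ∃ f, IsTestFunction f ∧ normB 1 (u - f) < ε

/-- `lam` is an eigenvalue of the Dirichlet Laplacian `-Δ` in `B₁`. -/
def IsDirichletEigenvalue (lam : ℝ) : Prop :=
  ∃ w : ℂ → ℂ, MemH10 w ∧ ¬ (w =ᵐ[diskMeasure] 0) ∧
    ∀ f, IsTestFunction f →
      ∫ x, ∑ j, weakGradient w x j * partialDeriv j f x ∂diskMeasure
        = (lam : ℂ) * ∫ x, w x * f x ∂diskMeasure

/-! ### Circular waves and the space `B` of Helmholtz solutions -/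

/-- Bessel function of the first kind of integer order, by its power series
`J_n(t) = ∑ₘ (-1)ᵐ / (m! (m+n)!) (t/2)^(2m+n)` for `n ≥ 0`, and `J_{-n} = (-1)ⁿ J_n`. -/
def besselJ (p : ℤ) (t : ℝ) : ℝ :=
  (if p < 0 then (-1) ^ p.natAbs else 1) *
    ∑' m : ℕ, (-1) ^ m / ((m.factorial : ℝ) * ((m + p.natAbs).factorial : ℝ))
      * (t / 2) ^ (2 * m + p.natAbs)

/-- `J_p(κ r) e^{ipθ}` at the point `x = r e^{iθ}`. -/
def circularWaveTilde (κ : ℝ) (p : ℤ) (x : ℂ) : ℂ :=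
  (besselJ p (κ * ‖x‖) : ℂ) * Complex.exp (Complex.I * (p : ℂ) * (Complex.arg x : ℂ))

/-- The normalised circular wave `b_p`. -/
def circularWave (κ : ℝ) (p : ℤ) (x : ℂ) : ℂ :=
  (((normB κ (circularWaveTilde κ p))⁻¹ : ℝ) : ℂ) * circularWaveTilde κ p x

/-- `u ∈ B`: the closure in `H¹(B₁)` of the span of the circular waves `b_p`, `p ∈ ℤ`. -/
def MemB (κ : ℝ) (u : ℂ → ℂ) : Prop :=
  MemH1 u ∧ ∀ ε : ℝ, 0 < ε →
    ∃ q ∈ Submodule.span ℂ (range (circularWave κ)), normB κ (u - q) < ε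

/-! ### Herglotz densities -/

/-- The cylinder `Y = [0, 2π) × ℝ` of parameters `(φ, ζ)`. -/
def cylinder : Set (ℝ × ℝ) := Ico 0 (2 * Real.pi) ×ˢ univ

/-- The weight `w(φ, ζ) = exp(-κ sinh|ζ| + |ζ|/4)`. -/
def weight (κ : ℝ) (y : ℝ × ℝ) : ℝ :=
  Real.exp (-κ * Real.sinh |y.2| + |y.2| / 4)

/-- The measure `w² dy` on `Y`. -/
def weightMeasure (κ : ℝ) : Measure (ℝ × ℝ) :=
  (volume.restrict cylinder).withDensity fun y => ENNReal.ofReal (weight κ y ^ 2)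

/-- The scalar product `(u, v)_A = ∫_Y u conj(v) w² dy`. -/
def innerA (κ : ℝ) (u v : ℝ × ℝ → ℂ) : ℂ := ∫ y, u y * conj (v y) ∂weightMeasure κ

/-- The norm of `L²(Y; w²)`. -/
def normA (κ : ℝ) (v : ℝ × ℝ → ℂ) : ℝ := Real.sqrt (∫ y, ‖v y‖ ^ 2 ∂weightMeasure κ)

/-- `e^{pζ} e^{ipφ}`. -/
def herglotzTilde (p : ℤ) (y : ℝ × ℝ) : ℂ :=
  Complex.exp ((p : ℂ) * (y.2 : ℂ)) * Complex.exp (Complex.I * (p : ℂ) * (y.1 : ℂ))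

/-- The normalised Herglotz polynomial `a_p`. -/
def herglotz (κ : ℝ) (p : ℤ) (y : ℝ × ℝ) : ℂ :=
  (((normA κ (herglotzTilde p))⁻¹ : ℝ) : ℂ) * herglotzTilde p y

/-- `v ∈ A`: the closure in `L²(Y; w²)` of the span of the `a_p`, `p ∈ ℤ`. -/
def MemA (κ : ℝ) (v : ℝ × ℝ → ℂ) : Prop :=
  MemLp v 2 (weightMeasure κ) ∧ ∀ ε : ℝ, 0 < ε →
    ∃ q ∈ Submodule.span ℂ (range (herglotz κ)), normA κ (v - q) < ε

/-- The truncated space `A_P = span {a_p : |p| ≤ P}`. -/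
def herglotzSpace (κ : ℝ) (P : ℕ) : Submodule ℂ (ℝ × ℝ → ℂ) :=
  Submodule.span ℂ (herglotz κ '' {p : ℤ | |p| ≤ (P : ℤ)})

/-- `k ∈ A` is the Riesz representation of the evaluation at `y`: `v(y) = (v, k)_A` for every
`v ∈ A`. The value `v(y)` of a class `v ∈ A` is that of its continuous representative on `Y`. -/
def IsSamplingFunctional (κ : ℝ) (y : ℝ × ℝ) (k : ℝ × ℝ → ℂ) : Prop :=
  MemA κ k ∧ ContinuousOn k cylinder ∧
    ∀ v, MemA κ v → ContinuousOn v cylinder → v y = innerA κ v k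

open Classical in
/-- The sampling functional `K_y` (it exists and is unique on `Y`, for `κ > 0` and `y ∈ Y`). -/
def samplingFunctional (κ : ℝ) (y : ℝ × ℝ) : ℝ × ℝ → ℂ :=
  if h : ∃ k, IsSamplingFunctional κ y k then h.choose else 0

/-! ### Approximation sets -/

/-- The Christoffel function `μ_N`, `N = 2P + 1`. -/
def christoffel (κ : ℝ) (P : ℕ) (y : ℝ × ℝ) : ℝ :=
  (∑ p ∈ Finset.Icc (-(P : ℤ)) (P : ℤ), ‖herglotz κ p y‖ ^ 2)⁻¹

/-- The evanescent plane wave `exp(iκ d(y)·x)`, `d(φ, ζ) = (cos(φ + iζ), sin(φ + iζ))`. -/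
def planeWave (κ : ℝ) (y : ℝ × ℝ) (x : ℂ) : ℂ :=
  Complex.exp (Complex.I * (κ : ℂ) *
    (Complex.cos ((y.1 : ℂ) + Complex.I * (y.2 : ℂ)) * (x.re : ℂ)
      + Complex.sin ((y.1 : ℂ) + Complex.I * (y.2 : ℂ)) * (x.im : ℂ)))

/-- The normalised sampling functionals `ψ_{P,M,m}` for nodes `Y_{P,M} = {y P M m}`. -/
def samplingSet (κ : ℝ) (y : (P M : ℕ) → Fin M → ℝ × ℝ) (P M : ℕ) (m : Fin M) :
    ℝ × ℝ → ℂ := fun z =>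
  ((Real.sqrt (christoffel κ P (y P M m) / M) : ℝ) : ℂ) * samplingFunctional κ (y P M m) z

/-- The normalised evanescent plane waves forming `Φ_{P,M}`, with `k = (P, M)`. -/
def planeWaveSet (κ : ℝ) (y : (P M : ℕ) → Fin M → ℝ × ℝ) (k : ℕ × ℕ) (m : Fin k.2) :
    ℂ → ℂ := fun x =>
  ((Real.sqrt (christoffel κ k.1 (y k.1 k.2 m) / k.2) : ℝ) : ℂ)
    * planeWave κ (y k.1 k.2 m) x

/-- The synthesis operator of a finite family of functions. -/
def synthesis {X : Type*} {n : ℕ} (Φ : Fin n → X → ℂ) (μ : EuclideanSpace ℂ (Fin n)) :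
    X → ℂ := fun x => ∑ l, μ l * Φ l x

/-- The family of finite sets `Φ_k` (of size `n k`) approximates all elements of `B` up to the
relative tolerance `η`, with stability exponent `s` and stability constant `C`. -/
def IsStableWith (κ : ℝ) {ι : Type*} (n : ι → ℕ) (Φ : (k : ι) → Fin (n k) → ℂ → ℂ)
    (η s C : ℝ) : Prop :=
  ∀ u, MemB κ u → ∃ (k : ι) (μ : EuclideanSpace ℂ (Fin (n k))),
    normB κ (u - synthesis (Φ k) μ) ≤ η * normB κ u ∧
    ‖μ‖ ≤ C * (n k : ℝ) ^ s * normB κ u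

/-- The family of finite subsets `Φ_k` of `B` is a stable approximation for `B`. -/
def IsStableApproximation (κ : ℝ) {ι : Type*} (n : ι → ℕ)
    (Φ : (k : ι) → Fin (n k) → ℂ → ℂ) : Prop :=
  (∀ k l, MemB κ (Φ k l)) ∧
    ∀ η : ℝ, 0 < η → ∃ s C : ℝ, 0 ≤ s ∧ 0 ≤ C ∧ IsStableWith κ n Φ η s C

/-- The conjecture on the nodes `y`: for each `P` the normalised sampling functionals are a
stable approximation for `A_P`, with stability exponents `s P` and stability constants `C P`
that are bounded uniformly in `P`. -/
def SamplingConjecture (κ : ℝ) (y : (P M : ℕ) → Fin M → ℝ × ℝ) : Prop :=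
  ∀ η : ℝ, 0 < η → ∃ s C : ℕ → ℝ,
    (∀ P, 0 ≤ s P ∧ 0 ≤ C P) ∧ BddAbove (range s) ∧ BddAbove (range C) ∧
    ∀ P : ℕ, ∀ v ∈ herglotzSpace κ P, ∃ (M : ℕ) (μ : EuclideanSpace ℂ (Fin M)),
      normA κ (v - synthesis (samplingSet κ y P M) μ) ≤ η * normA κ v ∧
      ‖μ‖ ≤ C P * (M : ℝ) ^ s P * normA κ v

/-! ### Boundary sampling with a regularised singular value decomposition -/

/-- The sampling points `e^{2πi s/S}`, `s = 1, …, S`, on the unit circle. -/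
def samplingPoint (S : ℕ) (s : Fin S) : ℂ :=
  Complex.exp (Complex.I * (((2 * Real.pi * ((s : ℕ) + 1) / S : ℝ)) : ℂ))

/-- The matrix of the boundary values of the functions `Φ_l` at the sampling points. -/
def samplingMatrix {n : ℕ} (Φ : Fin n → ℂ → ℂ) (S : ℕ) : Matrix (Fin S) (Fin n) ℂ :=
  Matrix.of fun s l => Φ l (samplingPoint S s)

/-- The vector of the boundary values of `u` at the sampling points. -/
def samplingVector (u : ℂ → ℂ) (S : ℕ) : Fin S → ℂ := fun s => u (samplingPoint S s)

/-- The largest singular value of `A`. -/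
def sigmaMax {S n : ℕ} (A : Matrix (Fin S) (Fin n) ℂ) : ℝ :=
  (Matrix.toEuclideanLin A).singularValues 0

/-- The rectangular diagonal matrix with diagonal `d`. -/
def rectDiagonal (S : ℕ) {n : ℕ} (d : Fin n → ℝ) : Matrix (Fin S) (Fin n) ℂ :=
  Matrix.of fun i j => if (i : ℕ) = (j : ℕ) then (d j : ℂ) else 0

/-- `A = U Σ V*` is a singular value decomposition of `A` (for `S ≥ n`), the singular values
being sorted in descending order. -/
def IsSVD {S n : ℕ} (A : Matrix (Fin S) (Fin n) ℂ) (U : Matrix (Fin S) (Fin S) ℂ)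
    (σ : Fin n → ℝ) (V : Matrix (Fin n) (Fin n) ℂ) : Prop :=
  U ∈ Matrix.unitaryGroup (Fin S) ℂ ∧ V ∈ Matrix.unitaryGroup (Fin n) ℂ ∧
    Antitone σ ∧ (∀ j, 0 ≤ σ j) ∧ A = U * rectDiagonal S σ * V.conjTranspose

open Classical in
/-- `ξ = V Σ_ε† U* b`, where `A = U Σ V*` is a singular value decomposition and all singular
values smaller than `ε σ_max` are replaced by zero. -/
def IsRegularizedSolution {S n : ℕ} (A : Matrix (Fin S) (Fin n) ℂ) (b : Fin S → ℂ) (ε : ℝ)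
    (ξ : EuclideanSpace ℂ (Fin n)) : Prop :=
  ∃ U σ V, IsSVD A U σ V ∧
    ξ = WithLp.toLp 2 ((V * (rectDiagonal S
      (fun j => if ε * sigmaMax A ≤ σ j then (σ j)⁻¹ else 0)).transpose
        * U.conjTranspose).mulVec b)

/-- The regularised sampling method, with `S` boundary samples of `u` and parameter `ε`, yields
an approximation in the span of `Φ` with an `L²(B₁)` error of at most `e`. -/
def ReconstructsWithin {n : ℕ} (Φ : Fin n → ℂ → ℂ) (u : ℂ → ℂ) (S : ℕ) (ε e : ℝ) : Prop :=
  (∃ ξ, IsRegularizedSolution (samplingMatrix Φ S) (samplingVector u S) ε ξ) ∧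
    ∀ ξ, IsRegularizedSolution (samplingMatrix Φ S) (samplingVector u S) ε ξ →
      l2Norm (u - synthesis Φ ξ) ≤ e

end

end EPW

/-!
Why plane waves are a stable approximation. The circular waves `b_p` are an orthonormal basis of
`B` and the Herglotz polynomials `a_p` one of `A`. By the Jacobi-Anger expansion
(`hasSum_planeWave`) the diagonal operator with the multipliers `i^p ‖ã_p‖ ‖b̃_p‖` maps the
sampling functional `K_y` to the plane wave `φ_y`. The multipliers are bounded from above and from
below (`exists_weightMoment_mul_circularEnergy_bounds`): up to constants `‖b̃_p‖²` is
`(κ/2)^{2|p|} (|p| + 1) / |p|!²`, by the leading term of the power series of `J_p`, and the weight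
is chosen so that `‖ã_p‖²` is, by comparison with a Gamma integral, the reciprocal of this. Hence
the operator is an isomorphism, and carries the stable approximations of truncations in `A_P`,
which the conjecture provides, to stable approximations in `B` (`exists_isStableWith`).

Elements of `H¹(B₁)` are handled through their jets `(u, κ⁻¹ ∇u)` in `L²(B₁; ℂ³)`, in which
`normB κ` is the norm; the jets of elements of `B` form the closed span of an orthonormal family
(`memB_iff`, `orthonormal_circularJet`).

Why sampling reconstructs. A continuous `u ∈ B` has the boundary Fourier coefficients
`c_p b_p(1)`, where `c_p` are its coefficients in the basis `b_p` (`inner_fourierLp_circleVec`).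
By Parseval's identity the trace is bounded on `B`, and if no `J_p(κ)` vanishes, then
`‖u‖_{L²(B₁)}` is bounded by the `L²` norm of the trace (`exists_norm_circleVec_le`,
`exists_l2Norm_le`). If some `J_p(κ) = 0`, then `b̃_p` is a Dirichlet eigenfunction
(`isDirichletEigenvalue_of_besselJ_eq_zero`), so that this case is excluded. The residual of the
regularised solution exceeds that of any other coefficient vector `μ` by at most `ε σ_max ‖μ‖`
(`norm_residual_le`), and on the finite-dimensional space spanned by `u` and the plane waves in
use the mean square over sufficiently many equispaced points is equivalent to the squared `L²`
norm on the circle (`exists_meanSquare_equiv`). With `μ` from the stable approximation these facts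
bound the error by a constant times `‖u - T μ‖_B + ε σ_max ‖μ‖ / √S`
(`exists_l2Norm_sub_synthesis_le`).
-/

namespace EPW

open MeasureTheory Set Filter Topology
open scoped ContDiff ComplexConjugate

noncomputable section

/-! ### Circular waves -/

/-- The `n`-th term `wⁿ / n!` of the exponential series. -/
def expTerm (n : ℕ) (w : ℂ) : ℂ := w ^ n / (n.factorial : ℂ)

/-- The derivative of `expTerm n`. -/
def expTermDeriv (n : ℕ) (w : ℂ) : ℂ := n * w ^ (n - 1) / (n.factorial : ℂ)

@[simp] lemma expTermDeriv_zero (w : ℂ) : expTermDeriv 0 w = 0 := by simp [expTermDeriv]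

@[simp] lemma expTermDeriv_succ (n : ℕ) (w : ℂ) : expTermDeriv (n + 1) w = expTerm n w := by
  have h : ((n : ℂ) + 1) ≠ 0 := by exact_mod_cast n.succ_ne_zero
  have h2 : (n.factorial : ℂ) ≠ 0 := by exact_mod_cast n.factorial_ne_zero
  simp only [expTermDeriv, expTerm, Nat.factorial_succ, Nat.add_sub_cancel]
  push_cast
  field_simp

lemma hasDerivAt_expTerm (n : ℕ) (w : ℂ) : HasDerivAt (expTerm n) (expTermDeriv n w) w :=
  (hasDerivAt_pow n w).div_const _

/-- A majorant of `expTerm n` on the ball of radius `r`. -/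
def expBound (r : ℝ) (n : ℕ) : ℝ := r ^ n / n.factorial

/-- A majorant of `expTermDeriv n` on the ball of radius `r`. -/
def expDerivBound (r : ℝ) (n : ℕ) : ℝ := n * r ^ (n - 1) / n.factorial

lemma norm_expTerm_le {r : ℝ} {w : ℂ} (h : ‖w‖ ≤ r) (n : ℕ) : ‖expTerm n w‖ ≤ expBound r n := by
  simp only [expTerm, expBound, norm_div, norm_pow, Complex.norm_natCast]
  gcongr

lemma norm_expTermDeriv_le {r : ℝ} {w : ℂ} (h : ‖w‖ ≤ r) (n : ℕ) :
    ‖expTermDeriv n w‖ ≤ expDerivBound r n := by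
  simp only [expTermDeriv, expDerivBound, norm_div, norm_mul, norm_pow, Complex.norm_natCast]
  gcongr

lemma summable_expBound (r : ℝ) : Summable (expBound r) := Real.summable_pow_div_factorial r

lemma summable_expDerivBound (r : ℝ) : Summable (expDerivBound r) := by
  rw [← summable_nat_add_iff 1]
  refine (summable_expBound r).congr fun n => ?_
  have h2 : (n.factorial : ℝ) ≠ 0 := by exact_mod_cast n.factorial_ne_zero
  simp only [expDerivBound, expBound, Nat.factorial_succ, Nat.add_sub_cancel]
  push_cast
  field_simp

lemma expBound_nonneg {r : ℝ} (hr : 0 ≤ r) (n : ℕ) : 0 ≤ expBound r n := by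
  unfold expBound; positivity

lemma expDerivBound_nonneg {r : ℝ} (hr : 0 ≤ r) (n : ℕ) : 0 ≤ expDerivBound r n := by
  unfold expDerivBound; positivity

lemma hasSum_expTerm (w : ℂ) : HasSum (fun n => expTerm n w) (Complex.exp w) := by
  rw [Complex.exp_eq_exp_ℂ]
  exact NormedSpace.expSeries_div_hasSum_exp w

/-- The constant `iκ/2`. -/
def halfWave (κ : ℝ) : ℂ := Complex.I * κ / 2

/-- The term of bidegree `(a, b)` of `exp (iκ z / 2) exp (iκ z̄ / 2)`. -/
def waveTerm (κ : ℝ) (x : ℕ × ℕ) (z : ℂ) : ℂ :=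
  expTerm x.1 (halfWave κ * z) * expTerm x.2 (halfWave κ * conj z)

lemma norm_halfWave_mul_le {κ r : ℝ} {z : ℂ} (hz : ‖z‖ ≤ r) :
    ‖halfWave κ * z‖ ≤ |κ| / 2 * r := by
  have : ‖halfWave κ‖ = |κ| / 2 := by simp [halfWave]
  rw [norm_mul, this]
  gcongr

lemma norm_halfWave_mul_conj_le {κ r : ℝ} {z : ℂ} (hz : ‖z‖ ≤ r) :
    ‖halfWave κ * conj z‖ ≤ |κ| / 2 * r :=
  norm_halfWave_mul_le (by simpa using hz)

lemma summable_norm_waveTerm (κ : ℝ) (z : ℂ) : Summable fun x => ‖waveTerm κ x z‖ := by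
  have hr : 0 ≤ |κ| / 2 * ‖z‖ := by positivity
  refine Summable.of_nonneg_of_le (fun _ => norm_nonneg _) (fun x => ?_)
    ((summable_expBound (|κ| / 2 * ‖z‖)).mul_of_nonneg (summable_expBound (|κ| / 2 * ‖z‖))
      (expBound_nonneg hr) (expBound_nonneg hr))
  rw [waveTerm, norm_mul]
  exact mul_le_mul (norm_expTerm_le (norm_halfWave_mul_le le_rfl) _)
    (norm_expTerm_le (norm_halfWave_mul_conj_le le_rfl) _) (norm_nonneg _) (expBound_nonneg hr _)

/-- The circular wave `i^p J_p(κ r) e^{ipθ}`, as the part of angular degree `p` of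
`exp (iκ z / 2) exp (iκ z̄ / 2)`. -/
def angularPart (κ : ℝ) (p : ℤ) (z : ℂ) : ℂ :=
  ∑' x : ℕ × ℕ, if (x.1 : ℤ) - x.2 = p then waveTerm κ x z else 0

/-- Multiplication by `a` plus conjugation followed by multiplication by `b`, as a real linear
map: the differential with Wirtinger derivatives `a` and `b`. -/
def wirtinger (a b : ℂ) : ℂ →L[ℝ] ℂ :=
  a • ContinuousLinearMap.id ℝ ℂ + b • (Complex.conjCLE : ℂ →L[ℝ] ℂ)

@[simp] lemma wirtinger_apply (a b v : ℂ) : wirtinger a b v = a * v + b * conj v := by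
  simp [wirtinger]

lemma norm_wirtinger_le (a b : ℂ) : ‖wirtinger a b‖ ≤ ‖a‖ + ‖b‖ := by
  refine ContinuousLinearMap.opNorm_le_bound _ (by positivity) fun v => ?_
  rw [wirtinger_apply]
  refine (norm_add_le _ _).trans ?_
  simp [add_mul]

lemma hasFDerivAt_waveTerm (κ : ℝ) (x : ℕ × ℕ) (z : ℂ) :
    HasFDerivAt (waveTerm κ x) (wirtinger
      (halfWave κ * (expTermDeriv x.1 (halfWave κ * z) * expTerm x.2 (halfWave κ * conj z)))
      (halfWave κ *
        (expTerm x.1 (halfWave κ * z) * expTermDeriv x.2 (halfWave κ * conj z)))) z := by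
  have h1 : HasFDerivAt (𝕜 := ℝ) (fun z : ℂ => halfWave κ * z)
      (halfWave κ • ContinuousLinearMap.id ℝ ℂ) z := (hasFDerivAt_id z).const_mul _
  have h2 : HasFDerivAt (𝕜 := ℝ) (fun z : ℂ => halfWave κ * conj z)
      (halfWave κ • (Complex.conjCLE : ℂ →L[ℝ] ℂ)) z :=
    (Complex.conjCLE : ℂ →L[ℝ] ℂ).hasFDerivAt.const_mul _
  have h3 := ((hasDerivAt_expTerm x.1 (halfWave κ * z)).hasFDerivAt.restrictScalars ℝ).comp z h1
  have h4 :=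
    ((hasDerivAt_expTerm x.2 (halfWave κ * conj z)).hasFDerivAt.restrictScalars ℝ).comp z h2
  refine (h3.mul h4).congr_fderiv ?_
  ext v
  simp
  ring

lemma summable_waveTerm_ite (κ : ℝ) (p : ℤ) (z : ℂ) :
    Summable fun x : ℕ × ℕ => if (x.1 : ℤ) - x.2 = p then waveTerm κ x z else 0 := by
  refine Summable.of_norm_bounded (summable_norm_waveTerm κ z) fun x => ?_
  split_ifs <;> simp

lemma hasSum_angularPart (κ : ℝ) (p : ℤ) (z : ℂ) :
    HasSum (fun x : ℕ × ℕ => if (x.1 : ℤ) - x.2 = p then waveTerm κ x z else 0)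
      (angularPart κ p z) := (summable_waveTerm_ite κ p z).hasSum

lemma hasSum_angularPart_sub_one (κ : ℝ) (p : ℤ) (z : ℂ) :
    HasSum (fun x : ℕ × ℕ => if (x.1 : ℤ) - x.2 = p then
      expTermDeriv x.1 (halfWave κ * z) * expTerm x.2 (halfWave κ * conj z) else 0)
      (angularPart κ (p - 1) z) := by
  have hinj : Function.Injective fun x : ℕ × ℕ => (x.1 + 1, x.2) := by
    rintro ⟨a, b⟩ ⟨c, d⟩ h
    simpa using h
  rw [← hinj.hasSum_iff]
  · convert hasSum_angularPart κ (p - 1) z using 2 with x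
    have : ((x.1 : ℤ) - x.2 = p - 1) ↔ (((x.1 + 1 : ℕ) : ℤ) - x.2 = p) := by
      push_cast; constructor <;> intro h <;> linarith
    simp [this, waveTerm]
  · rintro ⟨a, b⟩ h
    cases a with
    | zero => simp
    | succ a => exact absurd ⟨(a, b), rfl⟩ h

lemma hasSum_angularPart_add_one (κ : ℝ) (p : ℤ) (z : ℂ) :
    HasSum (fun x : ℕ × ℕ => if (x.1 : ℤ) - x.2 = p then
      expTerm x.1 (halfWave κ * z) * expTermDeriv x.2 (halfWave κ * conj z) else 0)
      (angularPart κ (p + 1) z) := by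
  have hinj : Function.Injective fun x : ℕ × ℕ => (x.1, x.2 + 1) := by
    rintro ⟨a, b⟩ ⟨c, d⟩ h
    simpa using h
  rw [← hinj.hasSum_iff]
  · convert hasSum_angularPart κ (p + 1) z using 2 with x
    have : ((x.1 : ℤ) - x.2 = p + 1) ↔ ((x.1 : ℤ) - ((x.2 + 1 : ℕ) : ℤ) = p) := by
      push_cast; constructor <;> intro h <;> linarith
    simp [this, waveTerm]
  · rintro ⟨a, b⟩ h
    cases b with
    | zero => simp
    | succ b => exact absurd ⟨(a, b), rfl⟩ h

/-- The differential of the term of bidegree `x`, if this has angular degree `p`. -/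
def waveTermFDeriv (κ : ℝ) (p : ℤ) (x : ℕ × ℕ) (w : ℂ) : ℂ →L[ℝ] ℂ :=
  if (x.1 : ℤ) - x.2 = p then wirtinger
      (halfWave κ * (expTermDeriv x.1 (halfWave κ * w) * expTerm x.2 (halfWave κ * conj w)))
      (halfWave κ * (expTerm x.1 (halfWave κ * w) * expTermDeriv x.2 (halfWave κ * conj w)))
    else 0

lemma norm_waveTermFDeriv_le {κ R : ℝ} (hR0 : 0 ≤ R) (p : ℤ) (x : ℕ × ℕ) {w : ℂ} (hw : ‖w‖ ≤ R) :
    ‖waveTermFDeriv κ p x w‖ ≤ ‖halfWave κ‖ *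
      (expDerivBound (|κ| / 2 * R) x.1 * expBound (|κ| / 2 * R) x.2 +
        expBound (|κ| / 2 * R) x.1 * expDerivBound (|κ| / 2 * R) x.2) := by
  have hR : 0 ≤ |κ| / 2 * R := by positivity
  have k1 := norm_halfWave_mul_le (κ := κ) hw
  have k2 := norm_halfWave_mul_conj_le (κ := κ) hw
  have b1 := expBound_nonneg hR
  have b2 := expDerivBound_nonneg hR
  have i1 : ‖expTermDeriv x.1 (halfWave κ * w) * expTerm x.2 (halfWave κ * conj w)‖ ≤
      expDerivBound (|κ| / 2 * R) x.1 * expBound (|κ| / 2 * R) x.2 := by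
    rw [norm_mul]
    exact mul_le_mul (norm_expTermDeriv_le k1 _) (norm_expTerm_le k2 _) (norm_nonneg _) (b2 _)
  have i2 : ‖expTerm x.1 (halfWave κ * w) * expTermDeriv x.2 (halfWave κ * conj w)‖ ≤
      expBound (|κ| / 2 * R) x.1 * expDerivBound (|κ| / 2 * R) x.2 := by
    rw [norm_mul]
    exact mul_le_mul (norm_expTerm_le k1 _) (norm_expTermDeriv_le k2 _) (norm_nonneg _) (b1 _)
  rw [waveTermFDeriv]
  split_ifs
  · refine (norm_wirtinger_le _ _).trans ?_
    rw [norm_mul (halfWave κ), norm_mul (halfWave κ), ← mul_add]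
    exact mul_le_mul_of_nonneg_left (add_le_add i1 i2) (norm_nonneg _)
  · rw [norm_zero]
    exact mul_nonneg (norm_nonneg _) (add_nonneg (mul_nonneg (b2 _) (b1 _))
      (mul_nonneg (b1 _) (b2 _)))

/-- The Wirtinger derivatives lower and raise the angular degree by one. -/
lemma hasFDerivAt_angularPart (κ : ℝ) (p : ℤ) (z : ℂ) :
    HasFDerivAt (angularPart κ p) (wirtinger (halfWave κ * angularPart κ (p - 1) z)
      (halfWave κ * angularPart κ (p + 1) z)) z := by
  have hR0 : 0 ≤ ‖z‖ + 1 := by positivity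
  have hR : 0 ≤ |κ| / 2 * (‖z‖ + 1) := by positivity
  have hz : z ∈ Metric.ball (0 : ℂ) (‖z‖ + 1) := by simp
  have hb := ((summable_expDerivBound (|κ| / 2 * (‖z‖ + 1))).mul_of_nonneg
    (summable_expBound (|κ| / 2 * (‖z‖ + 1))) (expDerivBound_nonneg hR) (expBound_nonneg hR)).add
    ((summable_expBound (|κ| / 2 * (‖z‖ + 1))).mul_of_nonneg
    (summable_expDerivBound (|κ| / 2 * (‖z‖ + 1))) (expBound_nonneg hR) (expDerivBound_nonneg hR))
  have hsum : HasSum (fun x => waveTermFDeriv κ p x z) (wirtinger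
      (halfWave κ * angularPart κ (p - 1) z) (halfWave κ * angularPart κ (p + 1) z)) := by
    have e3 := (((hasSum_angularPart_sub_one κ p z).mul_left (halfWave κ)).smul_const
      (ContinuousLinearMap.id ℝ ℂ)).add
      (((hasSum_angularPart_add_one κ p z).mul_left (halfWave κ)).smul_const
        (Complex.conjCLE : ℂ →L[ℝ] ℂ))
    rw [wirtinger]
    convert e3 using 2 with x
    rw [waveTermFDeriv]
    split_ifs <;> simp [wirtinger]
  rw [← hsum.tsum_eq]
  refine hasFDerivAt_tsum_of_isPreconnected (𝕜 := ℝ)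
    (f := fun x z => if (x.1 : ℤ) - x.2 = p then waveTerm κ x z else 0)
    (hb.mul_left ‖halfWave κ‖) Metric.isOpen_ball
    (convex_ball (0 : ℂ) (‖z‖ + 1)).isPreconnected
    (fun x w _ => ?_) (fun x w hw => norm_waveTermFDeriv_le hR0 p x (mem_ball_zero_iff.mp hw).le)
    hz (summable_waveTerm_ite κ p z) hz
  rw [waveTermFDeriv]
  split_ifs
  · exact hasFDerivAt_waveTerm κ x w
  · exact hasFDerivAt_const _ _

lemma hasSum_tsum_ite {α β : Type*} [DecidableEq β] {f : α → ℂ} {a : ℂ} (hf : HasSum f a)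
    (g : α → β) : HasSum (fun b => ∑' x, if g x = b then f x else 0) a := by
  have e : (fun b => ∑' x, if g x = b then f x else 0) = fun b => ∑' x : g ⁻¹' {b}, f x := by
    funext b
    rw [_root_.tsum_subtype (g ⁻¹' {b}) f]
    refine tsum_congr fun x => ?_
    by_cases h : g x = b
    · rw [if_pos h, Set.indicator_of_mem (by simpa using h)]
    · rw [if_neg h, Set.indicator_of_notMem (by simpa using h)]
  rw [e]
  exact hf.tsum_fiberwise g

/-- The complex parameter `exp (ζ - iφ)` of an evanescent plane wave. -/
def waveParam (y : ℝ × ℝ) : ℂ := Complex.exp ((y.2 : ℂ) - Complex.I * y.1)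

lemma waveParam_ne_zero (y : ℝ × ℝ) : waveParam y ≠ 0 := Complex.exp_ne_zero _

lemma conj_herglotzTilde (p : ℤ) (y : ℝ × ℝ) : conj (herglotzTilde p y) = waveParam y ^ p := by
  rw [herglotzTilde, map_mul, ← Complex.exp_conj, ← Complex.exp_conj, ← Complex.exp_add,
    waveParam, ← Complex.exp_int_mul]
  congr 1
  simp
  ring

lemma planeWave_eq (κ : ℝ) (y : ℝ × ℝ) (z : ℂ) : planeWave κ y z =
    Complex.exp (halfWave κ * z * waveParam y) *
      Complex.exp (halfWave κ * conj z * (waveParam y)⁻¹) := by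
  set s : ℂ := (y.1 : ℂ) + Complex.I * (y.2 : ℂ)
  have hz : z = z.re + z.im * Complex.I := (Complex.re_add_im z).symm
  have hz' : conj z = z.re - z.im * Complex.I := by apply Complex.ext <;> simp
  have e1 : (waveParam y)⁻¹ = Complex.cos s + Complex.sin s * Complex.I := by
    rw [← Complex.exp_mul_I, waveParam, ← Complex.exp_neg]
    congr 1
    linear_combination (-y.2 : ℂ) * Complex.I_sq
  have e2 : waveParam y = Complex.cos s - Complex.sin s * Complex.I := by
    have := Complex.exp_mul_I (-s)
    rw [Complex.cos_neg, Complex.sin_neg] at this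
    rw [sub_eq_add_neg, ← neg_mul, ← this, waveParam]
    congr 1
    linear_combination (y.2 : ℂ) * Complex.I_sq
  rw [← Complex.exp_add, planeWave, e1, e2, hz', halfWave]
  congr 1
  nth_rewrite 3 [hz]
  linear_combination (Complex.I * κ * Complex.sin s * z.im) * Complex.I_sq

lemma summable_norm_expTerm (w : ℂ) : Summable fun n => ‖expTerm n w‖ :=
  Summable.of_nonneg_of_le (fun _ => norm_nonneg _) (norm_expTerm_le le_rfl) (summable_expBound _)

lemma hasSum_exp_mul_exp (w₁ w₂ : ℂ) :
    HasSum (fun x : ℕ × ℕ => expTerm x.1 w₁ * expTerm x.2 w₂)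
      (Complex.exp w₁ * Complex.exp w₂) := by
  have h : Summable fun x : ℕ × ℕ => (fun n => expTerm n w₁) x.1 * (fun n => expTerm n w₂) x.2 :=
    summable_mul_of_summable_norm (f := fun n => expTerm n w₁) (g := fun n => expTerm n w₂)
      (summable_norm_expTerm w₁) (summable_norm_expTerm w₂)
  exact HasSum.mul (f := fun n => expTerm n w₁) (g := fun n => expTerm n w₂)
    (hasSum_expTerm w₁) (hasSum_expTerm w₂) h

lemma zpow_mul_waveTerm (κ : ℝ) (z : ℂ) {q : ℂ} (hq : q ≠ 0) (x : ℕ × ℕ) :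
    q ^ ((x.1 : ℤ) - x.2) * waveTerm κ x z =
      expTerm x.1 (halfWave κ * z * q) * expTerm x.2 (halfWave κ * conj z * q⁻¹) := by
  rw [zpow_sub₀ hq, zpow_natCast, zpow_natCast]
  simp only [waveTerm, expTerm, mul_pow, inv_pow]
  field_simp

/-- The Jacobi–Anger expansion, in terms of angular parts. -/
lemma hasSum_planeWave_angularPart (κ : ℝ) (y : ℝ × ℝ) (z : ℂ) :
    HasSum (fun p : ℤ => conj (herglotzTilde p y) * angularPart κ p z) (planeWave κ y z) := by
  have hs : HasSum (fun x : ℕ × ℕ => waveParam y ^ ((x.1 : ℤ) - x.2) * waveTerm κ x z)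
      (planeWave κ y z) := by
    have h := hasSum_exp_mul_exp (halfWave κ * z * waveParam y)
      (halfWave κ * conj z * (waveParam y)⁻¹)
    rw [← planeWave_eq] at h
    have e : (fun x : ℕ × ℕ => waveParam y ^ ((x.1 : ℤ) - x.2) * waveTerm κ x z) = fun x =>
        expTerm x.1 (halfWave κ * z * waveParam y) *
          expTerm x.2 (halfWave κ * conj z * (waveParam y)⁻¹) :=
      funext (zpow_mul_waveTerm κ z (waveParam_ne_zero y))
    rw [e]
    exact h
  have e : (fun p : ℤ => conj (herglotzTilde p y) * angularPart κ p z) = fun p => ∑' x : ℕ × ℕ,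
      if (x.1 : ℤ) - x.2 = p then waveParam y ^ ((x.1 : ℤ) - x.2) * waveTerm κ x z else 0 := by
    funext p
    rw [conj_herglotzTilde, angularPart, ← tsum_mul_left]
    refine tsum_congr fun x => ?_
    split_ifs with h
    · rw [h]
    · simp
  rw [e]
  exact hasSum_tsum_ite hs _

/-- A circular wave is, up to the unit factor `i^p`, an angular part of a plane wave. -/
lemma angularPart_eq (κ : ℝ) (p : ℤ) (z : ℂ) :
    angularPart κ p z = Complex.I ^ p * circularWaveTilde κ p z := by
  have hinj : Function.Injective fun m : ℕ => (m + p.toNat, m + (-p).toNat) := by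
    intro a b h
    simpa using h
  have h1 : angularPart κ p z = ∑' m : ℕ, waveTerm κ (m + p.toNat, m + (-p).toNat) z := by
    rw [angularPart, ← hinj.tsum_eq]
    · refine tsum_congr fun m => ?_
      rw [if_pos]
      push_cast
      omega
    · intro x hx
      have : (x.1 : ℤ) - x.2 = p := by
        by_contra h
        simp [h] at hx
      refine ⟨min x.1 x.2, ?_⟩
      ext
      · simp only; omega
      · simp only; omega
  rw [h1, circularWaveTilde, besselJ]
  push_cast
  rw [← tsum_mul_left, ← tsum_mul_right, ← tsum_mul_left]
  refine tsum_congr fun m => ?_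
  set w := Complex.exp (Complex.arg z * Complex.I) with hw
  have hw0 : w ≠ 0 := Complex.exp_ne_zero _
  have hz : z = ‖z‖ * w := (Complex.norm_mul_exp_arg_mul_I z).symm
  have hz' : conj z = ‖z‖ * w⁻¹ := by
    conv_lhs => rw [hz]
    rw [map_mul, hw, ← Complex.exp_neg, ← Complex.exp_conj]
    simp
  have hexp : Complex.exp (Complex.I * p * Complex.arg z) = w ^ p := by
    rw [hw, ← Complex.exp_int_mul]
    congr 1
    ring
  have hfac : (m.factorial : ℂ) ≠ 0 := by exact_mod_cast m.factorial_ne_zero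
  have hI : Complex.I ^ 2 = -1 := Complex.I_sq
  have hI0 := Complex.I_ne_zero
  rw [hexp, waveTerm, expTerm, expTerm, hz', halfWave]
  set r : ℂ := (‖z‖ : ℂ)
  rw [show z = r * w from hz]
  clear_value w r
  rcases lt_or_ge p 0 with hp | hp
  · obtain ⟨n, rfl⟩ : ∃ n : ℕ, p = -(n : ℤ) := ⟨(-p).toNat, by omega⟩
    have hfac2 : ((m + n).factorial : ℂ) ≠ 0 := by exact_mod_cast (m + n).factorial_ne_zero
    have h0 : (-(n : ℤ)).toNat = 0 := by omega
    have h2 : (-1 : ℂ) ^ n = Complex.I ^ n * Complex.I ^ n := by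
      rw [← hI, ← pow_mul, ← pow_add]; congr 1; ring
    have h3 : (-1 : ℂ) ^ m = Complex.I ^ m * Complex.I ^ m := by
      rw [← hI, ← pow_mul, ← pow_add]; congr 1; ring
    simp only [hp, if_true, h0, neg_neg, Int.toNat_natCast, Int.natAbs_neg, Int.natAbs_natCast,
      add_zero, zpow_neg, zpow_natCast, h3]
    push_cast
    field_simp
    simp only [mul_pow, div_pow, pow_add, two_mul]
    field_simp
    rw [h2, one_add_one_eq_two]
    ring
  · obtain ⟨n, rfl⟩ : ∃ n : ℕ, p = (n : ℤ) := ⟨p.toNat, by omega⟩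
    have hfac2 : ((m + n).factorial : ℂ) ≠ 0 := by exact_mod_cast (m + n).factorial_ne_zero
    have h0 : (-(n : ℤ)).toNat = 0 := by omega
    have h3 : (-1 : ℂ) ^ m = Complex.I ^ m * Complex.I ^ m := by
      rw [← hI, ← pow_mul, ← pow_add]; congr 1; ring
    simp only [not_lt.mpr hp, if_false, h0, Int.toNat_natCast, Int.natAbs_natCast,
      add_zero, zpow_natCast, h3]
    push_cast
    field_simp
    simp only [mul_pow, div_pow, pow_add, two_mul]
    field_simp
    rw [one_add_one_eq_two]
    ring


lemma circularWaveTilde_eq (κ : ℝ) (p : ℤ) :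
    circularWaveTilde κ p = fun z => Complex.I ^ (-p) * angularPart κ p z := by
  funext z
  rw [angularPart_eq, ← mul_assoc, ← zpow_add₀ Complex.I_ne_zero]
  simp

lemma hasFDerivAt_circularWaveTilde (κ : ℝ) (p : ℤ) (z : ℂ) :
    HasFDerivAt (circularWaveTilde κ p) (wirtinger (κ / 2 * circularWaveTilde κ (p - 1) z)
      (-(κ / 2) * circularWaveTilde κ (p + 1) z)) z := by
  have h := (hasFDerivAt_angularPart κ p z).const_mul (Complex.I ^ (-p))
  rw [circularWaveTilde_eq κ p]
  refine h.congr_fderiv ?_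
  have hI := Complex.I_ne_zero
  ext v
  simp only [smul_apply, wirtinger_apply, angularPart_eq, halfWave,
    zpow_sub₀ hI, zpow_add₀ hI, zpow_neg, zpow_one, smul_eq_mul]
  have hp : Complex.I ^ p ≠ 0 := zpow_ne_zero _ hI
  field_simp
  linear_combination
    (-(κ : ℂ) * (conj v * circularWaveTilde κ (p + 1) z)) * (-Complex.I_sq)

lemma differentiable_circularWaveTilde (κ : ℝ) (p : ℤ) :
    Differentiable ℝ (circularWaveTilde κ p) :=
  fun z => (hasFDerivAt_circularWaveTilde κ p z).differentiableAt

lemma continuous_circularWaveTilde (κ : ℝ) (p : ℤ) : Continuous (circularWaveTilde κ p) :=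
  (differentiable_circularWaveTilde κ p).continuous

lemma contDiff_circularWaveTilde (κ : ℝ) (p : ℤ) : ContDiff ℝ ∞ (circularWaveTilde κ p) := by
  rw [contDiff_infty]
  intro n
  induction n generalizing p with
  | zero => exact contDiff_zero.mpr (continuous_circularWaveTilde κ p)
  | succ n ih =>
    push_cast
    rw [contDiff_succ_iff_fderiv]
    refine ⟨differentiable_circularWaveTilde κ p, by simp, ?_⟩
    have : fderiv ℝ (circularWaveTilde κ p) = fun z =>
        (κ / 2 * circularWaveTilde κ (p - 1) z) • ContinuousLinearMap.id ℝ ℂ +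
        (-(κ / 2) * circularWaveTilde κ (p + 1) z) • (Complex.conjCLE : ℂ →L[ℝ] ℂ) :=
      funext fun z => (hasFDerivAt_circularWaveTilde κ p z).fderiv
    rw [this]
    exact ((contDiff_const.mul (ih _)).smul contDiff_const).add
      ((contDiff_const.mul (ih _)).smul contDiff_const)

lemma partialDeriv_zero_circularWaveTilde (κ : ℝ) (p : ℤ) (z : ℂ) :
    partialDeriv 0 (circularWaveTilde κ p) z =
      κ / 2 * (circularWaveTilde κ (p - 1) z - circularWaveTilde κ (p + 1) z) := by
  rw [partialDeriv, (hasFDerivAt_circularWaveTilde κ p z).fderiv, wirtinger_apply]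
  simp [dir]
  ring

lemma partialDeriv_one_circularWaveTilde (κ : ℝ) (p : ℤ) (z : ℂ) :
    partialDeriv 1 (circularWaveTilde κ p) z =
      κ / 2 * Complex.I * (circularWaveTilde κ (p - 1) z + circularWaveTilde κ (p + 1) z) := by
  rw [partialDeriv, (hasFDerivAt_circularWaveTilde κ p z).fderiv, wirtinger_apply]
  simp [dir]
  ring

/-- The Jacobi–Anger expansion of an evanescent plane wave. -/
lemma hasSum_planeWave (κ : ℝ) (y : ℝ × ℝ) (z : ℂ) :
    HasSum (fun p : ℤ => conj (herglotzTilde p y) * Complex.I ^ p * circularWaveTilde κ p z)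
      (planeWave κ y z) := by
  have h := hasSum_planeWave_angularPart κ y z
  simp_rw [angularPart_eq, ← mul_assoc] at h
  exact h

lemma circularWaveTilde_rotate (κ : ℝ) (p : ℤ) (a : ℝ) (z : ℂ) :
    circularWaveTilde κ p (Complex.exp (a * Complex.I) * z) =
      Complex.exp (a * Complex.I) ^ p * circularWaveTilde κ p z := by
  have h0 := Complex.exp_ne_zero (a * Complex.I)
  have hc : conj (Complex.exp (a * Complex.I)) = (Complex.exp (a * Complex.I))⁻¹ := by
    rw [← Complex.exp_conj, ← Complex.exp_neg]
    simp
  simp only [circularWaveTilde_eq, angularPart]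
  rw [mul_left_comm, ← tsum_mul_left (a := Complex.exp (a * Complex.I) ^ p)]
  congr 1
  refine tsum_congr fun x => ?_
  split_ifs with h
  · rw [← h, zpow_mul_waveTerm _ _ h0, waveTerm, map_mul, hc]
    congr 2 <;> ring
  · simp

lemma abs_besselJ_natAbs (p : ℤ) (t : ℝ) : |besselJ p t| = |besselJ p.natAbs t| := by
  simp only [besselJ, abs_mul, Int.natCast_natAbs, Int.natAbs_abs]
  congr 1
  split_ifs <;> simp

lemma norm_circularWaveTilde (κ : ℝ) (p : ℤ) (z : ℂ) :
    ‖circularWaveTilde κ p z‖ = |besselJ p.natAbs (κ * ‖z‖)| := by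
  rw [circularWaveTilde, norm_mul, Complex.norm_real, Real.norm_eq_abs, abs_besselJ_natAbs,
    show Complex.I * (p : ℂ) * (Complex.arg z : ℂ) = ((p * Complex.arg z : ℝ) : ℂ) * Complex.I by
      push_cast; ring, Complex.norm_exp_ofReal_mul_I, mul_one]

lemma hasSum_real_exp (x : ℝ) : HasSum (fun m : ℕ => x ^ m / (m.factorial : ℝ)) (Real.exp x) := by
  rw [Real.exp_eq_exp_ℝ]
  exact NormedSpace.expSeries_div_hasSum_exp x

/-- The first term dominates the power series of `J_n` for large `n` or small `t`. -/
lemma abs_besselJ_sub_le (n : ℕ) {t : ℝ} (ht : 0 ≤ t) :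
    |besselJ n t - (t / 2) ^ n / n.factorial| ≤
      (t / 2) ^ n / n.factorial * ((Real.exp (t ^ 2 / 4) - 1) / (n + 1)) := by
  set f : ℕ → ℝ := fun m => (-1) ^ m / ((m.factorial : ℝ) * ((m + n).factorial : ℝ))
      * (t / 2) ^ (2 * m + n) with hf
  have hJ : besselJ n t = ∑' m, f m := by simp [besselJ, hf]
  set g : ℕ → ℝ := fun m => (t / 2) ^ n / n.factorial * ((t ^ 2 / 4) ^ m / m.factorial) with hg
  have hexp : HasSum g ((t / 2) ^ n / n.factorial * Real.exp (t ^ 2 / 4)) := by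
    exact (hasSum_real_exp (t ^ 2 / 4)).mul_left _
  have hfac (k : ℕ) : (0 : ℝ) < k.factorial := by exact_mod_cast k.factorial_pos
  have habs (m : ℕ) : |f m| = (t / 2) ^ n * (t ^ 2 / 4) ^ m /
      (m.factorial * (m + n).factorial) := by
    have h1 := hfac m
    have h2 := hfac (m + n)
    rw [hf]
    simp only [abs_mul, abs_div, abs_pow, abs_neg, abs_one, one_pow, abs_of_pos h1, abs_of_pos h2,
      abs_of_nonneg (div_nonneg ht zero_le_two)]
    rw [pow_add, pow_mul, show (t / 2) ^ 2 = t ^ 2 / 4 by ring]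
    ring
  have hle (m : ℕ) : |f m| ≤ g m := by
    rw [habs, hg]
    have h1 := hfac m
    have h2 := hfac n
    have h3 : (n.factorial : ℝ) ≤ (m + n).factorial := by
      exact_mod_cast Nat.factorial_le (Nat.le_add_left _ _)
    beta_reduce
    rw [div_mul_div_comm, mul_comm (n.factorial : ℝ)]
    gcongr
  have hle' (m : ℕ) : |f (m + 1)| ≤ g (m + 1) / (n + 1) := by
    rw [habs, hg]
    have h1 := hfac (m + 1)
    have h2 := hfac n
    have h3 : ((n.factorial : ℝ) * (n + 1)) ≤ (m + 1 + n).factorial := by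
      have : (n + 1).factorial ≤ (m + 1 + n).factorial := Nat.factorial_le (by omega)
      rw [Nat.factorial_succ, mul_comm] at this
      exact_mod_cast this
    beta_reduce
    rw [div_mul_div_comm, div_div, mul_comm (n.factorial : ℝ), mul_assoc]
    gcongr
  have hfs : Summable f := Summable.of_norm_bounded hexp.summable hle
  have h0 : f 0 = (t / 2) ^ n / n.factorial := by simp [hf]; ring
  rw [hJ, hfs.tsum_eq_zero_add, h0, add_sub_cancel_left]
  have hgs : HasSum (fun m => g (m + 1) / (n + 1))
      ((t / 2) ^ n / n.factorial * ((Real.exp (t ^ 2 / 4) - 1) / (n + 1))) := by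
    have := ((hasSum_nat_add_iff' 1).mpr hexp).div_const ((n : ℝ) + 1)
    have e : (t / 2) ^ n / n.factorial * ((Real.exp (t ^ 2 / 4) - 1) / (n + 1)) =
        ((t / 2) ^ n / n.factorial * Real.exp (t ^ 2 / 4) - ∑ i ∈ Finset.range 1, g i) /
          ((n : ℝ) + 1) := by
      simp [hg]
      ring
    rw [e]
    exact this
  rw [← Real.norm_eq_abs]
  exact tsum_of_norm_bounded hgs hle'

lemma abs_besselJ_le (n : ℕ) {t : ℝ} (ht : 0 ≤ t) :
    |besselJ n t| ≤ (t / 2) ^ n / n.factorial * Real.exp (t ^ 2 / 4) := by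
  have h := abs_besselJ_sub_le n ht
  have h1 : 0 ≤ (t / 2) ^ n / n.factorial := by positivity
  have h2 : 0 ≤ Real.exp (t ^ 2 / 4) - 1 := by
    have := Real.add_one_le_exp (t ^ 2 / 4)
    nlinarith [sq_nonneg t]
  have h3 : (Real.exp (t ^ 2 / 4) - 1) / (n + 1) ≤ Real.exp (t ^ 2 / 4) - 1 :=
    div_le_self h2 (by linarith [(Nat.cast_nonneg n : (0 : ℝ) ≤ n)])
  have h4 := mul_le_mul_of_nonneg_left h3 h1
  have h5 := abs_sub_abs_le_abs_sub (besselJ n t) ((t / 2) ^ n / n.factorial)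
  rw [abs_of_nonneg h1] at h5
  linarith

lemma le_abs_besselJ {n : ℕ} {t : ℝ} (ht : 0 ≤ t)
    (h : 2 * (Real.exp (t ^ 2 / 4) - 1) ≤ n + 1) :
    (t / 2) ^ n / n.factorial / 2 ≤ |besselJ n t| := by
  have h0 := abs_besselJ_sub_le n ht
  have h1 : 0 ≤ (t / 2) ^ n / n.factorial := by positivity
  have h3 : (Real.exp (t ^ 2 / 4) - 1) / (n + 1) ≤ 1 / 2 := by
    rw [div_le_iff₀ (by positivity)]
    linarith
  have h4 := mul_le_mul_of_nonneg_left h3 h1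
  have h5 := abs_sub_abs_le_abs_sub ((t / 2) ^ n / n.factorial) (besselJ n t)
  rw [abs_of_nonneg h1, abs_sub_comm] at h5
  linarith


/-! ### `H¹(B₁)` as a space of square integrable jets -/

/-- The values of first-order jets. -/
abbrev JetVal := EuclideanSpace ℂ (Fin 3)

/-- Square integrable fields of first-order jets on the disk. -/
abbrev JetSpace := Lp JetVal 2 diskMeasure

instance : IsFiniteMeasure diskMeasure := by
  unfold diskMeasure disk
  exact ⟨by simp⟩

/-- The square of the norm of `L²` as an integral. -/
lemma Lp_norm_sq {α E : Type*} [MeasurableSpace α] {μ : Measure α} [NormedAddCommGroup E]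
    [InnerProductSpace ℂ E] (f : Lp E 2 μ) : ‖f‖ ^ 2 = ∫ x, ‖f x‖ ^ 2 ∂μ := by
  have h := L2.inner_def (𝕜 := ℂ) f f
  rw [inner_self_eq_norm_sq_to_K] at h
  simp_rw [inner_self_eq_norm_sq_to_K] at h
  exact_mod_cast h

lemma memLp_of_continuous {E : Type*} [NormedAddCommGroup E] {f : ℂ → E} (hf : Continuous f) :
    MemLp f 2 diskMeasure := by
  obtain ⟨C, hC⟩ := (isCompact_closedBall (0 : ℂ) 1).exists_bound_of_continuousOn hf.continuousOn
  refine MemLp.of_bound (hf.aestronglyMeasurable) C ?_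
  refine (ae_restrict_iff' Metric.isOpen_ball.measurableSet).mpr (.of_forall fun x hx => ?_)
  exact hC x (Metric.ball_subset_closedBall hx)

lemma setIntegral_disk_eq {h : ℂ → ℂ} (hh : ∀ x, x ∉ disk → h x = 0) :
    ∫ x, h x ∂diskMeasure = ∫ x, h x :=
  setIntegral_eq_integral_of_forall_compl_eq_zero hh

/-- The jet `(u, κ⁻¹ g)`. -/
def jetFun (κ : ℝ) (u : ℂ → ℂ) (g : ℂ → EuclideanSpace ℂ (Fin 2)) (x : ℂ) : JetVal :=
  WithLp.toLp 2 ![u x, (κ : ℂ)⁻¹ * g x 0, (κ : ℂ)⁻¹ * g x 1]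

lemma memLp_jetFun {κ : ℝ} {u : ℂ → ℂ} {g : ℂ → EuclideanSpace ℂ (Fin 2)}
    (hu : MemLp u 2 diskMeasure) (hg : MemLp g 2 diskMeasure) :
    MemLp (jetFun κ u g) 2 diskMeasure := by
  refine MemLp.of_eval_piLp fun i => ?_
  fin_cases i
  · exact hu
  · exact (hg.eval_piLp 0).const_mul _
  · exact (hg.eval_piLp 1).const_mul _

/-- The field tested against jets to express the weak relation between the components. -/
def jetTestFun (κ : ℝ) (j : Fin 2) (f : ℂ → ℂ) (x : ℂ) : JetVal :=
  EuclideanSpace.single 0 (conj (partialDeriv j f x)) +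
    EuclideanSpace.single j.succ (κ * conj (f x))

lemma inner_jetTestFun (κ : ℝ) (j : Fin 2) (f : ℂ → ℂ) (x : ℂ) (v : JetVal) :
    inner ℂ (jetTestFun κ j f x) v = v 0 * partialDeriv j f x + κ * (v j.succ * f x) := by
  simp [jetTestFun, EuclideanSpace.inner_single_left]
  ring

lemma continuous_partialDeriv {f : ℂ → ℂ} (hf : ContDiff ℝ ∞ f) (j : Fin 2) :
    Continuous (partialDeriv j f) :=
  (hf.continuous_fderiv (by simp)).clm_apply continuous_const

lemma memLp_jetTestFun (κ : ℝ) (j : Fin 2) {f : ℂ → ℂ} (hf : IsTestFunction f) :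
    MemLp (jetTestFun κ j f) 2 diskMeasure := by
  refine memLp_of_continuous ?_
  have h1 := continuous_partialDeriv hf.1 j
  have h2 := hf.1.continuous
  have hs (i : Fin 3) {g : ℂ → ℂ} (hg : Continuous g) :
      Continuous fun x => (EuclideanSpace.single i (g x) : JetVal) := by
    refine (PiLp.continuous_toLp 2 _).comp (continuous_pi fun k => ?_)
    by_cases h : k = i
    · subst h; simpa using hg
    · simp [h]; exact continuous_const
  exact (hs 0 (Complex.continuous_conj.comp h1)).add
    (hs j.succ (continuous_const.mul (Complex.continuous_conj.comp h2)))

/-- The element of `JetSpace` whose orthogonality to a jet field expresses that the `j`-th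
derivative is a weak derivative, tested with `f`. -/
def jetTest (κ : ℝ) (j : Fin 2) {f : ℂ → ℂ} (hf : IsTestFunction f) : JetSpace :=
  (memLp_jetTestFun κ j hf).toLp _

/-- `F` is the jet field `(u, κ⁻¹ ∇u)`. -/
def HasJet (κ : ℝ) (u : ℂ → ℂ) (F : JetSpace) : Prop :=
  (∀ᵐ x ∂diskMeasure, F x 0 = u x) ∧
    ∀ (j : Fin 2) (f : ℂ → ℂ) (hf : IsTestFunction f), inner ℂ (jetTest κ j hf) F = 0

lemma inner_jetTest (κ : ℝ) (j : Fin 2) {f : ℂ → ℂ} (hf : IsTestFunction f) (F : JetSpace) :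
    inner ℂ (jetTest κ j hf) F =
      (∫ x, F x 0 * partialDeriv j f x ∂diskMeasure) + κ * ∫ x, F x j.succ * f x ∂diskMeasure := by
  have hF (i : Fin 3) : MemLp (fun x => F x i) 2 diskMeasure := (Lp.memLp F).eval_piLp i
  have h1 : MemLp (partialDeriv j f) 2 diskMeasure :=
    memLp_of_continuous (continuous_partialDeriv hf.1 j)
  have h2 : MemLp f 2 diskMeasure := memLp_of_continuous hf.1.continuous
  rw [L2.inner_def, ← integral_const_mul, ← integral_add]
  · refine integral_congr_ae ?_
    filter_upwards [(memLp_jetTestFun κ j hf).coeFn_toLp] with x hx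
    rw [jetTest, hx, inner_jetTestFun]
  · exact (hF 0).integrable_mul h1
  · exact ((hF j.succ).integrable_mul h2).const_mul _

lemma HasJet.sub {κ : ℝ} {u v : ℂ → ℂ} {F G : JetSpace} (h : HasJet κ u F) (h' : HasJet κ v G) :
    HasJet κ (u - v) (F - G) := by
  refine ⟨?_, fun j f hf => by rw [inner_sub_right, h.2, h'.2, sub_zero]⟩
  filter_upwards [h.1, h'.1, Lp.coeFn_sub F G] with x h1 h2 h3
  rw [h3]
  simp [h1, h2]

lemma HasJet.add {κ : ℝ} {u v : ℂ → ℂ} {F G : JetSpace} (h : HasJet κ u F) (h' : HasJet κ v G) :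
    HasJet κ (u + v) (F + G) := by
  refine ⟨?_, fun j f hf => by rw [inner_add_right, h.2, h'.2, add_zero]⟩
  filter_upwards [h.1, h'.1, Lp.coeFn_add F G] with x h1 h2 h3
  rw [h3]
  simp [h1, h2]

lemma HasJet.smul {κ : ℝ} {u : ℂ → ℂ} {F : JetSpace} (c : ℂ) (h : HasJet κ u F) :
    HasJet κ (fun x => c * u x) (c • F) := by
  refine ⟨?_, fun j f hf => by rw [inner_smul_right, h.2, mul_zero]⟩
  filter_upwards [h.1, Lp.coeFn_smul c F] with x h1 h3
  rw [h3]
  simp [h1]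

lemma hasJet_zero (κ : ℝ) : HasJet κ 0 0 := by
  refine ⟨?_, fun j f hf => by simp⟩
  filter_upwards [Lp.coeFn_zero JetVal 2 diskMeasure] with x h
  rw [h]
  simp

lemma HasJet.sum {κ : ℝ} {ι : Type*} (s : Finset ι) {u : ι → ℂ → ℂ} {F : ι → JetSpace}
    (h : ∀ i ∈ s, HasJet κ (u i) (F i)) : HasJet κ (fun x => ∑ i ∈ s, u i x) (∑ i ∈ s, F i) := by
  classical
  induction s using Finset.induction_on with
  | empty => exact hasJet_zero κ
  | insert a s ha ih =>
    simp only [Finset.sum_insert ha]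
    exact (h a (by simp)).add (ih fun i hi => h i (by simp [hi]))

/-- The weak relation determines the derivatives of a jet. -/
lemma HasJet.unique {κ : ℝ} (hκ : κ ≠ 0) {u : ℂ → ℂ} {F G : JetSpace} (hF : HasJet κ u F)
    (hG : HasJet κ u G) : F = G := by
  rw [← sub_eq_zero]
  have hD := hF.sub hG
  set D := F - G
  have h0 : ∀ᵐ x ∂diskMeasure, D x 0 = 0 := by
    filter_upwards [hD.1] with x hx
    simpa using hx
  have hj (j : Fin 2) : ∀ᵐ x ∂diskMeasure, D x j.succ = 0 := by
    have hi : MemLp (fun x => D x j.succ) 2 diskMeasure := (Lp.memLp D).eval_piLp j.succ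
    have hloc : LocallyIntegrableOn (fun x => D x j.succ) disk volume :=
      IntegrableOn.locallyIntegrableOn (hi.integrable one_le_two)
    refine (ae_restrict_iff' Metric.isOpen_ball.measurableSet).mpr ?_
    refine IsOpen.ae_eq_zero_of_integral_contDiff_smul_eq_zero Metric.isOpen_ball hloc
      fun g hg hgc hgs => ?_
    have hsupp : (tsupport fun x => (g x : ℂ)) = tsupport g := by
      rw [tsupport, tsupport]
      congr 1
      ext x
      simp
    have htest : IsTestFunction fun x => (g x : ℂ) := by
      refine ⟨Complex.ofRealCLM.contDiff.comp hg, hgc.comp_left (g := Complex.ofReal) rfl, ?_⟩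
      rwa [hsupp]
    have key := hD.2 j _ htest
    rw [inner_jetTest, integral_eq_zero_of_ae, zero_add] at key
    · have key2 := (mul_eq_zero.mp key).resolve_left (by exact_mod_cast hκ)
      rw [← key2, setIntegral_disk_eq]
      · refine integral_congr_ae (.of_forall fun x => ?_)
        simp [mul_comm]
      · intro x hx
        have : g x = 0 := image_eq_zero_of_notMem_tsupport fun h => hx (hgs h)
        simp [this]
    · filter_upwards [h0] with x hx
      simp [hx]
  refine Lp.eq_zero_iff_ae_eq_zero.mpr ?_
  filter_upwards [h0, hj 0, hj 1] with x h1 h2 h3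
  ext i
  fin_cases i
  · exact h1
  · exact h2
  · exact h3

lemma IsWeakGradient.hasJet {κ : ℝ} (hκ : κ ≠ 0) {u : ℂ → ℂ} {g : ℂ → EuclideanSpace ℂ (Fin 2)}
    (hu : MemLp u 2 diskMeasure) (hg : IsWeakGradient u g) :
    HasJet κ u ((memLp_jetFun (κ := κ) hu hg.1).toLp _) := by
  have hκ' : (κ : ℂ) ≠ 0 := by exact_mod_cast hκ
  have hc := (memLp_jetFun (κ := κ) hu hg.1).coeFn_toLp
  refine ⟨?_, fun j f hf => ?_⟩
  · filter_upwards [hc] with x hx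
    rw [hx]
    rfl
  · rw [inner_jetTest]
    have e1 : ∫ x, ((memLp_jetFun (κ := κ) hu hg.1).toLp _) x 0 * partialDeriv j f x ∂diskMeasure
        = ∫ x, u x * partialDeriv j f x ∂diskMeasure := by
      refine integral_congr_ae ?_
      filter_upwards [hc] with x hx
      rw [hx]
      rfl
    have e2 : ∫ x, ((memLp_jetFun (κ := κ) hu hg.1).toLp _) x j.succ * f x ∂diskMeasure
        = ∫ x, (κ : ℂ)⁻¹ * (g x j * f x) ∂diskMeasure := by
      refine integral_congr_ae ?_
      filter_upwards [hc] with x hx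
      rw [hx, ← mul_assoc]
      congr 1
      fin_cases j <;> rfl
    rw [e1, e2, hg.2 j f hf, integral_const_mul, mul_inv_cancel_left₀ hκ', neg_add_cancel]

lemma HasJet.memLp {κ : ℝ} {u : ℂ → ℂ} {F : JetSpace} (h : HasJet κ u F) :
    MemLp u 2 diskMeasure :=
  (memLp_congr_ae h.1).mp ((Lp.memLp F).eval_piLp 0)

/-- The gradient stored in a jet field. -/
def jetGradient (κ : ℝ) (F : JetSpace) (x : ℂ) : EuclideanSpace ℂ (Fin 2) :=
  WithLp.toLp 2 fun j => (κ : ℂ) * F x j.succ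

lemma HasJet.isWeakGradient {κ : ℝ} {u : ℂ → ℂ} {F : JetSpace} (h : HasJet κ u F) :
    IsWeakGradient u (jetGradient κ F) := by
  refine ⟨MemLp.of_eval_piLp fun j => ((Lp.memLp F).eval_piLp j.succ).const_mul (κ : ℂ),
    fun j f hf => ?_⟩
  have key := h.2 j f hf
  rw [inner_jetTest] at key
  rw [eq_neg_iff_add_eq_zero, ← key]
  congr 1
  · refine integral_congr_ae ?_
    filter_upwards [h.1] with x hx
    rw [hx]
  · rw [← integral_const_mul]
    refine integral_congr_ae (.of_forall fun x => ?_)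
    simp [jetGradient, mul_assoc]

lemma memH1_iff {κ : ℝ} (hκ : κ ≠ 0) {u : ℂ → ℂ} : MemH1 u ↔ ∃ F, HasJet κ u F := by
  constructor
  · rintro ⟨hu, g, hg⟩
    exact ⟨_, hg.hasJet hκ hu⟩
  · rintro ⟨F, hF⟩
    exact ⟨hF.memLp, _, hF.isWeakGradient⟩

lemma HasJet.weakGradient_ae {κ : ℝ} (hκ : κ ≠ 0) {u : ℂ → ℂ} {F : JetSpace} (h : HasJet κ u F) :
    weakGradient u =ᵐ[diskMeasure] jetGradient κ F := by
  have hex : ∃ g, IsWeakGradient u g := ⟨_, h.isWeakGradient⟩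
  have hw : IsWeakGradient u (weakGradient u) := by
    rw [weakGradient, dif_pos hex]
    exact hex.choose_spec
  have hκ' : (κ : ℂ) ≠ 0 := by exact_mod_cast hκ
  have e := (hw.hasJet hκ h.memLp).unique hκ h
  have hc := (memLp_jetFun (κ := κ) h.memLp hw.1).coeFn_toLp
  rw [e] at hc
  filter_upwards [hc] with x hx
  ext j
  simp only [jetGradient, hx]
  fin_cases j <;> simp [jetFun, hκ']

/-- The norm of `H¹(B₁)` is the `L²` norm of the jet. -/
lemma HasJet.normB_eq {κ : ℝ} (hκ : κ ≠ 0) {u : ℂ → ℂ} {F : JetSpace} (h : HasJet κ u F) :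
    normB κ u = ‖F‖ := by
  have hκ' : (κ : ℂ) ≠ 0 := by exact_mod_cast hκ
  rw [normB, ← Real.sqrt_sq (norm_nonneg F), Lp_norm_sq]
  congr 1
  have hw : MemLp (weakGradient u) 2 diskMeasure :=
    (memLp_congr_ae (h.weakGradient_ae hκ)).mpr h.isWeakGradient.1
  rw [← integral_const_mul, ← integral_add]
  · refine integral_congr_ae ?_
    filter_upwards [h.1, h.weakGradient_ae hκ] with x h1 h2
    rw [h2, ← h1]
    simp only [EuclideanSpace.norm_sq_eq, jetGradient, Fin.sum_univ_succ, norm_mul, mul_pow,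
      Complex.norm_real, Real.norm_eq_abs, sq_abs]
    simp
    field_simp
  · exact (memLp_two_iff_integrable_sq_norm h.memLp.1).mp h.memLp
  · exact ((memLp_two_iff_integrable_sq_norm hw.1).mp hw).const_mul _

/-- Convergence in `L²` is convergence almost everywhere along a subsequence. -/
lemma exists_subseq_ae {α E : Type*} [MeasurableSpace α] {μ : Measure α} [NormedAddCommGroup E]
    {ι : Type*} {l : Filter ι} [l.IsCountablyGenerated] [l.NeBot] {F : ι → Lp E 2 μ} {G : Lp E 2 μ}
    (h : Tendsto F l (𝓝 G)) : ∃ n : ℕ → ι, Tendsto n atTop l ∧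
      ∀ᵐ x ∂μ, Tendsto (fun k => F (n k) x) atTop (𝓝 (G x)) :=
  (tendstoInMeasure_of_tendsto_Lp h).exists_seq_tendsto_ae'

/-- `HasJet` is closed under simultaneous `L²` and pointwise convergence. -/
lemma HasJet.of_tendsto {κ : ℝ} {ι : Type*} {l : Filter ι} [l.IsCountablyGenerated] [l.NeBot]
    {v : ι → ℂ → ℂ} {F : ι → JetSpace} {u : ℂ → ℂ} {G : JetSpace} (h : ∀ n, HasJet κ (v n) (F n))
    (hF : Tendsto F l (𝓝 G))
    (hv : ∀ x ∈ disk, Tendsto (fun n => v n x) l (𝓝 (u x))) : HasJet κ u G := by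
  refine ⟨?_, fun j f hf => ?_⟩
  · obtain ⟨n, hn, hae⟩ := exists_subseq_ae hF
    have h1 : ∀ᵐ x ∂diskMeasure, ∀ k, F (n k) x 0 = v (n k) x :=
      ae_all_iff.mpr fun k => (h (n k)).1
    filter_upwards [hae, h1, ae_restrict_mem Metric.isOpen_ball.measurableSet] with x hx h1 hd
    refine tendsto_nhds_unique ?_ ((hv x hd).comp hn)
    have := ((EuclideanSpace.proj (𝕜 := ℂ) (0 : Fin 3)).continuous.tendsto _).comp hx
    refine this.congr fun k => ?_
    simpa using h1 k
  · have h2 : Tendsto (fun n => inner ℂ (jetTest κ j hf) (F n)) l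
        (𝓝 (inner ℂ (jetTest κ j hf) G)) := tendsto_const_nhds.inner hF
    simp_rw [fun n => (h n).2 j f hf] at h2
    exact (tendsto_nhds_unique h2 tendsto_const_nhds)

/-- The classical gradient. -/
def classicalGradient (u : ℂ → ℂ) (x : ℂ) : EuclideanSpace ℂ (Fin 2) :=
  WithLp.toLp 2 fun j => partialDeriv j u x

/-- Integration by parts against a test function. -/
lemma integral_mul_partialDeriv {u f : ℂ → ℂ} (hu : Differentiable ℝ u)
    (hc : ∀ j, Continuous (partialDeriv j u)) (hf : IsTestFunction f) (j : Fin 2) :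
    ∫ x, u x * partialDeriv j f x ∂diskMeasure = -∫ x, partialDeriv j u x * f x ∂diskMeasure := by
  have hf0 : ∀ x, x ∉ disk → f x = 0 := fun x hx =>
    image_eq_zero_of_notMem_tsupport fun h => hx (hf.2.2 h)
  have hfd : ∀ x, x ∉ disk → partialDeriv j f x = 0 := fun x hx => by
    have : fderiv ℝ f x = 0 := image_eq_zero_of_notMem_tsupport fun h =>
      hx (hf.2.2 (tsupport_fderiv_subset ℝ h))
    rw [partialDeriv, this]
    rfl
  have hfc : HasCompactSupport (partialDeriv j f) := by
    refine (hf.2.1.fderiv (𝕜 := ℝ)).mono ?_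
    intro x hx h0
    apply hx
    rw [partialDeriv, h0]
    rfl
  rw [setIntegral_disk_eq fun x hx => by rw [hfd x hx, mul_zero],
    setIntegral_disk_eq fun x hx => by rw [hf0 x hx, mul_zero]]
  refine integral_mul_fderiv_eq_neg_fderiv_mul_of_integrable ?_ ?_ ?_
    (fun x _ => hu x) (fun x _ => hf.1.differentiable (by simp) x)
  · exact ((hc j).mul hf.1.continuous).integrable_of_hasCompactSupport hf.2.1.mul_left
  · exact (hu.continuous.mul (continuous_partialDeriv hf.1 j)).integrable_of_hasCompactSupport
      hfc.mul_left
  · exact (hu.continuous.mul hf.1.continuous).integrable_of_hasCompactSupport hf.2.1.mul_left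

lemma continuous_classicalGradient {u : ℂ → ℂ} (hc : ∀ j, Continuous (partialDeriv j u)) :
    Continuous (classicalGradient u) :=
  (PiLp.continuous_toLp 2 _).comp (continuous_pi hc)

lemma isWeakGradient_classicalGradient {u : ℂ → ℂ} (hu : Differentiable ℝ u)
    (hc : ∀ j, Continuous (partialDeriv j u)) : IsWeakGradient u (classicalGradient u) :=
  ⟨memLp_of_continuous (continuous_classicalGradient hc),
    fun j _ hf => integral_mul_partialDeriv hu hc hf j⟩


/-! ### Orthogonality of circular waves -/

lemma continuous_partialDeriv_circularWaveTilde (κ : ℝ) (p : ℤ) (j : Fin 2) :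
    Continuous (partialDeriv j (circularWaveTilde κ p)) :=
  continuous_partialDeriv (contDiff_circularWaveTilde κ p) j

lemma isWeakGradient_circularWaveTilde (κ : ℝ) (p : ℤ) :
    IsWeakGradient (circularWaveTilde κ p) (classicalGradient (circularWaveTilde κ p)) :=
  isWeakGradient_classicalGradient (differentiable_circularWaveTilde κ p)
    (continuous_partialDeriv_circularWaveTilde κ p)

lemma memLp_circularWaveTilde (κ : ℝ) (p : ℤ) : MemLp (circularWaveTilde κ p) 2 diskMeasure :=
  memLp_of_continuous (continuous_circularWaveTilde κ p)

/-- The jet field of the circular wave `b̃_p`. -/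
def circularJetTilde (κ : ℝ) (p : ℤ) : JetSpace :=
  (memLp_jetFun (κ := κ) (memLp_circularWaveTilde κ p)
    (isWeakGradient_circularWaveTilde κ p).1).toLp _

lemma hasJet_circularWaveTilde {κ : ℝ} (hκ : κ ≠ 0) (p : ℤ) :
    HasJet κ (circularWaveTilde κ p) (circularJetTilde κ p) :=
  (isWeakGradient_circularWaveTilde κ p).hasJet hκ (memLp_circularWaveTilde κ p)

/-- The `L²(B₁)` scalar product of two circular waves. -/
def circularInner (κ : ℝ) (p q : ℤ) : ℂ :=
  ∫ x, conj (circularWaveTilde κ p x) * circularWaveTilde κ q x ∂diskMeasure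

lemma integral_disk_rotate (a : ℝ) (f : ℂ → ℂ) :
    ∫ x, f (Complex.exp (a * Complex.I) * x) ∂diskMeasure = ∫ x, f x ∂diskMeasure := by
  have hmp := (rotation (Circle.exp a)).measurePreserving
  have h := hmp.setIntegral_preimage_emb
    (rotation (Circle.exp a)).toHomeomorph.measurableEmbedding f disk
  have hpre : (rotation (Circle.exp a)) ⁻¹' disk = disk := by
    ext x
    simp only [disk, mem_preimage, mem_ball_zero_iff, LinearIsometryEquiv.norm_map]
  rw [hpre] at h
  simpa [diskMeasure, rotation_apply, Circle.coe_exp] using h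

/-- Circular waves of different orders are orthogonal, by rotation invariance. -/
lemma circularInner_eq_zero (κ : ℝ) {p q : ℤ} (hpq : p ≠ q) : circularInner κ p q = 0 := by
  set a : ℝ := Real.pi / (q - p)
  have hqp : ((q : ℝ) - p) ≠ 0 := by
    rw [sub_ne_zero]; exact_mod_cast hpq.symm
  have h := integral_disk_rotate a
    (fun x => conj (circularWaveTilde κ p x) * circularWaveTilde κ q x)
  have hc : conj (Complex.exp (a * Complex.I)) = (Complex.exp (a * Complex.I))⁻¹ := by
    rw [← Complex.exp_conj, ← Complex.exp_neg]
    simp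
  have h0 := Complex.exp_ne_zero (a * Complex.I)
  -- rotating by the angle `π / (q - p)` changes the sign of the integrand
  have hrot : (Complex.exp (a * Complex.I))⁻¹ ^ p * Complex.exp (a * Complex.I) ^ q = -1 := by
    rw [inv_zpow', ← zpow_add₀ h0, ← Complex.exp_int_mul, ← Complex.exp_pi_mul_I]
    congr 1
    have : ((q : ℂ) - p) ≠ 0 := by exact_mod_cast hqp
    simp only [a]
    push_cast
    field_simp
    ring
  have e : ∀ x, conj (circularWaveTilde κ p (Complex.exp (a * Complex.I) * x)) *
      circularWaveTilde κ q (Complex.exp (a * Complex.I) * x) =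
      -1 * (conj (circularWaveTilde κ p x) * circularWaveTilde κ q x) := by
    intro x
    rw [circularWaveTilde_rotate, circularWaveTilde_rotate, map_mul, map_zpow₀, hc, ← hrot]
    ring
  simp_rw [e, integral_const_mul] at h
  rw [circularInner]
  linear_combination (-1 / 2 : ℂ) * h

/-- The squared `L²(B₁)` norm of `b̃_p`. -/
def circularMass (κ : ℝ) (p : ℤ) : ℝ := ∫ x, ‖circularWaveTilde κ p x‖ ^ 2 ∂diskMeasure

lemma circularInner_self (κ : ℝ) (p : ℤ) : circularInner κ p p = circularMass κ p := by
  rw [circularInner, circularMass, ← integral_complex_ofReal]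
  refine integral_congr_ae (.of_forall fun x => ?_)
  simp [Complex.conj_mul']

lemma circularMass_natAbs (κ : ℝ) (p : ℤ) : circularMass κ p = circularMass κ p.natAbs := by
  simp only [circularMass, norm_circularWaveTilde, Int.natAbs_natCast]

lemma circularMass_pos {κ : ℝ} (hκ : 0 < κ) (p : ℤ) : 0 < circularMass κ p := by
  have hlim : Tendsto (fun t : ℝ => 2 * (Real.exp ((κ * t) ^ 2 / 4) - 1)) (𝓝[>] 0) (𝓝 0) := by
    have : Continuous fun t : ℝ => 2 * (Real.exp ((κ * t) ^ 2 / 4) - 1) := by fun_prop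
    have h := this.tendsto 0
    simp only [mul_zero, ne_eq, OfNat.ofNat_ne_zero, not_false_eq_true, zero_pow, zero_div,
      Real.exp_zero, sub_self] at h
    exact h.mono_left nhdsWithin_le_nhds
  obtain ⟨t, ⟨ht1, ht0⟩, htlt⟩ := (((hlim.eventually (gt_mem_nhds one_pos)).and
    self_mem_nhdsWithin).and (Ioo_mem_nhdsGT (zero_lt_one (α := ℝ)))).exists
  have ht0 : 0 < t := ht0
  have hne : circularWaveTilde κ p t ≠ 0 := by
    rw [← norm_pos_iff, norm_circularWaveTilde, Complex.norm_real, Real.norm_eq_abs,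
      abs_of_pos ht0]
    refine lt_of_lt_of_le ?_ (le_abs_besselJ (by positivity) ?_)
    · positivity
    · linarith [(Nat.cast_nonneg p.natAbs : (0 : ℝ) ≤ _)]
  have hcont : Continuous fun x => ‖circularWaveTilde κ p x‖ ^ 2 :=
    (continuous_circularWaveTilde κ p).norm.pow 2
  have hint : Integrable (fun x => ‖circularWaveTilde κ p x‖ ^ 2) diskMeasure :=
    (memLp_two_iff_integrable_sq_norm (memLp_circularWaveTilde κ p).1).mp
      (memLp_circularWaveTilde κ p)
  rw [circularMass, integral_pos_iff_support_of_nonneg (fun x => by positivity) hint]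
  have hopen : IsOpen ((Function.support fun x => ‖circularWaveTilde κ p x‖ ^ 2) ∩ disk) :=
    hcont.isOpen_support.inter Metric.isOpen_ball
  rw [diskMeasure, Measure.restrict_apply hcont.isOpen_support.measurableSet]
  refine hopen.measure_pos _ ⟨t, ?_, ?_⟩
  · simpa using hne
  · simp [disk, abs_of_pos ht0, htlt.2]

lemma inner_circularJetTilde {κ : ℝ} (hκ : κ ≠ 0) (p q : ℤ) :
    inner ℂ (circularJetTilde κ p) (circularJetTilde κ q) = circularInner κ p q +
      1 / 2 * (circularInner κ (p - 1) (q - 1) + circularInner κ (p + 1) (q + 1)) := by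
  have hκ' : (κ : ℂ) ≠ 0 := by exact_mod_cast hκ
  have hint (p q : ℤ) : Integrable
      (fun x => conj (circularWaveTilde κ p x) * circularWaveTilde κ q x) diskMeasure :=
    ((memLp_circularWaveTilde κ p).star).integrable_mul (memLp_circularWaveTilde κ q)
  rw [L2.inner_def, circularInner, circularInner, circularInner,
    ← integral_add (hint _ _) (hint _ _), ← integral_const_mul, ← integral_add (hint _ _) ?_]
  swap
  · exact ((hint _ _).add (hint _ _)).const_mul _
  refine integral_congr_ae ?_
  have hc (p : ℤ) := (memLp_jetFun (κ := κ) (memLp_circularWaveTilde κ p)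
    (isWeakGradient_circularWaveTilde κ p).1).coeFn_toLp
  filter_upwards [hc p, hc q] with x hp hq
  rw [circularJetTilde, circularJetTilde, hp, hq, PiLp.inner_apply]
  simp only [jetFun, classicalGradient, Fin.sum_univ_succ, RCLike.inner_apply]
  have h2 : (starRingEnd ℂ) 2 = 2 := map_ofNat _ 2
  simp [partialDeriv_zero_circularWaveTilde, partialDeriv_one_circularWaveTilde, h2]
  field_simp
  ring_nf
  simp only [Complex.I_sq]
  ring

/-- The squared `B`-norm of `b̃_p`. -/
def circularEnergy (κ : ℝ) (p : ℤ) : ℝ :=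
  circularMass κ p + 1 / 2 * (circularMass κ (p - 1) + circularMass κ (p + 1))

lemma circularEnergy_pos {κ : ℝ} (hκ : 0 < κ) (p : ℤ) : 0 < circularEnergy κ p := by
  have := circularMass_pos hκ p
  have := circularMass_pos hκ (p - 1)
  have := circularMass_pos hκ (p + 1)
  unfold circularEnergy
  positivity

lemma normB_circularWaveTilde_sq {κ : ℝ} (hκ : κ ≠ 0) (p : ℤ) :
    normB κ (circularWaveTilde κ p) ^ 2 = circularEnergy κ p := by
  rw [(hasJet_circularWaveTilde hκ p).normB_eq hκ]
  have h := inner_circularJetTilde hκ p p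
  rw [inner_self_eq_norm_sq_to_K, circularInner_self, circularInner_self, circularInner_self] at h
  rw [circularEnergy]
  have h2 : (((‖circularJetTilde κ p‖ ^ 2 : ℝ)) : ℂ) = ((circularMass κ p +
      1 / 2 * (circularMass κ (p - 1) + circularMass κ (p + 1)) : ℝ) : ℂ) := by
    push_cast
    exact h
  exact_mod_cast h2

lemma normB_circularWaveTilde_pos {κ : ℝ} (hκ : 0 < κ) (p : ℤ) :
    0 < normB κ (circularWaveTilde κ p) := by
  have h := normB_circularWaveTilde_sq hκ.ne' p
  have h2 := circularEnergy_pos hκ p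
  rw [← h] at h2
  exact lt_of_le_of_ne (Real.sqrt_nonneg _) fun h0 => by simp [← h0] at h2

/-- The jet field of the normalised circular wave `b_p`. -/
def circularJet (κ : ℝ) (p : ℤ) : JetSpace :=
  (((normB κ (circularWaveTilde κ p))⁻¹ : ℝ) : ℂ) • circularJetTilde κ p

lemma hasJet_circularWave {κ : ℝ} (hκ : κ ≠ 0) (p : ℤ) :
    HasJet κ (circularWave κ p) (circularJet κ p) :=
  (hasJet_circularWaveTilde hκ p).smul _

lemma orthonormal_circularJet {κ : ℝ} (hκ : 0 < κ) : Orthonormal ℂ (circularJet κ) := by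
  refine ⟨fun p => ?_, fun p q hpq => ?_⟩
  · have h := normB_circularWaveTilde_pos hκ p
    rw [circularJet, norm_smul, ← (hasJet_circularWaveTilde hκ.ne' p).normB_eq hκ.ne',
      Complex.norm_real, Real.norm_eq_abs, abs_of_pos (inv_pos.mpr h), inv_mul_cancel₀ h.ne']
  · simp only [circularJet]
    rw [inner_smul_left, inner_smul_right, inner_circularJetTilde hκ.ne',
      circularInner_eq_zero κ hpq, circularInner_eq_zero κ (by simpa using hpq),
      circularInner_eq_zero κ (by simpa using hpq)]
    simp

/-- The closed span of the jets of circular waves: the space `B` up to almost everywhere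
equality. -/
def circularSpace (κ : ℝ) : Submodule ℂ JetSpace :=
  (Submodule.span ℂ (range (circularJet κ))).topologicalClosure

lemma exists_jet_of_mem_span {κ : ℝ} (hκ : κ ≠ 0) {q : ℂ → ℂ}
    (hq : q ∈ Submodule.span ℂ (range (circularWave κ))) :
    ∃ Q ∈ Submodule.span ℂ (range (circularJet κ)), HasJet κ q Q := by
  induction hq using Submodule.span_induction with
  | mem x hx =>
    obtain ⟨p, rfl⟩ := hx
    exact ⟨_, Submodule.subset_span ⟨p, rfl⟩, hasJet_circularWave hκ p⟩
  | zero => exact ⟨0, Submodule.zero_mem _, hasJet_zero κ⟩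
  | add x y _ _ hx hy =>
    obtain ⟨X, hX, hX'⟩ := hx
    obtain ⟨Y, hY, hY'⟩ := hy
    exact ⟨X + Y, Submodule.add_mem _ hX hY, hX'.add hY'⟩
  | smul a x _ hx =>
    obtain ⟨X, hX, hX'⟩ := hx
    exact ⟨a • X, Submodule.smul_mem _ _ hX, hX'.smul a⟩

lemma exists_hasJet_of_mem_span {κ : ℝ} (hκ : κ ≠ 0) {Q : JetSpace}
    (hQ : Q ∈ Submodule.span ℂ (range (circularJet κ))) :
    ∃ q ∈ Submodule.span ℂ (range (circularWave κ)), HasJet κ q Q := by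
  induction hQ using Submodule.span_induction with
  | mem x hx =>
    obtain ⟨p, rfl⟩ := hx
    exact ⟨_, Submodule.subset_span ⟨p, rfl⟩, hasJet_circularWave hκ p⟩
  | zero => exact ⟨0, Submodule.zero_mem _, hasJet_zero κ⟩
  | add x y _ _ hx hy =>
    obtain ⟨X, hX, hX'⟩ := hx
    obtain ⟨Y, hY, hY'⟩ := hy
    exact ⟨X + Y, Submodule.add_mem _ hX hY, hX'.add hY'⟩
  | smul a x _ hx =>
    obtain ⟨X, hX, hX'⟩ := hx
    exact ⟨a • X, Submodule.smul_mem _ _ hX, hX'.smul a⟩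

lemma memB_iff {κ : ℝ} (hκ : κ ≠ 0) {u : ℂ → ℂ} :
    MemB κ u ↔ ∃ F ∈ circularSpace κ, HasJet κ u F := by
  constructor
  · rintro ⟨hu, happ⟩
    obtain ⟨F, hF⟩ := (memH1_iff hκ).mp hu
    refine ⟨F, ?_, hF⟩
    refine Metric.mem_closure_iff.mpr fun ε hε => ?_
    obtain ⟨q, hq, hlt⟩ := happ ε hε
    obtain ⟨Q, hQ, hQ'⟩ := exists_jet_of_mem_span hκ hq
    exact ⟨Q, hQ, by rwa [dist_eq_norm, ← (hF.sub hQ').normB_eq hκ]⟩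
  · rintro ⟨F, hFc, hF⟩
    refine ⟨(memH1_iff hκ).mpr ⟨F, hF⟩, fun ε hε => ?_⟩
    obtain ⟨Q, hQ, hlt⟩ := Metric.mem_closure_iff.mp hFc ε hε
    obtain ⟨q, hq, hq'⟩ := exists_hasJet_of_mem_span hκ hQ
    exact ⟨q, hq, by rwa [(hF.sub hq').normB_eq hκ, ← dist_eq_norm]⟩


/-! ### Moments of the weight -/

/-- The function `exp ((k + 1/2) ζ - κ e^ζ)`, comparable with `e^{kζ} w(ζ)²` for `ζ ≥ 0`. -/
def gammaDensity (κ k ζ : ℝ) : ℝ := Real.exp ((k + 1 / 2) * ζ - κ * Real.exp ζ)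

lemma gammaDensity_pos (κ k ζ : ℝ) : 0 < gammaDensity κ k ζ := Real.exp_pos _

lemma gammaDensity_eq (κ k ζ : ℝ) : |Real.exp ζ| •
    ((Real.exp ζ) ^ (k + 1 / 2 - 1) * Real.exp (-(κ * Real.exp ζ))) = gammaDensity κ k ζ := by
  rw [abs_of_pos (Real.exp_pos ζ), smul_eq_mul, ← Real.exp_mul, ← Real.exp_add, ← Real.exp_add,
    gammaDensity]
  congr 1
  ring

lemma image_exp_univ : Real.exp '' univ = Ioi 0 := by
  rw [image_univ, Real.range_exp]

lemma integrableOn_gamma {κ k : ℝ} (hκ : 0 < κ) (hk : 0 ≤ k) :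
    IntegrableOn (fun t : ℝ => t ^ (k + 1 / 2 - 1) * Real.exp (-(κ * t))) (Ioi 0) := by
  refine .of_integral_ne_zero ?_
  rw [Real.integral_rpow_mul_exp_neg_mul_Ioi (by positivity) hκ]
  have := Real.Gamma_pos_of_pos (show 0 < k + 1 / 2 by positivity)
  positivity

lemma integrable_gammaDensity {κ k : ℝ} (hκ : 0 < κ) (hk : 0 ≤ k) :
    Integrable (gammaDensity κ k) := by
  have h := integrableOn_gamma hκ hk
  rw [← image_exp_univ, integrableOn_image_iff_integrableOn_abs_deriv_smul MeasurableSet.univ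
    (fun x _ => (Real.hasDerivAt_exp x).hasDerivWithinAt) Real.exp_injective.injOn,
    integrableOn_univ] at h
  exact h.congr (.of_forall fun ζ => gammaDensity_eq κ k ζ)

lemma integral_gammaDensity {κ k : ℝ} (hκ : 0 < κ) (hk : 0 ≤ k) :
    ∫ ζ, gammaDensity κ k ζ = (1 / κ) ^ (k + 1 / 2) * Real.Gamma (k + 1 / 2) := by
  rw [← Real.integral_rpow_mul_exp_neg_mul_Ioi (by positivity) hκ, ← image_exp_univ,
    integral_image_eq_integral_abs_deriv_smul MeasurableSet.univ
    (fun x _ => (Real.hasDerivAt_exp x).hasDerivWithinAt) Real.exp_injective.injOn,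
    setIntegral_univ]
  exact integral_congr_ae (.of_forall fun ζ => (gammaDensity_eq κ k ζ).symm)

/-- The squared weight as a function of `ζ`. -/
def weightSq (κ ζ : ℝ) : ℝ := weight κ (0, ζ) ^ 2

lemma weightSq_eq (κ ζ : ℝ) :
    weightSq κ ζ = Real.exp (|ζ| / 2 - κ * Real.exp |ζ| + κ * Real.exp (-|ζ|)) := by
  rw [weightSq, weight, ← Real.exp_nat_mul]
  congr 1
  simp only [Real.sinh_eq]
  push_cast
  ring

lemma weightSq_pos (κ ζ : ℝ) : 0 < weightSq κ ζ := by
  rw [weightSq_eq]; positivity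

lemma weightSq_neg (κ ζ : ℝ) : weightSq κ (-ζ) = weightSq κ ζ := by
  simp [weightSq_eq]

lemma continuous_weightSq (κ : ℝ) : Continuous (weightSq κ) := by
  have : weightSq κ = fun ζ => Real.exp (|ζ| / 2 - κ * Real.exp |ζ| + κ * Real.exp (-|ζ|)) :=
    funext (weightSq_eq κ)
  rw [this]
  fun_prop

lemma exp_mul_weightSq_le {κ : ℝ} (hκ : 0 < κ) (k ζ : ℝ) :
    Real.exp (k * ζ) * weightSq κ ζ ≤
      Real.exp κ * (gammaDensity κ |k| ζ + gammaDensity κ |k| (-ζ)) := by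
  have h1 : Real.exp (k * ζ) * weightSq κ ζ ≤ Real.exp κ * gammaDensity κ |k| |ζ| := by
    rw [weightSq_eq, gammaDensity, ← Real.exp_add, ← Real.exp_add, Real.exp_le_exp]
    have e1 : k * ζ ≤ |k| * |ζ| := by rw [← abs_mul]; exact le_abs_self _
    have e2 : κ * Real.exp (-|ζ|) ≤ κ * 1 := by
      gcongr
      exact Real.exp_le_one_iff.mpr (by simp)
    linarith
  refine h1.trans ?_
  gcongr
  have p1 := gammaDensity_pos κ |k| ζ
  have p2 := gammaDensity_pos κ |k| (-ζ)
  rcases abs_cases ζ with ⟨h, _⟩ | ⟨h, _⟩ <;> rw [h] <;> linarith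

lemma gammaDensity_le {κ : ℝ} (hκ : 0 < κ) (k : ℝ) {ζ : ℝ} (hζ : 0 ≤ ζ) :
    gammaDensity κ k ζ ≤ Real.exp (k * ζ) * weightSq κ ζ := by
  rw [weightSq_eq, gammaDensity, ← Real.exp_add, Real.exp_le_exp, abs_of_nonneg hζ]
  have : 0 < κ * Real.exp (-ζ) := by positivity
  linarith

lemma integrable_exp_mul_weightSq {κ : ℝ} (hκ : 0 < κ) (k : ℝ) :
    Integrable fun ζ => Real.exp (k * ζ) * weightSq κ ζ := by
  have h := integrable_gammaDensity hκ (abs_nonneg k)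
  refine Integrable.mono' ((h.add h.comp_neg).const_mul (Real.exp κ)) ?_ (.of_forall fun ζ => ?_)
  · exact (Continuous.mul (by fun_prop) (continuous_weightSq κ)).aestronglyMeasurable
  · have := weightSq_pos κ ζ
    rw [Real.norm_eq_abs, abs_of_pos (by positivity)]
    exact exp_mul_weightSq_le hκ k ζ

/-- The exponential moments of the squared weight. -/
def weightMoment (κ : ℝ) (p : ℤ) : ℝ := ∫ ζ, Real.exp (2 * p * ζ) * weightSq κ ζ

lemma weightMoment_natAbs (κ : ℝ) (p : ℤ) : weightMoment κ p = weightMoment κ p.natAbs := by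
  rcases Int.natAbs_eq p with h | h
  · rw [← h]
  · rw [weightMoment, ← integral_neg_eq_self, weightMoment]
    refine integral_congr_ae (.of_forall fun ζ => ?_)
    beta_reduce
    rw [weightSq_neg]
    congr 2
    have : (p : ℝ) = -((p.natAbs : ℤ) : ℝ) := by exact_mod_cast h
    rw [this]
    ring

lemma weightMoment_le {κ : ℝ} (hκ : 0 < κ) (n : ℕ) :
    weightMoment κ n ≤ 2 * Real.exp κ * ∫ ζ, gammaDensity κ (2 * n) ζ := by
  have hk : (0 : ℝ) ≤ 2 * n := by positivity
  have h := integrable_gammaDensity hκ hk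
  have h2 : weightMoment κ n ≤
      ∫ ζ, Real.exp κ * (gammaDensity κ (2 * n) ζ + gammaDensity κ (2 * n) (-ζ)) := by
    refine integral_mono ?_ ((h.add h.comp_neg).const_mul _) fun ζ => ?_
    · exact_mod_cast integrable_exp_mul_weightSq hκ (2 * n)
    · have := exp_mul_weightSq_le hκ (2 * n) ζ
      rw [abs_of_nonneg hk] at this
      exact_mod_cast this
  rw [integral_const_mul, integral_add h h.comp_neg, integral_neg_eq_self] at h2
  linarith

lemma setIntegral_gammaDensity_le_weightMoment {κ : ℝ} (hκ : 0 < κ) (n : ℕ) :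
    ∫ ζ in Ioi 0, gammaDensity κ (2 * n) ζ ≤ weightMoment κ n := by
  have hk : (0 : ℝ) ≤ 2 * n := by positivity
  have hi : Integrable fun ζ => Real.exp (2 * ((n : ℤ) : ℝ) * ζ) * weightSq κ ζ := by
    exact_mod_cast integrable_exp_mul_weightSq hκ (2 * n)
  calc ∫ ζ in Ioi 0, gammaDensity κ (2 * n) ζ
      ≤ ∫ ζ in Ioi 0, Real.exp (2 * ((n : ℤ) : ℝ) * ζ) * weightSq κ ζ := by
        refine setIntegral_mono_on (integrable_gammaDensity hκ hk).integrableOn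
          hi.integrableOn measurableSet_Ioi fun ζ hζ => ?_
        exact_mod_cast gammaDensity_le hκ (2 * n) (le_of_lt hζ)
    _ ≤ weightMoment κ n := setIntegral_le_integral hi (.of_forall fun ζ => by
        have := weightSq_pos κ ζ
        simp only [Pi.zero_apply]
        positivity)

lemma gammaDensity_add (κ k ζ : ℝ) :
    gammaDensity κ k ζ = Real.exp (k * ζ) * gammaDensity κ 0 ζ := by
  rw [gammaDensity, gammaDensity, ← Real.exp_add]
  congr 1
  ring

lemma setIntegral_gammaDensity_pos {κ : ℝ} (hκ : 0 < κ) (R : ℝ) :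
    0 < ∫ ζ in Ioi R, gammaDensity κ 0 ζ := by
  rw [setIntegral_pos_iff_support_of_nonneg_ae (.of_forall fun ζ => (gammaDensity_pos κ 0 ζ).le)
    (integrable_gammaDensity hκ le_rfl).integrableOn]
  have : Function.support (gammaDensity κ 0) = univ := by
    ext ζ
    simpa using (gammaDensity_pos κ 0 ζ).ne'
  rw [this, univ_inter]
  simp

/-- The moments grow faster than every exponential. -/
lemma exp_le_weightMoment {κ : ℝ} (hκ : 0 < κ) {R : ℝ} (hR : 0 ≤ R) (n : ℕ) :
    Real.exp (2 * n * R) * ∫ ζ in Ioi R, gammaDensity κ 0 ζ ≤ weightMoment κ n := by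
  have hk : (0 : ℝ) ≤ 2 * n := by positivity
  have hi := integrable_gammaDensity hκ hk
  refine le_trans ?_ (setIntegral_gammaDensity_le_weightMoment hκ n)
  calc Real.exp (2 * n * R) * ∫ ζ in Ioi R, gammaDensity κ 0 ζ
      = ∫ ζ in Ioi R, Real.exp (2 * n * R) * gammaDensity κ 0 ζ := by rw [integral_const_mul]
    _ ≤ ∫ ζ in Ioi R, gammaDensity κ (2 * n) ζ := by
        refine setIntegral_mono_on
          ((integrable_gammaDensity hκ le_rfl).const_mul _).integrableOn
          hi.integrableOn measurableSet_Ioi fun ζ hζ => ?_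
        rw [gammaDensity_add κ (2 * n)]
        have := gammaDensity_pos κ 0 ζ
        have hζ' : R ≤ ζ := le_of_lt hζ
        gcongr
    _ ≤ ∫ ζ in Ioi 0, gammaDensity κ (2 * n) ζ :=
        setIntegral_mono_set hi.integrableOn (.of_forall fun ζ => (gammaDensity_pos κ _ ζ).le)
          (Ioi_subset_Ioi hR).eventuallyLE

lemma weightMoment_pos {κ : ℝ} (hκ : 0 < κ) (p : ℤ) : 0 < weightMoment κ p := by
  rw [weightMoment_natAbs]
  refine lt_of_lt_of_le ?_ (exp_le_weightMoment hκ le_rfl p.natAbs)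
  have := setIntegral_gammaDensity_pos hκ 0
  positivity

/-- Up to constants, the moments are values of the Gamma function. -/
lemma exists_gamma_le_weightMoment {κ : ℝ} (hκ : 0 < κ) :
    ∃ C > 0, ∀ n : ℕ, ∫ ζ, gammaDensity κ (2 * n) ζ ≤ C * weightMoment κ n := by
  set c := ∫ ζ in Ioi 0, gammaDensity κ 0 ζ with hc
  set d := ∫ ζ in Iic 0, gammaDensity κ 0 ζ with hd
  have hcpos : 0 < c := setIntegral_gammaDensity_pos hκ 0
  have hdpos : 0 ≤ d := integral_nonneg fun ζ => (gammaDensity_pos κ 0 ζ).le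
  refine ⟨1 + d / c, by positivity, fun n => ?_⟩
  have hk : (0 : ℝ) ≤ 2 * n := by positivity
  have hi := integrable_gammaDensity hκ hk
  have hi0 := integrable_gammaDensity hκ (le_refl 0)
  have h1 : c ≤ ∫ ζ in Ioi 0, gammaDensity κ (2 * n) ζ := by
    refine setIntegral_mono_on hi0.integrableOn hi.integrableOn measurableSet_Ioi fun ζ hζ => ?_
    rw [gammaDensity_add κ (2 * n)]
    have hζ' : 0 ≤ ζ := le_of_lt hζ
    exact le_mul_of_one_le_left (gammaDensity_pos κ 0 ζ).le (Real.one_le_exp (by positivity))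
  have h2 : ∫ ζ in Iic 0, gammaDensity κ (2 * n) ζ ≤ d := by
    refine setIntegral_mono_on hi.integrableOn hi0.integrableOn measurableSet_Iic fun ζ hζ => ?_
    rw [gammaDensity_add κ (2 * n)]
    have hζ' : ζ ≤ 0 := hζ
    exact mul_le_of_le_one_left (gammaDensity_pos κ 0 ζ).le
      (Real.exp_le_one_iff.mpr (mul_nonpos_of_nonneg_of_nonpos hk hζ'))
  have h3 := intervalIntegral.integral_Iic_add_Ioi (b := (0 : ℝ)) hi.integrableOn hi.integrableOn
  have h4 := setIntegral_gammaDensity_le_weightMoment hκ n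
  have h5 : d ≤ d / c * ∫ ζ in Ioi 0, gammaDensity κ (2 * n) ζ := by
    rw [div_mul_eq_mul_div, le_div_iff₀ hcpos]
    gcongr
  have h6 : d / c * ∫ ζ in Ioi 0, gammaDensity κ (2 * n) ζ ≤ d / c * weightMoment κ n := by gcongr
  rw [← h3, add_mul, one_mul]
  linarith


/-! ### Asymptotic size of the circular waves -/

/-- A bound that holds from some index on holds everywhere after enlarging the constant. -/
lemma exists_forall_le_mul {f g : ℕ → ℝ} (hg : ∀ n, 0 < g n) {N : ℕ} {C : ℝ}
    (h : ∀ n, N ≤ n → f n ≤ C * g n) : ∃ C' > 0, ∀ n, f n ≤ C' * g n := by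
  refine ⟨|C| + ∑ n ∈ Finset.range N, |f n| / g n + 1, ?_, fun n => ?_⟩
  · have : 0 ≤ ∑ n ∈ Finset.range N, |f n| / g n :=
      Finset.sum_nonneg fun n _ => div_nonneg (abs_nonneg _) (hg n).le
    have := abs_nonneg C
    linarith
  · have h0 : 0 ≤ ∑ n ∈ Finset.range N, |f n| / g n :=
      Finset.sum_nonneg fun n _ => div_nonneg (abs_nonneg _) (hg n).le
    have hC := abs_nonneg C
    rcases le_or_gt N n with hn | hn
    · refine (h n hn).trans (mul_le_mul_of_nonneg_right ?_ (hg n).le)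
      linarith [le_abs_self C]
    · have h1 : |f n| / g n ≤ ∑ n ∈ Finset.range N, |f n| / g n :=
        Finset.single_le_sum (f := fun n => |f n| / g n)
          (fun n _ => div_nonneg (abs_nonneg _) (hg n).le) (Finset.mem_range.mpr hn)
      have h2 : f n ≤ |f n| / g n * g n := by
        rw [div_mul_cancel₀ _ (hg n).ne']
        exact le_abs_self _
      refine h2.trans (mul_le_mul_of_nonneg_right ?_ (hg n).le)
      linarith

/-- The leading coefficient `((κ/2)ⁿ / n!)²` of `J_n(κ r)²`. -/
def besselLead (κ : ℝ) (n : ℕ) : ℝ := ((κ / 2) ^ n / n.factorial) ^ 2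

lemma besselLead_pos {κ : ℝ} (hκ : 0 < κ) (n : ℕ) : 0 < besselLead κ n := by
  unfold besselLead; positivity

lemma besselLead_succ (κ : ℝ) (n : ℕ) :
    besselLead κ (n + 1) * (n + 1) ^ 2 = κ ^ 2 / 4 * besselLead κ n := by
  have h : (n.factorial : ℝ) ≠ 0 := by exact_mod_cast n.factorial_ne_zero
  have h1 : (n : ℝ) + 1 ≠ 0 := by positivity
  simp only [besselLead, Nat.factorial_succ]
  push_cast
  field_simp
  ring

lemma besselJ_sq_le {κ : ℝ} (hκ : 0 < κ) (n : ℕ) {r : ℝ} (hr : 0 ≤ r) (hr1 : r ≤ 1) :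
    |besselJ n (κ * r)| ^ 2 ≤ Real.exp (κ ^ 2 / 2) * besselLead κ n * r ^ (2 * n) := by
  have h := abs_besselJ_le n (mul_nonneg hκ.le hr)
  have h1 : Real.exp ((κ * r) ^ 2 / 4) ≤ Real.exp (κ ^ 2 / 4) := by
    gcongr
    exact mul_le_of_le_one_right hκ.le hr1
  have h2 : |besselJ n (κ * r)| ≤ (κ * r / 2) ^ n / n.factorial * Real.exp (κ ^ 2 / 4) :=
    h.trans (by gcongr)
  calc |besselJ n (κ * r)| ^ 2 ≤ ((κ * r / 2) ^ n / n.factorial * Real.exp (κ ^ 2 / 4)) ^ 2 := by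
        gcongr
    _ = Real.exp (κ ^ 2 / 2) * besselLead κ n * r ^ (2 * n) := by
        rw [mul_pow, ← Real.exp_nat_mul, besselLead, mul_div_right_comm, mul_pow]
        rw [show ((2 : ℕ) : ℝ) * (κ ^ 2 / 4) = κ ^ 2 / 2 by push_cast; ring]
        ring

lemma le_besselJ_sq {κ : ℝ} (hκ : 0 < κ) {n : ℕ} (hn : 2 * (Real.exp (κ ^ 2 / 4) - 1) ≤ n + 1)
    {r : ℝ} (hr : 0 ≤ r) (hr1 : r ≤ 1) :
    1 / 4 * besselLead κ n * r ^ (2 * n) ≤ |besselJ n (κ * r)| ^ 2 := by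
  have h1 : Real.exp ((κ * r) ^ 2 / 4) ≤ Real.exp (κ ^ 2 / 4) := by
    gcongr
    exact mul_le_of_le_one_right hκ.le hr1
  have h := le_abs_besselJ (n := n) (mul_nonneg hκ.le hr) (by linarith)
  calc 1 / 4 * besselLead κ n * r ^ (2 * n) = ((κ * r / 2) ^ n / n.factorial / 2) ^ 2 := by
        rw [besselLead, mul_div_right_comm, mul_pow]
        ring
    _ ≤ |besselJ n (κ * r)| ^ 2 := by gcongr

lemma integral_norm_pow (n : ℕ) :
    ∫ x, ‖x‖ ^ (2 * n) ∂diskMeasure = Real.pi / (n + 1) := by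
  have h := integral_fun_norm_addHaar (volume : Measure ℂ)
    (fun r : ℝ => (Iio (1 : ℝ)).indicator (fun r => r ^ (2 * n)) r)
  have e1 : ∫ x : ℂ, (Iio (1 : ℝ)).indicator (fun r => r ^ (2 * n)) ‖x‖ =
      ∫ x, ‖x‖ ^ (2 * n) ∂diskMeasure := by
    rw [diskMeasure, disk, ← integral_indicator Metric.isOpen_ball.measurableSet]
    refine integral_congr_ae (.of_forall fun x => ?_)
    beta_reduce
    by_cases hx : ‖x‖ < 1
    · rw [indicator_of_mem (mem_Iio.mpr hx), indicator_of_mem (mem_ball_zero_iff.mpr hx)]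
    · rw [indicator_of_notMem (by simpa using hx), indicator_of_notMem (by simpa using hx)]
  have e2 : ∫ y in Ioi (0 : ℝ), y ^ (Module.finrank ℝ ℂ - 1) •
      (Iio (1 : ℝ)).indicator (fun r => r ^ (2 * n)) y = 1 / (2 * n + 2) := by
    have : ∀ y : ℝ, y ^ (Module.finrank ℝ ℂ - 1) •
        (Iio (1 : ℝ)).indicator (fun r => r ^ (2 * n)) y =
        (Iio (1 : ℝ)).indicator (fun r => r ^ (2 * n + 1)) y := by
      intro y
      simp only [Complex.finrank_real_complex, indicator_apply, smul_eq_mul]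
      split_ifs <;> ring
    simp_rw [this]
    rw [setIntegral_indicator measurableSet_Iio, Ioi_inter_Iio, ← integral_Ioc_eq_integral_Ioo,
      ← intervalIntegral.integral_of_le zero_le_one, integral_pow]
    push_cast
    simp
    ring
  rw [e1, e2] at h
  rw [h]
  simp [Measure.real, Complex.volume_ball, Complex.finrank_real_complex]
  field_simp

lemma circularMass_natCast (κ : ℝ) (n : ℕ) :
    circularMass κ n = ∫ x, |besselJ n (κ * ‖x‖)| ^ 2 ∂diskMeasure := by
  simp only [circularMass, norm_circularWaveTilde, Int.natAbs_natCast]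

lemma integrable_norm_pow (n : ℕ) : Integrable (fun x : ℂ => ‖x‖ ^ (2 * n)) diskMeasure := by
  refine .of_integral_ne_zero ?_
  rw [integral_norm_pow]
  positivity

lemma integrable_besselJ_sq (κ : ℝ) (n : ℕ) :
    Integrable (fun x : ℂ => |besselJ n (κ * ‖x‖)| ^ 2) diskMeasure := by
  have h := (memLp_two_iff_integrable_sq_norm (memLp_circularWaveTilde κ n).1).mp
      (memLp_circularWaveTilde κ n)
  simpa only [norm_circularWaveTilde, Int.natAbs_natCast] using h

lemma norm_le_one_ae : ∀ᵐ x ∂diskMeasure, ‖x‖ ≤ 1 := by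
  filter_upwards [ae_restrict_mem Metric.isOpen_ball.measurableSet] with x hx
  exact (mem_ball_zero_iff.mp hx).le

lemma circularMass_le {κ : ℝ} (hκ : 0 < κ) (n : ℕ) : circularMass κ n ≤
    Real.exp (κ ^ 2 / 2) * Real.pi * (besselLead κ n / (n + 1)) := by
  rw [circularMass_natCast]
  calc _ ≤ ∫ x, Real.exp (κ ^ 2 / 2) * besselLead κ n * ‖x‖ ^ (2 * n) ∂diskMeasure := by
        refine integral_mono_ae (integrable_besselJ_sq κ n) ((integrable_norm_pow n).const_mul _) ?_
        filter_upwards [norm_le_one_ae] with x hx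
        exact besselJ_sq_le hκ n (norm_nonneg x) hx
    _ = _ := by
        rw [integral_const_mul, integral_norm_pow]
        ring

/-- An index from which on the leading term dominates the Bessel series on `[0, κ]`. -/
def largeIndex (κ : ℝ) : ℕ := ⌈2 * (Real.exp (κ ^ 2 / 4) - 1)⌉₊

lemma le_of_largeIndex_le {κ : ℝ} {n : ℕ} (hn : largeIndex κ ≤ n) :
    2 * (Real.exp (κ ^ 2 / 4) - 1) ≤ n + 1 := by
  have := Nat.ceil_le.mp hn
  linarith

lemma exists_le_circularMass {κ : ℝ} (hκ : 0 < κ) :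
    ∃ C > 0, ∀ n : ℕ, besselLead κ n / (n + 1) ≤ C * circularMass κ n := by
  refine exists_forall_le_mul (fun n => circularMass_pos hκ n) (N := largeIndex κ) (C := 4) ?_
  intro n hn
  rw [circularMass_natCast]
  have : ∫ x, 1 / 4 * besselLead κ n * ‖x‖ ^ (2 * n) ∂diskMeasure ≤
      ∫ x, |besselJ n (κ * ‖x‖)| ^ 2 ∂diskMeasure := by
    refine integral_mono_ae ((integrable_norm_pow n).const_mul _) (integrable_besselJ_sq κ n) ?_
    filter_upwards [norm_le_one_ae] with x hx
    exact le_besselJ_sq hκ (le_of_largeIndex_le hn) (norm_nonneg x) hx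
  rw [integral_const_mul, integral_norm_pow] at this
  have h2 : besselLead κ n / (n + 1) ≤ besselLead κ n * (Real.pi / (n + 1)) := by
    rw [mul_div_assoc']
    have := besselLead_pos hκ n
    gcongr
    nlinarith [Real.pi_gt_three]
  linarith

lemma circularEnergy_natAbs (κ : ℝ) (p : ℤ) : circularEnergy κ p = circularEnergy κ p.natAbs := by
  rcases Int.natAbs_eq p with h | h
  · rw [← h]
  · have h1 : (p - 1).natAbs = ((p.natAbs : ℤ) + 1).natAbs := by omega
    have h2 : (p + 1).natAbs = ((p.natAbs : ℤ) - 1).natAbs := by omega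
    simp only [circularEnergy]
    rw [circularMass_natAbs κ p, circularMass_natAbs κ (p - 1), circularMass_natAbs κ (p + 1),
      h1, h2,
      ← circularMass_natAbs κ (p.natAbs + 1), ← circularMass_natAbs κ (p.natAbs - 1)]
    ring

lemma circularEnergy_succ (κ : ℝ) (n : ℕ) : circularEnergy κ (n + 1 : ℕ) =
    circularMass κ (n + 1 : ℕ) + 1 / 2 * (circularMass κ n + circularMass κ (n + 2 : ℕ)) := by
  rw [circularEnergy]
  push_cast
  rw [add_sub_cancel_right, add_assoc (n : ℤ) 1 1, one_add_one_eq_two]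

lemma exists_le_circularEnergy {κ : ℝ} (hκ : 0 < κ) :
    ∃ C > 0, ∀ n : ℕ, besselLead κ n * (n + 1) ≤ C * circularEnergy κ n := by
  obtain ⟨C, hC, h⟩ := exists_le_circularMass hκ
  refine exists_forall_le_mul (fun n => circularEnergy_pos hκ n) (N := 1) (C := κ ^ 2 * C) ?_
  intro n hn
  obtain ⟨n, rfl⟩ : ∃ m, n = m + 1 := ⟨n - 1, by omega⟩
  rw [circularEnergy_succ]
  have h1 := h n
  have h2 := besselLead_succ κ n
  have p1 := circularMass_pos hκ (n + 1 : ℕ)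
  have p2 := circularMass_pos hκ (n + 2 : ℕ)
  have p3 := besselLead_pos hκ (n + 1)
  have hn1 : (0 : ℝ) < n + 1 := by positivity
  have h3 : besselLead κ (n + 1) * (n + 1) = κ ^ 2 / 4 * (besselLead κ n / (n + 1)) := by
    field_simp
    field_simp at h2
    linarith
  have h4 : besselLead κ (n + 1) * ((n + 1 : ℕ) + 1 : ℝ) ≤
      2 * (besselLead κ (n + 1) * (n + 1)) := by
    push_cast
    nlinarith [(Nat.cast_nonneg n : (0 : ℝ) ≤ n)]
  have h5 : κ ^ 2 / 4 * (besselLead κ n / (n + 1)) ≤ κ ^ 2 / 4 * (C * circularMass κ n) := by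
    gcongr
  have h6 : 0 ≤ κ ^ 2 * C * circularMass κ (n + 1 : ℕ) := by positivity
  have h7 : 0 ≤ κ ^ 2 * C * circularMass κ (n + 2 : ℕ) := by positivity
  rw [h3] at h4
  linarith

lemma exists_circularEnergy_le {κ : ℝ} (hκ : 0 < κ) :
    ∃ C > 0, ∀ n : ℕ, circularEnergy κ n ≤ C * (besselLead κ n * (n + 1)) := by
  set A := Real.exp (κ ^ 2 / 2) * Real.pi with hA
  have hA0 : 0 < A := by positivity
  refine exists_forall_le_mul (fun n => mul_pos (besselLead_pos hκ n) (by positivity)) (N := 1)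
    (C := A + A * 2 / κ ^ 2 + A * κ ^ 2 / 8) ?_
  intro n hn
  obtain ⟨n, rfl⟩ : ∃ m, n = m + 1 := ⟨n - 1, by omega⟩
  rw [circularEnergy_succ]
  have h0 := circularMass_le hκ n
  have h1 := circularMass_le hκ (n + 1)
  have h2 := circularMass_le hκ (n + 2)
  have s0 := besselLead_succ κ n
  have s1 := besselLead_succ κ (n + 1)
  set X := besselLead κ (n + 1)
  have hX : 0 < X := besselLead_pos hκ (n + 1)
  have hX2 := besselLead_pos hκ (n + 2)
  have hn0 : (0 : ℝ) ≤ n := Nat.cast_nonneg n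
  push_cast at h0 h1 h2 s0 s1 ⊢
  set Y := X * ((n : ℝ) + 1 + 1) with hY
  have hYX : X ≤ Y := by rw [hY]; nlinarith
  have e1 : X / ((n : ℝ) + 1 + 1) ≤ Y := (div_le_self hX.le (by linarith)).trans hYX
  have e0 : besselLead κ n / ((n : ℝ) + 1) ≤ 4 / κ ^ 2 * Y := by
    have : besselLead κ n = 4 / κ ^ 2 * (X * ((n : ℝ) + 1) ^ 2) := by
      rw [s0]; field_simp
    have h3 : X * ((n : ℝ) + 1) ^ 2 ≤ Y * ((n : ℝ) + 1) := by
      rw [hY, sq, ← mul_assoc]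
      gcongr
      linarith
    rw [this, div_le_iff₀ (by positivity), mul_assoc]
    exact mul_le_mul_of_nonneg_left h3 (by positivity)
  have e2 : besselLead κ (n + 2) / ((n : ℝ) + 2 + 1) ≤ κ ^ 2 / 4 * Y := by
    refine (div_le_self hX2.le (by linarith)).trans ?_
    have : besselLead κ (n + 2) ≤ κ ^ 2 / 4 * X := by
      rw [← s1]
      refine le_mul_of_one_le_right hX2.le ?_
      nlinarith
    exact this.trans (by gcongr)
  have f0 : circularMass κ n ≤ A * (4 / κ ^ 2 * Y) := h0.trans (by gcongr)
  have f1 : circularMass κ (n + 1) ≤ A * Y := h1.trans (by gcongr)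
  have f2 : circularMass κ (n + 2) ≤ A * (κ ^ 2 / 4 * Y) := h2.trans (by gcongr)
  have : (A + A * 2 / κ ^ 2 + A * κ ^ 2 / 8) * Y =
      A * Y + 1 / 2 * (A * (4 / κ ^ 2 * Y) + A * (κ ^ 2 / 4 * Y)) := by ring
  rw [this]
  linarith

/-- Unless some Bessel function vanishes at `κ`, the `L²(B₁)` norms of the circular waves are
controlled by their boundary values. -/
lemma exists_circularMass_le {κ : ℝ} (hκ : 0 < κ) (hJ : ∀ n : ℕ, besselJ n κ ≠ 0) :
    ∃ C > 0, ∀ n : ℕ, circularMass κ n ≤ C * |besselJ n κ| ^ 2 := by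
  refine exists_forall_le_mul (fun n => by have := hJ n; positivity) (N := largeIndex κ)
    (C := Real.exp (κ ^ 2 / 2) * Real.pi * 4) ?_
  intro n hn
  have h1 := le_besselJ_sq hκ (le_of_largeIndex_le hn) zero_le_one le_rfl
  rw [mul_one, one_pow, mul_one] at h1
  have hX := besselLead_pos hκ n
  refine (circularMass_le hκ n).trans ?_
  rw [mul_assoc _ 4]
  gcongr
  refine (div_le_self hX.le (by linarith [(Nat.cast_nonneg n : (0 : ℝ) ≤ n)])).trans ?_
  linarith

/-! ### Matching growth of the two families -/

/-- The quantity `Γ(2n + 1/2) n / (4ⁿ n!²)`; by Stirling's formula it converges. -/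
def gammaRatio (n : ℕ) : ℝ :=
  Real.Gamma (2 * n + 1 / 2) * n / (4 ^ n * (n.factorial : ℝ) ^ 2)

lemma gammaRatio_succ {n : ℕ} (hn : 1 ≤ n) :
    gammaRatio (n + 1) = gammaRatio n * (1 + 3 / (16 * (n * (n + 1)))) := by
  have h : (n.factorial : ℝ) ≠ 0 := by exact_mod_cast n.factorial_ne_zero
  have hn0 : (n : ℝ) ≠ 0 := by positivity
  have e : Real.Gamma (2 * ((n + 1 : ℕ) : ℝ) + 1 / 2) =
      (2 * n + 3 / 2) * ((2 * n + 1 / 2) * Real.Gamma (2 * n + 1 / 2)) := by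
    rw [← Real.Gamma_add_one (by positivity),
      show (2 * (n : ℝ) + 3 / 2) = 2 * n + 1 / 2 + 1 by ring,
      ← Real.Gamma_add_one (by positivity)]
    congr 1
    push_cast
    ring
  rw [gammaRatio, e, gammaRatio, Nat.factorial_succ]
  push_cast
  field_simp
  ring

lemma gammaRatio_pos {n : ℕ} (hn : 1 ≤ n) : 0 < gammaRatio n := by
  have := Real.Gamma_pos_of_pos (show (0 : ℝ) < 2 * n + 1 / 2 by positivity)
  have hn0 : (0 : ℝ) < n := by exact_mod_cast hn
  unfold gammaRatio
  positivity

lemma gammaRatio_bounds {n : ℕ} (hn : 1 ≤ n) :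
    gammaRatio 1 ≤ gammaRatio n ∧ gammaRatio n ≤ 2 * gammaRatio 1 := by
  -- the upper bound holds because `gammaRatio n * (1 + 1 / n)` decreases
  have key : gammaRatio 1 ≤ gammaRatio n ∧ gammaRatio n * (1 + 1 / n) ≤ 2 * gammaRatio 1 := by
    induction n, hn using Nat.le_induction with
    | base => exact ⟨le_rfl, by norm_num; linarith⟩
    | succ n hn ih =>
      have hn0 : (1 : ℝ) ≤ n := by exact_mod_cast hn
      have hp := gammaRatio_pos hn
      rw [gammaRatio_succ hn]
      refine ⟨ih.1.trans (le_mul_of_one_le_right hp.le ?_), le_trans ?_ ih.2⟩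
      · have : (0 : ℝ) ≤ 3 / (16 * (n * (n + 1))) := by positivity
        linarith
      · rw [mul_assoc]
        refine mul_le_mul_of_nonneg_left ?_ hp.le
        push_cast
        have : (1 + 3 / (16 * ((n : ℝ) * (n + 1)))) * (1 + 1 / ((n : ℝ) + 1)) =
            1 + 1 / n - (13 * n + 10) / (16 * n * (n + 1) ^ 2) := by
          field_simp
          ring
        rw [this]
        have : (0 : ℝ) ≤ (13 * n + 10) / (16 * n * (n + 1) ^ 2) := by positivity
        linarith
  have hn0 : (1 : ℝ) ≤ n := by exact_mod_cast hn
  refine ⟨key.1, le_trans ?_ key.2⟩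
  have : (0 : ℝ) ≤ 1 / n := by positivity
  exact le_mul_of_one_le_right (gammaRatio_pos hn).le (by linarith)

lemma integral_gammaDensity_mul {κ : ℝ} (hκ : 0 < κ) {n : ℕ} (hn : 1 ≤ n) :
    (∫ ζ, gammaDensity κ (2 * n) ζ) * (besselLead κ n * n) =
      (1 / κ) ^ (1 / 2 : ℝ) * gammaRatio n := by
  rw [integral_gammaDensity hκ (by positivity), Real.rpow_add (by positivity),
    show (2 * (n : ℝ)) = ((2 * n : ℕ) : ℝ) by push_cast; ring, Real.rpow_natCast, gammaRatio,
    besselLead]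
  push_cast
  have h : (n.factorial : ℝ) ≠ 0 := by exact_mod_cast n.factorial_ne_zero
  have h4 : (4 : ℝ) ^ n = (2 ^ n) ^ 2 := by rw [← pow_mul, mul_comm, pow_mul]; norm_num
  rw [h4, div_pow, div_pow, div_pow, one_pow, pow_mul' κ 2 n]
  field_simp

/-- The norms of `ã_p` and `b̃_p` are inversely proportional, up to bounded factors. -/
lemma exists_weightMoment_mul_circularEnergy_bounds {κ : ℝ} (hκ : 0 < κ) :
    ∃ c C : ℝ, 0 < c ∧ 0 < C ∧ ∀ p : ℤ, c ≤ weightMoment κ p * circularEnergy κ p ∧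
      weightMoment κ p * circularEnergy κ p ≤ C := by
  obtain ⟨C₁, hC₁, h₁⟩ := exists_gamma_le_weightMoment hκ
  obtain ⟨C₂, hC₂, h₂⟩ := exists_le_circularEnergy hκ
  obtain ⟨C₃, hC₃, h₃⟩ := exists_circularEnergy_le hκ
  have hM (n : ℕ) := weightMoment_pos hκ n
  have hE (n : ℕ) := circularEnergy_pos hκ n
  have hX (n : ℕ) := besselLead_pos hκ n
  set k := (1 / κ) ^ (1 / 2 : ℝ)
  have hk : 0 < k := by positivity
  have hr := gammaRatio_pos le_rfl
  obtain ⟨A, hA, hA'⟩ := exists_forall_le_mul (f := fun n => weightMoment κ n * circularEnergy κ n)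
    (g := fun _ => 1) (fun _ => one_pos) (N := 1)
    (C := 2 * Real.exp κ * C₃ * 2 * k * (2 * gammaRatio 1)) (by
      intro n hn
      have hn1 : (1 : ℝ) ≤ n := by exact_mod_cast hn
      have e := integral_gammaDensity_mul hκ hn
      have b := (gammaRatio_bounds hn).2
      set I := ∫ ζ, gammaDensity κ (2 * n) ζ
      have hI : 0 ≤ I := integral_nonneg fun ζ => (gammaDensity_pos κ _ ζ).le
      rw [mul_one]
      calc weightMoment κ n * circularEnergy κ n
          ≤ (2 * Real.exp κ * I) * (C₃ * (besselLead κ n * (n + n))) := by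
            have := hX n
            refine mul_le_mul (weightMoment_le hκ n) ((h₃ n).trans ?_) (hE n).le (by positivity)
            gcongr
        _ = 2 * Real.exp κ * C₃ * 2 * (I * (besselLead κ n * n)) := by ring
        _ = 2 * Real.exp κ * C₃ * 2 * k * gammaRatio n := by rw [e]; ring
        _ ≤ _ := by gcongr)
  obtain ⟨B, hB, hB'⟩ := exists_forall_le_mul (f := fun _ => 1)
    (g := fun n => weightMoment κ n * circularEnergy κ n)
    (fun n => mul_pos (hM n) (hE n)) (N := 1) (C := C₁ * C₂ / (k * gammaRatio 1)) (by
      intro n hn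
      have e := integral_gammaDensity_mul hκ hn
      have b := (gammaRatio_bounds hn).1
      set I := ∫ ζ, gammaDensity κ (2 * n) ζ
      have hI : 0 ≤ I := integral_nonneg fun ζ => (gammaDensity_pos κ _ ζ).le
      have hC1 := h₁ n
      have hC2 : besselLead κ n * n ≤ C₂ * circularEnergy κ n := by
        refine le_trans ?_ (h₂ n)
        have := hX n
        gcongr
        linarith
      have : k * gammaRatio 1 ≤ C₁ * C₂ * (weightMoment κ n * circularEnergy κ n) := by
        calc k * gammaRatio 1 ≤ k * gammaRatio n := by gcongr
          _ = I * (besselLead κ n * n) := e.symm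
          _ ≤ (C₁ * weightMoment κ n) * (C₂ * circularEnergy κ n) := by
              have := hX n
              have := hM n
              exact mul_le_mul hC1 hC2 (by positivity) (by positivity)
          _ = _ := by ring
      rw [div_mul_eq_mul_div, le_div_iff₀ (by positivity)]
      linarith)
  refine ⟨1 / B, A, by positivity, hA, fun p => ?_⟩
  rw [weightMoment_natAbs, circularEnergy_natAbs]
  refine ⟨?_, by simpa using hA' p.natAbs⟩
  rw [div_le_iff₀ hB, mul_comm]
  exact hB' p.natAbs


/-! ### Orthonormal expansions -/

section Hilbert

variable {H : Type*} [NormedAddCommGroup H] [InnerProductSpace ℂ H] [CompleteSpace H]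

/-- The orthonormal expansion of an element of the closed span of an orthonormal family. -/
lemma hasSum_of_mem_closure_span {ι : Type*} {e : ι → H} (he : Orthonormal ℂ e) {x : H}
    (hx : x ∈ (Submodule.span ℂ (range e)).topologicalClosure) :
    HasSum (fun i => inner ℂ (e i) x • e i) x := by
  set K := (Submodule.span ℂ (range e)).topologicalClosure with hK
  have hcl : IsClosed (K : Set H) := Submodule.isClosed_topologicalClosure _
  have : CompleteSpace K := hcl.completeSpace_coe
  let e' : ι → K := fun i => ⟨e i, Submodule.le_topologicalClosure _
    (Submodule.subset_span ⟨i, rfl⟩)⟩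
  have he' : Orthonormal ℂ e' := ⟨fun i => he.1 i, fun i j hij => he.2 hij⟩
  have hbot : (Submodule.span ℂ (range e'))ᗮ = ⊥ := by
    rw [Submodule.eq_bot_iff]
    intro z hz
    have h1 : (z : H) ∈ (Submodule.span ℂ (range e))ᗮ := by
      rw [Submodule.mem_orthogonal]
      intro w hw
      induction hw using Submodule.span_induction with
      | mem w hw =>
        obtain ⟨i, rfl⟩ := hw
        exact (Submodule.mem_orthogonal _ z).mp hz (e' i) (Submodule.subset_span ⟨i, rfl⟩)
      | zero => simp
      | add a b _ _ ha hb => rw [inner_add_left, ha, hb, add_zero]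
      | smul a b _ hb => rw [inner_smul_left, hb, mul_zero]
    rw [← Submodule.orthogonal_closure] at h1
    have h2 : inner ℂ (z : H) (z : H) = 0 := (Submodule.mem_orthogonal _ _).mp h1 z z.2
    exact Subtype.ext (inner_self_eq_zero.mp h2)
  let b := HilbertBasis.mkOfOrthogonalEqBot he' hbot
  have hb : ∀ i, b i = e' i := fun i => by simp [b]
  have h := (b.hasSum_repr ⟨x, hx⟩).mapL K.subtypeL
  simp only [b.repr_apply_apply, hb] at h
  exact h

lemma hasSum_inner_of_mem_closure_span {ι : Type*} {e : ι → H} (he : Orthonormal ℂ e) {x : H}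
    (hx : x ∈ (Submodule.span ℂ (range e)).topologicalClosure) (z : H) :
    HasSum (fun i => inner ℂ (e i) x * inner ℂ z (e i)) (inner ℂ z x) := by
  have h := (hasSum_of_mem_closure_span he hx).mapL (innerSL ℂ z)
  simpa [inner_smul_right] using h

/-- Parseval's identity. -/
lemma hasSum_norm_sq_of_mem_closure_span {ι : Type*} {e : ι → H} (he : Orthonormal ℂ e) {x : H}
    (hx : x ∈ (Submodule.span ℂ (range e)).topologicalClosure) :
    HasSum (fun i => ‖inner ℂ (e i) x‖ ^ 2) (‖x‖ ^ 2) := by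
  have h := hasSum_inner_of_mem_closure_span he hx x
  have e2 : inner ℂ x x = ((‖x‖ ^ 2 : ℝ) : ℂ) := by
    rw [inner_self_eq_norm_sq_to_K]
    simp
  rw [e2] at h
  have e1 : (fun i => inner ℂ (e i) x * inner ℂ x (e i)) =
      fun i => (((‖inner ℂ (e i) x‖ ^ 2 : ℝ)) : ℂ) := by
    funext i
    rw [← inner_conj_symm x (e i), Complex.mul_conj']
    push_cast
    rfl
  rw [e1] at h
  exact Complex.hasSum_ofReal.mp h

end Hilbert

/-! ### The space `A` -/

lemma measurable_weightSq (κ : ℝ) : Measurable fun ζ => ENNReal.ofReal (weightSq κ ζ) :=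
  (continuous_weightSq κ).measurable.ennreal_ofReal

/-- The measure `w(ζ)² dζ`. -/
def zetaMeasure (κ : ℝ) : Measure ℝ := volume.withDensity fun ζ => ENNReal.ofReal (weightSq κ ζ)

instance (κ : ℝ) : SFinite (zetaMeasure κ) := by unfold zetaMeasure; infer_instance

lemma weightMeasure_eq (κ : ℝ) :
    weightMeasure κ = (volume.restrict (Ico 0 (2 * Real.pi))).prod (zetaMeasure κ) := by
  rw [zetaMeasure, prod_withDensity_right (measurable_weightSq κ), weightMeasure, cylinder]
  have h : (volume.restrict (Ico 0 (2 * Real.pi))).prod (volume : Measure ℝ) =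
      volume.restrict (Ico 0 (2 * Real.pi) ×ˢ univ) := by
    have h := Measure.prod_restrict (μ := (volume : Measure ℝ)) (ν := (volume : Measure ℝ))
      (Ico 0 (2 * Real.pi)) univ
    rwa [Measure.restrict_univ] at h
  rw [h]
  rfl

lemma integral_zetaMeasure {E : Type*} [NormedAddCommGroup E] [NormedSpace ℝ E] (κ : ℝ)
    (g : ℝ → E) : ∫ ζ, g ζ ∂zetaMeasure κ = ∫ ζ, weightSq κ ζ • g ζ := by
  rw [zetaMeasure, integral_withDensity_eq_integral_toReal_smul (measurable_weightSq κ)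
    (.of_forall fun _ => ENNReal.ofReal_lt_top)]
  refine integral_congr_ae (.of_forall fun ζ => ?_)
  simp [ENNReal.toReal_ofReal (weightSq_pos κ ζ).le]

lemma integrable_exp_zetaMeasure {κ : ℝ} (hκ : 0 < κ) (k : ℝ) :
    Integrable (fun ζ => Real.exp (k * ζ)) (zetaMeasure κ) := by
  rw [zetaMeasure, integrable_withDensity_iff_integrable_smul₀' (measurable_weightSq κ).aemeasurable
    (.of_forall fun _ => ENNReal.ofReal_lt_top)]
  refine (integrable_exp_mul_weightSq hκ k).congr (.of_forall fun ζ => ?_)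
  simp [ENNReal.toReal_ofReal (weightSq_pos κ ζ).le, mul_comm]

lemma norm_herglotzTilde (p : ℤ) (y : ℝ × ℝ) : ‖herglotzTilde p y‖ = Real.exp (p * y.2) := by
  rw [herglotzTilde, ← Complex.exp_add, Complex.norm_exp]
  simp

lemma continuous_herglotzTilde (p : ℤ) : Continuous (herglotzTilde p) := by
  unfold herglotzTilde; fun_prop

lemma norm_herglotzTilde_sq (p : ℤ) (y : ℝ × ℝ) :
    ‖herglotzTilde p y‖ ^ 2 = 1 * Real.exp (2 * p * y.2) := by
  rw [norm_herglotzTilde, ← Real.exp_nat_mul, one_mul]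
  congr 1
  push_cast
  ring

lemma integral_norm_herglotzTilde_sq (κ : ℝ) (p : ℤ) :
    ∫ y, ‖herglotzTilde p y‖ ^ 2 ∂weightMeasure κ = 2 * Real.pi * weightMoment κ p := by
  simp_rw [norm_herglotzTilde_sq]
  rw [weightMeasure_eq, integral_prod_mul (fun _ : ℝ => (1 : ℝ)) (fun ζ => Real.exp (2 * p * ζ)),
    integral_zetaMeasure, weightMoment]
  congr 1
  · simp [Real.pi_pos.le]
  · refine integral_congr_ae (.of_forall fun ζ => ?_)
    simp [mul_comm]

lemma memLp_herglotzTilde {κ : ℝ} (hκ : 0 < κ) (p : ℤ) :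
    MemLp (herglotzTilde p) 2 (weightMeasure κ) := by
  rw [memLp_two_iff_integrable_sq_norm (continuous_herglotzTilde p).aestronglyMeasurable]
  simp_rw [norm_herglotzTilde_sq]
  rw [weightMeasure_eq]
  exact Integrable.mul_prod (f := fun _ : ℝ => (1 : ℝ)) (integrable_const 1)
    (integrable_exp_zetaMeasure hκ (2 * p))

lemma integral_herglotzTilde_mul {κ : ℝ} {p q : ℤ} (hpq : p ≠ q) :
    ∫ y, conj (herglotzTilde p y) * herglotzTilde q y ∂weightMeasure κ = 0 := by
  have e : ∀ y : ℝ × ℝ, conj (herglotzTilde p y) * herglotzTilde q y =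
      Complex.exp ((Complex.I * (q - p)) * y.1) * Complex.exp ((p + q) * y.2) := by
    intro y
    rw [herglotzTilde, herglotzTilde, map_mul, ← Complex.exp_conj, ← Complex.exp_conj,
      ← Complex.exp_add, ← Complex.exp_add, ← Complex.exp_add, ← Complex.exp_add]
    congr 1
    simp
    ring
  have hne : Complex.I * ((q : ℂ) - p) ≠ 0 :=
    mul_ne_zero Complex.I_ne_zero (sub_ne_zero.mpr (by exact_mod_cast hpq.symm))
  simp_rw [e]
  rw [weightMeasure_eq, integral_prod_mul
    (fun φ : ℝ => Complex.exp ((Complex.I * (q - p)) * φ))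
    (fun ζ : ℝ => Complex.exp ((p + q) * ζ)), integral_Ico_eq_integral_Ioc,
    ← intervalIntegral.integral_of_le (by positivity), integral_exp_mul_complex hne]
  have : Complex.exp (Complex.I * (q - p) * ((2 * Real.pi : ℝ) : ℂ)) = 1 := by
    rw [Complex.exp_eq_one_iff]
    exact ⟨q - p, by push_cast; ring⟩
  rw [this]
  simp

lemma normA_herglotzTilde_sq (κ : ℝ) (p : ℤ) :
    normA κ (herglotzTilde p) ^ 2 = 2 * Real.pi * weightMoment κ p := by
  rw [normA, Real.sq_sqrt (integral_nonneg fun _ => by positivity), integral_norm_herglotzTilde_sq]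

lemma normA_herglotzTilde_pos {κ : ℝ} (hκ : 0 < κ) (p : ℤ) : 0 < normA κ (herglotzTilde p) := by
  have h := normA_herglotzTilde_sq κ p
  have h2 := weightMoment_pos hκ p
  refine lt_of_le_of_ne (Real.sqrt_nonneg _) fun h0 => ?_
  rw [← h0] at h
  have : 0 < 2 * Real.pi * weightMoment κ p := by positivity
  simp at h
  linarith [Real.pi_pos]

/-- The Hilbert space `L²(Y; w²)`. -/
abbrev DensitySpace (κ : ℝ) := Lp ℂ 2 (weightMeasure κ)

lemma memLp_herglotz {κ : ℝ} (hκ : 0 < κ) (p : ℤ) : MemLp (herglotz κ p) 2 (weightMeasure κ) :=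
  (memLp_herglotzTilde hκ p).const_mul _

lemma continuous_herglotz (κ : ℝ) (p : ℤ) : Continuous (herglotz κ p) :=
  continuous_const.mul (continuous_herglotzTilde p)

/-- The class of `a_p` in `L²(Y; w²)`. -/
def herglotzVec {κ : ℝ} (hκ : 0 < κ) (p : ℤ) : DensitySpace κ := (memLp_herglotz hκ p).toLp _

/-- A function in the class `F` has the norm of `F`. -/
lemma normA_eq {κ : ℝ} {v : ℝ × ℝ → ℂ} {F : DensitySpace κ} (h : F =ᵐ[weightMeasure κ] v) :
    normA κ v = ‖F‖ := by
  rw [normA, ← Real.sqrt_sq (norm_nonneg F), Lp_norm_sq]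
  congr 1
  refine integral_congr_ae ?_
  filter_upwards [h] with x hx
  rw [hx]

lemma innerA_eq {κ : ℝ} {u v : ℝ × ℝ → ℂ} {F G : DensitySpace κ} (hF : F =ᵐ[weightMeasure κ] u)
    (hG : G =ᵐ[weightMeasure κ] v) : innerA κ u v = inner ℂ G F := by
  rw [innerA, L2.inner_def]
  refine integral_congr_ae ?_
  filter_upwards [hF, hG] with x h1 h2
  rw [h1, h2, RCLike.inner_apply]

lemma coeFn_herglotzVec {κ : ℝ} (hκ : 0 < κ) (p : ℤ) :
    herglotzVec hκ p =ᵐ[weightMeasure κ] herglotz κ p := (memLp_herglotz hκ p).coeFn_toLp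

lemma orthonormal_herglotzVec {κ : ℝ} (hκ : 0 < κ) : Orthonormal ℂ (herglotzVec hκ) := by
  refine ⟨fun p => ?_, fun p q hpq => ?_⟩
  · have hpos := normA_herglotzTilde_pos hκ p
    rw [← normA_eq (coeFn_herglotzVec hκ p), normA]
    simp only [herglotz, norm_mul, mul_pow, Complex.norm_real, Real.norm_eq_abs, sq_abs]
    rw [integral_const_mul, integral_norm_herglotzTilde_sq, ← normA_herglotzTilde_sq, ← mul_pow,
      inv_mul_cancel₀ hpos.ne']
    simp
  · simp only
    rw [← innerA_eq (coeFn_herglotzVec hκ q) (coeFn_herglotzVec hκ p), innerA]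
    have e : ∀ y, herglotz κ q y * conj (herglotz κ p y) =
        ((((normA κ (herglotzTilde p))⁻¹ * (normA κ (herglotzTilde q))⁻¹ : ℝ)) : ℂ) *
          (conj (herglotzTilde p y) * herglotzTilde q y) := by
      intro y
      simp only [herglotz, map_mul, Complex.conj_ofReal]
      push_cast
      ring
    simp_rw [e]
    rw [integral_const_mul, integral_herglotzTilde_mul hpq, mul_zero]

/-- The space `A` as a closed subspace of `L²(Y; w²)`. -/
def densitySubspace {κ : ℝ} (hκ : 0 < κ) : Submodule ℂ (DensitySpace κ) :=
  (Submodule.span ℂ (range (herglotzVec hκ))).topologicalClosure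

lemma exists_vec_of_mem_span {κ : ℝ} (hκ : 0 < κ) {q : ℝ × ℝ → ℂ}
    (hq : q ∈ Submodule.span ℂ (range (herglotz κ))) :
    ∃ Q ∈ Submodule.span ℂ (range (herglotzVec hκ)), Q =ᵐ[weightMeasure κ] q := by
  induction hq using Submodule.span_induction with
  | mem x hx =>
    obtain ⟨p, rfl⟩ := hx
    exact ⟨_, Submodule.subset_span ⟨p, rfl⟩, coeFn_herglotzVec hκ p⟩
  | zero => exact ⟨0, Submodule.zero_mem _, Lp.coeFn_zero _ _ _⟩
  | add x y _ _ hx hy =>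
    obtain ⟨X, hX, hX'⟩ := hx
    obtain ⟨Y, hY, hY'⟩ := hy
    exact ⟨X + Y, Submodule.add_mem _ hX hY, (Lp.coeFn_add X Y).trans (hX'.add hY')⟩
  | smul a x _ hx =>
    obtain ⟨X, hX, hX'⟩ := hx
    exact ⟨a • X, Submodule.smul_mem _ _ hX, (Lp.coeFn_smul a X).trans (hX'.const_smul a)⟩

lemma exists_fun_of_mem_span {κ : ℝ} (hκ : 0 < κ) {Q : DensitySpace κ}
    (hQ : Q ∈ Submodule.span ℂ (range (herglotzVec hκ))) :
    ∃ q ∈ Submodule.span ℂ (range (herglotz κ)), Q =ᵐ[weightMeasure κ] q := by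
  induction hQ using Submodule.span_induction with
  | mem x hx =>
    obtain ⟨p, rfl⟩ := hx
    exact ⟨_, Submodule.subset_span ⟨p, rfl⟩, coeFn_herglotzVec hκ p⟩
  | zero => exact ⟨0, Submodule.zero_mem _, Lp.coeFn_zero _ _ _⟩
  | add x y _ _ hx hy =>
    obtain ⟨X, hX, hX'⟩ := hx
    obtain ⟨Y, hY, hY'⟩ := hy
    exact ⟨X + Y, Submodule.add_mem _ hX hY, (Lp.coeFn_add x y).trans (hX'.add hY')⟩
  | smul a x _ hx =>
    obtain ⟨X, hX, hX'⟩ := hx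
    exact ⟨a • X, Submodule.smul_mem _ _ hX, (Lp.coeFn_smul a x).trans (hX'.const_smul a)⟩

lemma memA_iff {κ : ℝ} (hκ : 0 < κ) {v : ℝ × ℝ → ℂ} :
    MemA κ v ↔ ∃ F ∈ densitySubspace hκ, F =ᵐ[weightMeasure κ] v := by
  constructor
  · rintro ⟨hv, happ⟩
    refine ⟨hv.toLp v, ?_, hv.coeFn_toLp⟩
    refine Metric.mem_closure_iff.mpr fun ε hε => ?_
    obtain ⟨q, hq, hlt⟩ := happ ε hε
    obtain ⟨Q, hQ, hQ'⟩ := exists_vec_of_mem_span hκ hq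
    exact ⟨Q, hQ, by
      rwa [dist_eq_norm, ← normA_eq ((Lp.coeFn_sub _ Q).trans (hv.coeFn_toLp.sub hQ'))]⟩
  · rintro ⟨F, hFc, hF⟩
    refine ⟨(memLp_congr_ae hF).mp (Lp.memLp F), fun ε hε => ?_⟩
    obtain ⟨Q, hQ, hlt⟩ := Metric.mem_closure_iff.mp hFc ε hε
    obtain ⟨q, hq, hq'⟩ := exists_fun_of_mem_span hκ hQ
    exact ⟨q, hq, by
      rwa [normA_eq ((Lp.coeFn_sub F Q).trans (hF.sub hq')), ← dist_eq_norm]⟩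

/-- The functions `a_p` decay exponentially in `|p|`, uniformly for bounded `ζ`. -/
lemma exists_norm_herglotz_le {κ : ℝ} (hκ : 0 < κ) {R : ℝ} (hR : 0 ≤ R) :
    ∃ C > 0, ∀ (p : ℤ) (y : ℝ × ℝ), |y.2| ≤ R →
      ‖herglotz κ p y‖ ≤ C * Real.exp (-1) ^ p.natAbs := by
  set m := ∫ ζ in Ioi (R + 1), gammaDensity κ 0 ζ with hm
  have hmpos : 0 < m := setIntegral_gammaDensity_pos hκ _
  refine ⟨(Real.sqrt (2 * Real.pi * m))⁻¹, by positivity, fun p y hy => ?_⟩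
  have hpos := normA_herglotzTilde_pos hκ p
  have h1 : Real.sqrt (2 * Real.pi * m) * Real.exp (p.natAbs * (R + 1)) ≤
      normA κ (herglotzTilde p) := by
    rw [← abs_of_pos hpos, ← abs_of_nonneg (show 0 ≤ Real.sqrt (2 * Real.pi * m) *
      Real.exp (p.natAbs * (R + 1)) by positivity), ← sq_le_sq, normA_herglotzTilde_sq, mul_pow,
      Real.sq_sqrt (by positivity), weightMoment_natAbs, ← Real.exp_nat_mul]
    have := exp_le_weightMoment hκ (by linarith : 0 ≤ R + 1) p.natAbs
    rw [← hm] at this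
    have e : ((2 : ℕ) : ℝ) * (p.natAbs * (R + 1)) = 2 * p.natAbs * (R + 1) := by push_cast; ring
    rw [e, mul_assoc, mul_comm m]
    gcongr
  have h2 : ‖herglotzTilde p y‖ ≤ Real.exp (p.natAbs * R) := by
    rw [norm_herglotzTilde, Real.exp_le_exp]
    calc (p : ℝ) * y.2 ≤ |(p : ℝ) * y.2| := le_abs_self _
      _ = p.natAbs * |y.2| := by rw [abs_mul, Nat.cast_natAbs, Int.cast_abs]
      _ ≤ _ := by gcongr
  rw [herglotz, norm_mul, Complex.norm_real, Real.norm_eq_abs, abs_of_pos (inv_pos.mpr hpos),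
    inv_mul_le_iff₀ hpos]
  calc ‖herglotzTilde p y‖ ≤ Real.exp (p.natAbs * R) := h2
    _ = (Real.sqrt (2 * Real.pi * m))⁻¹ * Real.exp (-1) ^ p.natAbs *
        (Real.sqrt (2 * Real.pi * m) * Real.exp (p.natAbs * (R + 1))) := by
        rw [← Real.exp_nat_mul]
        have hs : Real.sqrt (2 * Real.pi * m) ≠ 0 := by positivity
        field_simp
        rw [← Real.exp_add]
        congr 1
        ring
    _ ≤ _ := by
        rw [mul_comm (normA κ (herglotzTilde p))]
        gcongr

lemma summable_exp_natAbs : Summable fun p : ℤ => Real.exp (-1) ^ p.natAbs := by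
  have h : Summable fun n : ℕ => Real.exp (-1) ^ n :=
    summable_geometric_of_lt_one (Real.exp_pos _).le (by simp)
  refine Summable.of_nat_of_neg ?_ ?_ <;> simp [h]


/-! ### Sampling functionals -/

/-- The pointwise sum of a series of the functions `a_p`. -/
def herglotzSeries (κ : ℝ) (c : ℤ → ℂ) (z : ℝ × ℝ) : ℂ := ∑' p, c p * herglotz κ p z

/-- Series of the `a_p` with bounded coefficients are dominated for bounded `ζ`. -/
lemma exists_herglotzSeries_majorant {κ : ℝ} (hκ : 0 < κ) {c : ℤ → ℂ} {B : ℝ}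
    (hc : ∀ p, ‖c p‖ ≤ B) {R : ℝ} (hR : 0 ≤ R) :
    ∃ b : ℤ → ℝ, Summable b ∧ ∀ p (z : ℝ × ℝ), |z.2| ≤ R → ‖c p * herglotz κ p z‖ ≤ b p := by
  obtain ⟨C, hC, h⟩ := exists_norm_herglotz_le hκ hR
  have hB : 0 ≤ B := (norm_nonneg _).trans (hc 0)
  refine ⟨fun p => B * (C * Real.exp (-1) ^ p.natAbs),
    (summable_exp_natAbs.mul_left C).mul_left B, fun p z hz => ?_⟩
  rw [norm_mul]
  exact mul_le_mul (hc p) (h p z hz) (norm_nonneg _) hB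

lemma hasSum_herglotzSeries {κ : ℝ} (hκ : 0 < κ) {c : ℤ → ℂ} {B : ℝ}
    (hc : ∀ p, ‖c p‖ ≤ B) (z : ℝ × ℝ) :
    HasSum (fun p => c p * herglotz κ p z) (herglotzSeries κ c z) := by
  obtain ⟨b, hb, h⟩ := exists_herglotzSeries_majorant hκ hc (abs_nonneg z.2)
  exact (Summable.of_norm_bounded hb fun p => h p z le_rfl).hasSum

lemma continuous_herglotzSeries {κ : ℝ} (hκ : 0 < κ) {c : ℤ → ℂ} {B : ℝ}
    (hc : ∀ p, ‖c p‖ ≤ B) : Continuous (herglotzSeries κ c) := by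
  rw [continuous_iff_continuousAt]
  intro z
  obtain ⟨b, hb, h⟩ := exists_herglotzSeries_majorant hκ hc (R := |z.2| + 1) (by positivity)
  have hon : ContinuousOn (herglotzSeries κ c) {y | |y.2| < |z.2| + 1} :=
    continuousOn_tsum (fun p => (continuous_const.mul (continuous_herglotz κ p)).continuousOn) hb
      fun p y hy => h p y (le_of_lt hy)
  refine hon.continuousAt (IsOpen.mem_nhds ?_ ?_)
  · exact isOpen_lt continuous_snd.abs continuous_const
  · simp

lemma coeFn_sum_herglotzVec {κ : ℝ} (hκ : 0 < κ) (c : ℤ → ℂ) (s : Finset ℤ) :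
    (∑ p ∈ s, c p • herglotzVec hκ p : DensitySpace κ) =ᵐ[weightMeasure κ]
      fun z => ∑ p ∈ s, c p * herglotz κ p z := by
  induction s using Finset.induction_on with
  | empty =>
    simp only [Finset.sum_empty]
    exact Lp.coeFn_zero _ _ _
  | insert a s ha ih =>
    simp only [Finset.sum_insert ha]
    exact (Lp.coeFn_add _ _).trans
      (((Lp.coeFn_smul _ _).trans ((coeFn_herglotzVec hκ a).const_smul (c a))).add ih)

/-- The `L²` sum of a series of the `a_p` is given by the pointwise sum. -/
lemma ae_eq_herglotzSeries {κ : ℝ} (hκ : 0 < κ) {c : ℤ → ℂ} {B : ℝ} (hc : ∀ p, ‖c p‖ ≤ B)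
    {F : DensitySpace κ} (hF : HasSum (fun p => c p • herglotzVec hκ p) F) :
    F =ᵐ[weightMeasure κ] herglotzSeries κ c := by
  have hF' : Tendsto (fun s : Finset ℤ => ∑ p ∈ s, c p • herglotzVec hκ p) atTop (𝓝 F) := hF
  obtain ⟨n, hn, hae⟩ := exists_subseq_ae hF'
  have h1 : ∀ᵐ z ∂weightMeasure κ, ∀ k, (∑ p ∈ n k, c p • herglotzVec hκ p : DensitySpace κ) z =
      ∑ p ∈ n k, c p * herglotz κ p z :=
    ae_all_iff.mpr fun k => coeFn_sum_herglotzVec hκ c (n k)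
  filter_upwards [hae, h1] with z hz h1
  simp_rw [h1] at hz
  have h2 : Tendsto (fun s : Finset ℤ => ∑ p ∈ s, c p * herglotz κ p z) atTop
    (𝓝 (herglotzSeries κ c z)) := hasSum_herglotzSeries hκ hc z
  exact tendsto_nhds_unique hz (h2.comp hn)

/-- Functions that agree almost everywhere on `Y` and are continuous there are equal on `Y`. -/
lemma eqOn_cylinder {κ : ℝ} {f g : ℝ × ℝ → ℂ} (h : f =ᵐ[weightMeasure κ] g)
    (hf : ContinuousOn f cylinder) (hg : ContinuousOn g cylinder) : EqOn f g cylinder := by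
  have hmeas : Measurable fun y : ℝ × ℝ => ENNReal.ofReal (weight κ y ^ 2) :=
    (measurable_weightSq κ).comp measurable_snd
  have hac : volume.restrict cylinder ≪ weightMeasure κ := by
    refine withDensity_absolutelyContinuous' hmeas.aemeasurable (.of_forall fun y => ?_)
    have : weight κ y ≠ 0 := (Real.exp_pos _).ne'
    simpa using this
  refine Measure.eqOn_of_ae_eq (hac.ae_le h) hf hg ?_
  rw [cylinder, interior_prod_eq, interior_univ, closure_prod_eq, closure_univ, interior_Ico,
    closure_Ioo (by positivity)]
  exact prod_mono Ico_subset_Icc_self subset_rfl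

lemma memA_herglotz {κ : ℝ} (hκ : 0 < κ) (p : ℤ) : MemA κ (herglotz κ p) :=
  (memA_iff hκ).mpr ⟨herglotzVec hκ p, Submodule.le_topologicalClosure _
    (Submodule.subset_span ⟨p, rfl⟩), coeFn_herglotzVec hκ p⟩

lemma exists_isSamplingFunctional {κ : ℝ} (hκ : 0 < κ) {y : ℝ × ℝ} (hy : y ∈ cylinder) :
    ∃ k, IsSamplingFunctional κ y k := by
  set c : ℤ → ℂ := fun p => conj (herglotz κ p y) with hc
  obtain ⟨C, hC, hle⟩ := exists_norm_herglotz_le hκ (abs_nonneg y.2)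
  have hcle (p : ℤ) : ‖c p‖ ≤ C * Real.exp (-1) ^ p.natAbs := by
    simpa [hc] using hle p y le_rfl
  have hcB (p : ℤ) : ‖c p‖ ≤ C := by
    refine (hcle p).trans (mul_le_of_le_one_right hC.le ?_)
    exact pow_le_one₀ (Real.exp_pos _).le (by simp)
  have hsum : Summable fun p => c p • herglotzVec hκ p := by
    refine Summable.of_norm_bounded (summable_exp_natAbs.mul_left C) fun p => ?_
    rw [norm_smul, (orthonormal_herglotzVec hκ).1 p, mul_one]
    exact hcle p
  obtain ⟨F, hF⟩ := hsum
  have hFk := ae_eq_herglotzSeries hκ hcB hF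
  have hFmem : F ∈ densitySubspace hκ := by
    refine (Submodule.isClosed_topologicalClosure _).mem_of_tendsto hF (.of_forall fun s => ?_)
    exact Submodule.le_topologicalClosure _ (Submodule.sum_mem _ fun p _ =>
      Submodule.smul_mem _ _ (Submodule.subset_span ⟨p, rfl⟩))
  refine ⟨herglotzSeries κ c, (memA_iff hκ).mpr ⟨F, hFmem, hFk⟩,
    (continuous_herglotzSeries hκ hcB).continuousOn, fun v hv hvc => ?_⟩
  obtain ⟨V, hVmem, hV⟩ := (memA_iff hκ).mp hv
  set d : ℤ → ℂ := fun p => inner ℂ (herglotzVec hκ p) V with hd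
  have hdB (p : ℤ) : ‖d p‖ ≤ ‖V‖ := by
    have := norm_inner_le_norm (𝕜 := ℂ) (herglotzVec hκ p) V
    rwa [(orthonormal_herglotzVec hκ).1 p, one_mul] at this
  have hVsum := hasSum_of_mem_closure_span (orthonormal_herglotzVec hκ) hVmem
  have hVd := ae_eq_herglotzSeries hκ hdB hVsum
  have heq : v y = herglotzSeries κ d y :=
    eqOn_cylinder (hV.symm.trans hVd) hvc (continuous_herglotzSeries hκ hdB).continuousOn hy
  have h1 := hasSum_herglotzSeries hκ hdB y
  rw [innerA_eq hV hFk, heq]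
  -- expand the scalar product in the second factor `F = ∑ conj (a_p y) a_p`
  have h2 := hF.mapL (innerSL ℂ V)
  simp only [innerSL_apply_apply, inner_smul_right] at h2
  have h3 : HasSum (fun p => d p * herglotz κ p y) (conj (inner ℂ V F)) := by
    have h4 := Complex.hasSum_conj'.mpr h2
    convert h4 using 2 with p
    rw [hc, map_mul, Complex.conj_conj, inner_conj_symm, mul_comm]
  rw [inner_conj_symm] at h3
  exact h1.unique h3

lemma isSamplingFunctional_samplingFunctional {κ : ℝ} (hκ : 0 < κ) {y : ℝ × ℝ}
    (hy : y ∈ cylinder) : IsSamplingFunctional κ y (samplingFunctional κ y) := by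
  have h := exists_isSamplingFunctional hκ hy
  rw [samplingFunctional, dif_pos h]
  exact h.choose_spec

/-- The coefficients of the sampling functional `K_y` are the numbers `conj (a_p y)`. -/
lemma exists_vec_samplingFunctional {κ : ℝ} (hκ : 0 < κ) {y : ℝ × ℝ} (hy : y ∈ cylinder) :
    ∃ G ∈ densitySubspace hκ, G =ᵐ[weightMeasure κ] samplingFunctional κ y ∧
      ∀ p, inner ℂ (herglotzVec hκ p) G = conj (herglotz κ p y) := by
  obtain ⟨hmem, _, hrep⟩ := isSamplingFunctional_samplingFunctional hκ hy
  obtain ⟨G, hG, hG'⟩ := (memA_iff hκ).mp hmem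
  refine ⟨G, hG, hG', fun p => ?_⟩
  rw [hrep _ (memA_herglotz hκ p) (continuous_herglotz κ p).continuousOn,
    innerA_eq (coeFn_herglotzVec hκ p) hG', inner_conj_symm]


/-! ### Plane waves and stable approximation -/

/-- The multiplier `i^p ‖ã_p‖ ‖b̃_p‖` of the isomorphism from `A` to `B` that maps `K_y` to the
plane wave `φ_y`. -/
def jacobiAngerCoeff (κ : ℝ) (p : ℤ) : ℂ :=
  Complex.I ^ p * ((normA κ (herglotzTilde p) * normB κ (circularWaveTilde κ p) : ℝ) : ℂ)

/-- The multipliers are bounded from above and from below. -/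
lemma exists_jacobiAngerCoeff_bounds {κ : ℝ} (hκ : 0 < κ) :
    ∃ c C : ℝ, 0 < c ∧ 0 < C ∧ ∀ p, c ≤ ‖jacobiAngerCoeff κ p‖ ∧ ‖jacobiAngerCoeff κ p‖ ≤ C := by
  obtain ⟨c, C, hc, hC, h⟩ := exists_weightMoment_mul_circularEnergy_bounds hκ
  refine ⟨Real.sqrt (2 * Real.pi * c), Real.sqrt (2 * Real.pi * C), by positivity, by positivity,
    fun p => ?_⟩
  have hp : 0 < normA κ (herglotzTilde p) * normB κ (circularWaveTilde κ p) :=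
    mul_pos (normA_herglotzTilde_pos hκ p) (normB_circularWaveTilde_pos hκ p)
  have e : ‖jacobiAngerCoeff κ p‖ =
      Real.sqrt (2 * Real.pi * (weightMoment κ p * circularEnergy κ p)) := by
    rw [jacobiAngerCoeff, norm_mul, norm_zpow, Complex.norm_I, one_zpow, one_mul,
      Complex.norm_real, Real.norm_eq_abs, abs_of_pos hp, ← Real.sqrt_sq hp.le, mul_pow,
      normA_herglotzTilde_sq, normB_circularWaveTilde_sq hκ.ne', mul_assoc (2 * Real.pi)]
  rw [e]
  constructor
  · exact Real.sqrt_le_sqrt (by have := (h p).1; gcongr)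
  · exact Real.sqrt_le_sqrt (by have := (h p).2; gcongr)

lemma inner_of_hasSum {H ι : Type*} [NormedAddCommGroup H] [InnerProductSpace ℂ H] {e : ι → H}
    (he : Orthonormal ℂ e) {c : ι → ℂ} {x : H} (h : HasSum (fun i => c i • e i) x) (i : ι) :
    inner ℂ (e i) x = c i := by
  classical
  have h1 := h.mapL (innerSL ℂ (e i))
  simp only [innerSL_apply_apply, inner_smul_right, orthonormal_iff_ite.mp he] at h1
  refine h1.unique ?_
  have e1 : (fun j => c j * if i = j then 1 else 0) = fun j => if j = i then c i else 0 := by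
    funext j
    by_cases hj : i = j
    · simp [hj]
    · simp [hj, Ne.symm hj]
  rw [e1]
  exact hasSum_ite_eq i (c i)

lemma inner_sum_smul {H ι : Type*} [NormedAddCommGroup H] [InnerProductSpace ℂ H] [DecidableEq ι]
    {e : ι → H} (he : Orthonormal ℂ e) (c : ι → ℂ) (s : Finset ι) (i : ι) :
    inner ℂ (e i) (∑ j ∈ s, c j • e j) = if i ∈ s then c i else 0 := by
  rw [inner_sum]
  simp [inner_smul_right, orthonormal_iff_ite.mp he]

/-- A plane wave `φ_y` belongs to `B`, with coefficients proportional to those of `K_y`. -/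
lemma exists_jet_planeWave {κ : ℝ} (hκ : 0 < κ) (y : ℝ × ℝ) :
    ∃ G ∈ circularSpace κ, HasJet κ (planeWave κ y) G ∧
      ∀ p, inner ℂ (circularJet κ p) G = jacobiAngerCoeff κ p * conj (herglotz κ p y) := by
  obtain ⟨t, T, ht, hT, hb⟩ := exists_jacobiAngerCoeff_bounds hκ
  obtain ⟨C, hC, hle⟩ := exists_norm_herglotz_le hκ (abs_nonneg y.2)
  set c : ℤ → ℂ := fun p => jacobiAngerCoeff κ p * conj (herglotz κ p y) with hc
  have hsum : Summable fun p => c p • circularJet κ p := by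
    refine Summable.of_norm_bounded ((summable_exp_natAbs.mul_left C).mul_left T) fun p => ?_
    rw [norm_smul, (orthonormal_circularJet hκ).1 p, mul_one, hc, norm_mul, RCLike.norm_conj]
    exact mul_le_mul (hb p).2 (hle p y le_rfl) (norm_nonneg _) hT.le
  obtain ⟨G, hG⟩ := hsum
  refine ⟨G, ?_, ?_, fun p => inner_of_hasSum (orthonormal_circularJet hκ) hG p⟩
  · refine (Submodule.isClosed_topologicalClosure _).mem_of_tendsto hG (.of_forall fun s => ?_)
    exact Submodule.le_topologicalClosure _ (Submodule.sum_mem _ fun p _ =>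
      Submodule.smul_mem _ _ (Submodule.subset_span ⟨p, rfl⟩))
  · have hG' : Tendsto (fun s : Finset ℤ => ∑ p ∈ s, c p • circularJet κ p) atTop (𝓝 G) := hG
    refine HasJet.of_tendsto (v := fun s x => ∑ p ∈ s, c p * circularWave κ p x)
      (fun s => HasJet.sum s fun p _ => (hasJet_circularWave hκ.ne' p).smul (c p)) hG'
      fun x _ => ?_
    have h := hasSum_planeWave κ y x
    have e : (fun p : ℤ => conj (herglotzTilde p y) * Complex.I ^ p * circularWaveTilde κ p x) =
        fun p => c p * circularWave κ p x := by
      funext p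
      have h1 : ((normA κ (herglotzTilde p) : ℝ) : ℂ) ≠ 0 := by
        exact_mod_cast (normA_herglotzTilde_pos hκ p).ne'
      have h2 : ((normB κ (circularWaveTilde κ p) : ℝ) : ℂ) ≠ 0 := by
        exact_mod_cast (normB_circularWaveTilde_pos hκ p).ne'
      simp only [hc, jacobiAngerCoeff, herglotz, circularWave, map_mul, Complex.conj_ofReal]
      push_cast
      field_simp
    rw [e] at h
    exact h

lemma exists_jet_synthesis {κ : ℝ} {n : ℕ} {Φ : Fin n → ℂ → ℂ}
    {G : Fin n → JetSpace} (hG : ∀ m, HasJet κ (Φ m) (G m)) (μ : EuclideanSpace ℂ (Fin n)) :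
    HasJet κ (synthesis Φ μ) (∑ m, μ m • G m) :=
  HasJet.sum Finset.univ fun m _ => (hG m).smul (μ m)

lemma coeFn_synthesis {κ : ℝ} {n : ℕ} {Ψ : Fin n → ℝ × ℝ → ℂ} {G : Fin n → DensitySpace κ}
    (hG : ∀ m, G m =ᵐ[weightMeasure κ] Ψ m) (μ : EuclideanSpace ℂ (Fin n)) :
    (∑ m, μ m • G m : DensitySpace κ) =ᵐ[weightMeasure κ] synthesis Ψ μ := by
  have h : ∀ s : Finset (Fin n), (∑ m ∈ s, μ m • G m : DensitySpace κ) =ᵐ[weightMeasure κ]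
      fun x => ∑ m ∈ s, μ m * Ψ m x := by
    intro s
    induction s using Finset.induction_on with
    | empty =>
      simp only [Finset.sum_empty]
      exact Lp.coeFn_zero _ _ _
    | insert a s ha ih =>
      simp only [Finset.sum_insert ha]
      exact (Lp.coeFn_add _ _).trans
        (((Lp.coeFn_smul _ _).trans ((hG a).const_smul (μ a))).add ih)
  exact h Finset.univ

lemma memB_smul_planeWave {κ : ℝ} (hκ : 0 < κ) (c : ℂ) (y : ℝ × ℝ) :
    MemB κ fun x => c * planeWave κ y x := by
  obtain ⟨G, hG, hJ, -⟩ := exists_jet_planeWave hκ y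
  exact (memB_iff hκ.ne').mpr ⟨c • G, Submodule.smul_mem _ _ hG, hJ.smul c⟩

/-- Elements of `B` are approximated by truncating their expansions. -/
lemma exists_truncation {κ : ℝ} (hκ : 0 < κ) {F : JetSpace} (hF : F ∈ circularSpace κ) {η : ℝ}
    (hη : 0 < η) : ∃ P : ℕ, ‖F - ∑ p ∈ Finset.Icc (-(P : ℤ)) P,
      inner ℂ (circularJet κ p) F • circularJet κ p‖ ≤ η * ‖F‖ := by
  rcases eq_or_ne F 0 with rfl | hF0
  · exact ⟨0, by simp⟩
  have h : Tendsto (fun s : Finset ℤ => ∑ p ∈ s, inner ℂ (circularJet κ p) F • circularJet κ p)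
    atTop (𝓝 F) := hasSum_of_mem_closure_span (orthonormal_circularJet hκ) hF
  have hpos : 0 < η * ‖F‖ := mul_pos hη (norm_pos_iff.mpr hF0)
  obtain ⟨s, hs⟩ := eventually_atTop.mp (Metric.tendsto_nhds.mp h _ hpos)
  refine ⟨s.sup Int.natAbs, ?_⟩
  have hsub : s ≤ Finset.Icc (-((s.sup Int.natAbs : ℕ) : ℤ)) ((s.sup Int.natAbs : ℕ) : ℤ) := by
    intro p hp
    have : p.natAbs ≤ s.sup Int.natAbs := Finset.le_sup hp
    rw [Finset.mem_Icc]
    omega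
  have := hs _ hsub
  rw [dist_comm, dist_eq_norm] at this
  exact this.le

/-- Norms of elements with termwise comparable coefficients are comparable. -/
lemma norm_le_of_coeff_le {H H' ι : Type*} [NormedAddCommGroup H] [InnerProductSpace ℂ H]
    [CompleteSpace H] [NormedAddCommGroup H'] [InnerProductSpace ℂ H'] [CompleteSpace H']
    {e : ι → H} {e' : ι → H'} (he : Orthonormal ℂ e) (he' : Orthonormal ℂ e') {x : H} {x' : H'}
    (hx : x ∈ (Submodule.span ℂ (range e)).topologicalClosure)
    (hx' : x' ∈ (Submodule.span ℂ (range e')).topologicalClosure) {C : ℝ} (hC : 0 ≤ C)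
    (h : ∀ i, ‖inner ℂ (e i) x‖ ≤ C * ‖inner ℂ (e' i) x'‖) : ‖x‖ ≤ C * ‖x'‖ := by
  have h1 := hasSum_norm_sq_of_mem_closure_span he hx
  have h2 := (hasSum_norm_sq_of_mem_closure_span he' hx').mul_left (C ^ 2)
  have h3 : ‖x‖ ^ 2 ≤ C ^ 2 * ‖x'‖ ^ 2 := hasSum_le (fun i => by
    rw [← mul_pow]
    exact pow_le_pow_left₀ (norm_nonneg _) (h i) 2) h1 h2
  rw [← mul_pow] at h3
  exact le_of_sq_le_sq h3 (by positivity)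

/-- The sampling conjecture transfers to the plane waves through the isomorphism of `A` and `B`
given by the multipliers `jacobiAngerCoeff`. -/
lemma exists_isStableWith {κ : ℝ} (hκ : 0 < κ) {y : (P M : ℕ) → Fin M → ℝ × ℝ}
    (hy : ∀ P M m, y P M m ∈ cylinder) (hconj : SamplingConjecture κ y) {η : ℝ} (hη : 0 < η) :
    ∃ s C : ℝ, 0 ≤ s ∧ 0 ≤ C ∧ IsStableWith κ Prod.snd (planeWaveSet κ y) η s C := by
  obtain ⟨t, T, ht, hT, hb⟩ := exists_jacobiAngerCoeff_bounds hκ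
  obtain ⟨s, C, hnn, ⟨sMax, hs⟩, ⟨CMax, hC⟩, happ⟩ := hconj (η / 2 * t / T) (by positivity)
  have hs' (P : ℕ) : s P ≤ sMax := hs ⟨P, rfl⟩
  have hC' (P : ℕ) : C P ≤ CMax := hC ⟨P, rfl⟩
  have hsM : 0 ≤ sMax := (hnn 0).1.trans (hs' 0)
  have hCM : 0 ≤ CMax := (hnn 0).2.trans (hC' 0)
  refine ⟨sMax, CMax / t, hsM, by positivity, fun u hu => ?_⟩
  obtain ⟨F, hF, hJ⟩ := (memB_iff hκ.ne').mp hu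
  have hoB := orthonormal_circularJet hκ
  have hoA := orthonormal_herglotzVec hκ
  obtain ⟨P, hP⟩ := exists_truncation hκ hF (half_pos hη)
  set I := Finset.Icc (-(P : ℤ)) (P : ℤ)
  set c : ℤ → ℂ := fun p => inner ℂ (circularJet κ p) F
  set τ := jacobiAngerCoeff κ
  have hτ (p : ℤ) : τ p ≠ 0 := norm_pos_iff.mp (ht.trans_le (hb p).1)
  -- the preimage in `A_P` of the truncation of `u`
  set V : DensitySpace κ := ∑ p ∈ I, (c p / τ p) • herglotzVec hκ p
  set v : ℝ × ℝ → ℂ := fun z => ∑ p ∈ I, (c p / τ p) * herglotz κ p z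
  have hVv : V =ᵐ[weightMeasure κ] v := coeFn_sum_herglotzVec hκ _ I
  have hVmem : V ∈ densitySubspace hκ := Submodule.le_topologicalClosure _
    (Submodule.sum_mem _ fun p _ => Submodule.smul_mem _ _ (Submodule.subset_span ⟨p, rfl⟩))
  have hv : v ∈ herglotzSpace κ P := by
    have : v = ∑ p ∈ I, (c p / τ p) • herglotz κ p := by
      funext z
      simp [v]
    rw [this]
    refine Submodule.sum_mem _ fun p hp =>
      Submodule.smul_mem _ _ (Submodule.subset_span ⟨p, ?_, rfl⟩)
    rw [mem_ofPred_eq, abs_le]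
    exact Finset.mem_Icc.mp hp
  have hVnorm : ‖V‖ ≤ t⁻¹ * ‖F‖ := by
    refine norm_le_of_coeff_le hoA hoB hVmem hF (by positivity) fun p => ?_
    rw [inner_sum_smul hoA]
    split_ifs
    · rw [norm_div, div_eq_inv_mul]
      gcongr
      exact (hb p).1
    · rw [norm_zero]
      positivity
  obtain ⟨M, μ, herr, hμ⟩ := happ P v hv
  rw [normA_eq hVv] at herr hμ
  refine ⟨(P, M), μ, ?_, ?_⟩
  · choose G hG hGrep hGc using fun m => exists_vec_samplingFunctional hκ (hy P M m)
    choose G' hG' hGJ hGc' using fun m => exists_jet_planeWave hκ (y P M m)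
    set σ : Fin M → ℂ := fun m => ((Real.sqrt (christoffel κ P (y P M m) / M) : ℝ) : ℂ)
    have hΨ : (∑ m, μ m • σ m • G m : DensitySpace κ) =ᵐ[weightMeasure κ]
        synthesis (samplingSet κ y P M) μ :=
      coeFn_synthesis (fun m => (Lp.coeFn_smul _ _).trans ((hGrep m).const_smul (σ m))) μ
    have hΦ : HasJet κ (synthesis (planeWaveSet κ y (P, M)) μ) (∑ m, μ m • σ m • G' m) :=
      exists_jet_synthesis (fun m => (hGJ m).smul (σ m)) μ
    set Ψ := ∑ m, μ m • σ m • G m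
    set Φ := ∑ m, μ m • σ m • G' m
    have hΨmem : Ψ ∈ densitySubspace hκ := Submodule.sum_mem _ fun m _ =>
      Submodule.smul_mem _ _ (Submodule.smul_mem _ _ (hG m))
    have hΦmem : Φ ∈ circularSpace κ := Submodule.sum_mem _ fun m _ =>
      Submodule.smul_mem _ _ (Submodule.smul_mem _ _ (hG' m))
    have hFP : (∑ p ∈ I, c p • circularJet κ p) ∈ circularSpace κ :=
      Submodule.le_topologicalClosure _
        (Submodule.sum_mem _ fun p _ => Submodule.smul_mem _ _ (Submodule.subset_span ⟨p, rfl⟩))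
    rw [normA_eq ((Lp.coeFn_sub V Ψ).trans (hVv.sub hΨ))] at herr
    have hkey : ‖∑ p ∈ I, c p • circularJet κ p - Φ‖ ≤ T * ‖V - Ψ‖ := by
      refine norm_le_of_coeff_le hoB hoA (Submodule.sub_mem _ hFP hΦmem)
        (Submodule.sub_mem _ hVmem hΨmem) hT.le fun p => ?_
      have e : inner ℂ (circularJet κ p) (∑ p ∈ I, c p • circularJet κ p - Φ) =
          τ p * inner ℂ (herglotzVec hκ p) (V - Ψ) := by
        rw [inner_sub_right, inner_sub_right, inner_sum_smul hoB, inner_sum_smul hoA, mul_sub]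
        congr 1
        · split_ifs
          · field_simp [hτ p]
          · simp
        · simp only [Φ, Ψ, inner_sum, inner_smul_right, hGc, hGc', Finset.mul_sum]
          exact Finset.sum_congr rfl fun m _ => by ring
      rw [e, norm_mul]
      gcongr
      exact (hb p).2
    rw [(hJ.sub hΦ).normB_eq hκ.ne', hJ.normB_eq hκ.ne']
    calc ‖F - Φ‖ ≤ ‖F - ∑ p ∈ I, c p • circularJet κ p‖ +
          ‖∑ p ∈ I, c p • circularJet κ p - Φ‖ := by
          rw [← sub_add_sub_cancel F (∑ p ∈ I, c p • circularJet κ p) Φ]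
          exact norm_add_le _ _
      _ ≤ η / 2 * ‖F‖ + T * (η / 2 * t / T * (t⁻¹ * ‖F‖)) := by
          refine add_le_add hP (hkey.trans ?_)
          gcongr
          exact herr.trans (by gcongr)
      _ = η * ‖F‖ := by
          field_simp
          ring
  · rw [hJ.normB_eq hκ.ne']
    have hF0 := norm_nonneg F
    rcases Nat.eq_zero_or_pos M with rfl | hM
    · -- the empty family carries no coefficients
      have : μ = 0 := Subsingleton.elim _ _
      rw [this, norm_zero]
      positivity
    · have hM1 : (1 : ℝ) ≤ M := by exact_mod_cast hM
      calc ‖μ‖ ≤ C P * (M : ℝ) ^ s P * ‖V‖ := hμ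
        _ ≤ CMax * (M : ℝ) ^ sMax * (t⁻¹ * ‖F‖) := by
            have := (hnn P).2
            gcongr
            · exact hC' P
            · exact hs' P
        _ = CMax / t * (M : ℝ) ^ sMax * ‖F‖ := by
            rw [div_eq_mul_inv]
            ring

/-- If the sampling conjecture holds, the plane waves are a stable approximation for `B`. -/
lemma isStableApproximation_planeWaveSet {κ : ℝ} (hκ : 0 < κ) {y : (P M : ℕ) → Fin M → ℝ × ℝ}
    (hy : ∀ P M m, y P M m ∈ cylinder) (hconj : SamplingConjecture κ y) :
    IsStableApproximation κ Prod.snd (planeWaveSet κ y) :=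
  ⟨fun _ _ => memB_smul_planeWave hκ _ _, fun _ hη => exists_isStableWith hκ hy hconj hη⟩


/-! ### Zeros of Bessel functions and Dirichlet eigenvalues -/

lemma weakGradient_ae_eq {u : ℂ → ℂ} {g : ℂ → EuclideanSpace ℂ (Fin 2)}
    (hu : MemLp u 2 diskMeasure) (hg : IsWeakGradient u g) : weakGradient u =ᵐ[diskMeasure] g := by
  refine ((hg.hasJet one_ne_zero hu).weakGradient_ae one_ne_zero).trans ?_
  filter_upwards [(memLp_jetFun (κ := 1) hu hg.1).coeFn_toLp] with x hx
  ext j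
  simp only [jetGradient, hx]
  fin_cases j <;> simp [jetFun]

lemma contDiff_partialDeriv {f : ℂ → ℂ} (hf : ContDiff ℝ ∞ f) (j : Fin 2) :
    ContDiff ℝ ∞ (partialDeriv j f) :=
  (hf.fderiv_right (m := ∞) (by simp)).clm_apply contDiff_const

lemma partialDeriv_add_eq {a b : ℂ} (p q : ℤ) (κ : ℝ) (j : Fin 2) (z : ℂ) :
    partialDeriv j (fun z => a * circularWaveTilde κ p z + b * circularWaveTilde κ q z) z =
      a * partialDeriv j (circularWaveTilde κ p) z +
        b * partialDeriv j (circularWaveTilde κ q) z := by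
  have h := ((hasFDerivAt_circularWaveTilde κ p z).const_mul a).add
    ((hasFDerivAt_circularWaveTilde κ q z).const_mul b)
  have h' : fderiv ℝ (fun z => a * circularWaveTilde κ p z + b * circularWaveTilde κ q z) z = _ :=
    h.fderiv
  rw [partialDeriv, h', partialDeriv, partialDeriv, (hasFDerivAt_circularWaveTilde κ p z).fderiv,
    (hasFDerivAt_circularWaveTilde κ q z).fderiv]
  simp

/-- Circular waves solve the Helmholtz equation. -/
lemma laplacian_circularWaveTilde (κ : ℝ) (p : ℤ) (z : ℂ) :
    partialDeriv 0 (partialDeriv 0 (circularWaveTilde κ p)) z +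
      partialDeriv 1 (partialDeriv 1 (circularWaveTilde κ p)) z =
      -(κ : ℂ) ^ 2 * circularWaveTilde κ p z := by
  have e0 : partialDeriv 0 (circularWaveTilde κ p) = fun z =>
      (κ / 2 : ℂ) * circularWaveTilde κ (p - 1) z +
        (-(κ / 2) : ℂ) * circularWaveTilde κ (p + 1) z := by
    funext z
    rw [partialDeriv_zero_circularWaveTilde]
    ring
  have e1 : partialDeriv 1 (circularWaveTilde κ p) = fun z =>
      (κ / 2 * Complex.I : ℂ) * circularWaveTilde κ (p - 1) z +
        (κ / 2 * Complex.I : ℂ) * circularWaveTilde κ (p + 1) z := by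
    funext z
    rw [partialDeriv_one_circularWaveTilde]
    ring
  rw [e0, e1, partialDeriv_add_eq, partialDeriv_add_eq]
  simp only [partialDeriv_zero_circularWaveTilde, partialDeriv_one_circularWaveTilde,
    sub_add_cancel, add_sub_cancel_right]
  ring_nf
  simp only [Complex.I_sq]
  ring

lemma integral_gradient_circularWaveTilde (κ : ℝ) (p : ℤ) {f : ℂ → ℂ} (hf : IsTestFunction f) :
    ∫ x, ∑ j, weakGradient (circularWaveTilde κ p) x j * partialDeriv j f x ∂diskMeasure
      = ((κ ^ 2 : ℝ) : ℂ) * ∫ x, circularWaveTilde κ p x * f x ∂diskMeasure := by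
  have hw := contDiff_circularWaveTilde κ p
  have hd (j : Fin 2) := contDiff_partialDeriv hw j
  have h1 : ∫ x, ∑ j, weakGradient (circularWaveTilde κ p) x j * partialDeriv j f x ∂diskMeasure =
      ∫ x, ∑ j, partialDeriv j (circularWaveTilde κ p) x * partialDeriv j f x ∂diskMeasure := by
    refine integral_congr_ae ?_
    filter_upwards [weakGradient_ae_eq (memLp_circularWaveTilde κ p)
      (isWeakGradient_circularWaveTilde κ p)] with x hx
    rw [hx]
    rfl
  have hint (g h : ℂ → ℂ) (hg : Continuous g) (hh : Continuous h) :
      Integrable (fun x => g x * h x) diskMeasure :=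
    (memLp_of_continuous hg).integrable_mul (memLp_of_continuous hh)
  have h2 (j : Fin 2) : ∫ x, partialDeriv j (circularWaveTilde κ p) x * partialDeriv j f x
      ∂diskMeasure = -∫ x, partialDeriv j (partialDeriv j (circularWaveTilde κ p)) x * f x
        ∂diskMeasure :=
    integral_mul_partialDeriv ((hd j).differentiable (by simp))
      (fun i => continuous_partialDeriv (hd j) i) hf j
  rw [h1, integral_finsetSum _ fun j _ => hint _ _ (hd j).continuous
    (continuous_partialDeriv hf.1 j), Fin.sum_univ_two, h2, h2, ← neg_add,
    ← integral_add (hint _ _ (continuous_partialDeriv (hd 0) 0) hf.1.continuous)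
    (hint _ _ (continuous_partialDeriv (hd 1) 1) hf.1.continuous), ← integral_const_mul,
    ← integral_neg]
  refine integral_congr_ae (.of_forall fun x => ?_)
  beta_reduce
  rw [← add_mul, laplacian_circularWaveTilde]
  push_cast
  ring

lemma exists_deriv_smoothTransition_le : ∃ K : ℝ, 0 ≤ K ∧
    ∀ t, |deriv Real.smoothTransition t| ≤ K ∧ (deriv Real.smoothTransition t ≠ 0 → t ≤ 1) := by
  have hc : Continuous (deriv Real.smoothTransition) :=
    (Real.smoothTransition.contDiff (n := 1)).continuous_deriv le_rfl
  obtain ⟨K, hK⟩ := (isCompact_Icc (a := (0 : ℝ)) (b := 1)).exists_bound_of_continuousOn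
    hc.continuousOn
  have hgt : ∀ t : ℝ, 1 < t → deriv Real.smoothTransition t = 0 := by
    intro t ht
    have : Real.smoothTransition =ᶠ[𝓝 t] fun _ => 1 := by
      filter_upwards [lt_mem_nhds ht] with s hs
      exact Real.smoothTransition.one_of_one_le (le_of_lt hs)
    rw [this.deriv_eq, deriv_const]
  have hlt : ∀ t : ℝ, t < 0 → deriv Real.smoothTransition t = 0 := by
    intro t ht
    have : Real.smoothTransition =ᶠ[𝓝 t] fun _ => 0 := by
      filter_upwards [gt_mem_nhds ht] with s hs
      exact Real.smoothTransition.zero_of_nonpos (le_of_lt hs)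
    rw [this.deriv_eq, deriv_const]
  have hK0 : 0 ≤ K := (norm_nonneg _).trans (hK 0 (by simp))
  refine ⟨K, hK0, fun t => ⟨?_, fun h => ?_⟩⟩
  · by_cases h0 : t < 0
    · rw [hlt t h0, abs_zero]
      exact hK0
    · by_cases h1 : 1 < t
      · rw [hgt t h1, abs_zero]
        exact hK0
      · exact hK t ⟨not_lt.mp h0, not_lt.mp h1⟩
  · by_contra h1
    exact h (hgt t (not_le.mp h1))

/-- A smooth radial cutoff that is `1` for `1 - |x|² ≥ 2/n` and `0` for `1 - |x|² ≤ 1/n`. -/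
def cutoff (n : ℝ) (x : ℂ) : ℝ := Real.smoothTransition (n * (1 - ‖x‖ ^ 2) - 1)

lemma contDiff_cutoff (n : ℝ) : ContDiff ℝ ∞ (cutoff n) := by
  refine Real.smoothTransition.contDiff.comp ?_
  exact (contDiff_const.mul (contDiff_const.sub (contDiff_norm_sq ℝ))).sub contDiff_const

lemma hasFDerivAt_cutoff (n : ℝ) (x : ℂ) : HasFDerivAt (cutoff n)
    (deriv Real.smoothTransition (n * (1 - ‖x‖ ^ 2) - 1) •
      (n • (-((2:ℕ) • (innerSL ℝ x : ℂ →L[ℝ] ℝ))) : ℂ →L[ℝ] ℝ)) x := by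
  have h1 : HasFDerivAt (fun x : ℂ => n * (1 - ‖x‖ ^ 2) - 1)
      (n • (-((2:ℕ) • (innerSL ℝ x : ℂ →L[ℝ] ℝ))) : ℂ →L[ℝ] ℝ) x :=
    (((hasStrictFDerivAt_norm_sq x).hasFDerivAt.const_sub 1).const_mul n).sub_const 1
  have h2 : HasDerivAt Real.smoothTransition
      (deriv Real.smoothTransition (n * (1 - ‖x‖ ^ 2) - 1)) (n * (1 - ‖x‖ ^ 2) - 1) :=
    ((Real.smoothTransition.contDiff (n := 1)).differentiable one_ne_zero _).hasDerivAt
  exact h2.comp_hasFDerivAt x h1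

lemma abs_cutoff_le (n : ℝ) (x : ℂ) : |1 - cutoff n x| ≤ 1 := by
  have h1 := Real.smoothTransition.nonneg (n * (1 - ‖x‖ ^ 2) - 1)
  have h2 := Real.smoothTransition.le_one (n * (1 - ‖x‖ ^ 2) - 1)
  rw [cutoff, abs_le]
  constructor <;> linarith

lemma isTestFunction_cutoff_mul {n : ℝ} (hn : 0 < n) {w : ℂ → ℂ} (hw : ContDiff ℝ ∞ w) :
    IsTestFunction fun x => (cutoff n x : ℂ) * w x := by
  have hsub : (tsupport fun x => (cutoff n x : ℂ) * w x) ⊆ {x | 1 / n ≤ 1 - ‖x‖ ^ 2} := by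
    refine closure_minimal (fun x hx => ?_) (isClosed_le continuous_const (by fun_prop))
    by_contra h
    apply hx
    have h1 : 1 - ‖x‖ ^ 2 < 1 / n := not_le.mp h
    rw [lt_div_iff₀ hn] at h1
    have : cutoff n x = 0 := Real.smoothTransition.zero_of_nonpos (by linarith)
    simp [this]
  have hsub2 : {x : ℂ | 1 / n ≤ 1 - ‖x‖ ^ 2} ⊆ disk := by
    intro x hx
    have h1 : 1 / n ≤ 1 - ‖x‖ ^ 2 := hx
    have h2 : 0 < 1 / n := by positivity
    rw [disk, mem_ball_zero_iff]
    nlinarith [norm_nonneg x]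
  refine ⟨(Complex.ofRealCLM.contDiff.comp (contDiff_cutoff n)).mul hw, ?_, hsub.trans hsub2⟩
  exact HasCompactSupport.of_support_subset_isCompact (isCompact_closedBall (0 : ℂ) 1)
    (((subset_tsupport _).trans (hsub.trans hsub2)).trans Metric.ball_subset_closedBall)

/-- A smooth function that vanishes at a linear rate at the unit circle belongs to `H¹₀(B₁)`. -/
lemma memH10_of_vanishing {w : ℂ → ℂ} (hw : ContDiff ℝ ∞ w) {L : ℝ}
    (hL : ∀ x ∈ disk, ‖w x‖ ≤ L * (1 - ‖x‖)) : MemH10 w := by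
  have hC1 {g : ℂ → ℂ} (hg : ContDiff ℝ ∞ g) : MemLp g 2 diskMeasure ∧
      IsWeakGradient g (classicalGradient g) :=
    ⟨memLp_of_continuous hg.continuous, isWeakGradient_classicalGradient
      (hg.differentiable (by simp)) (continuous_partialDeriv hg)⟩
  refine ⟨⟨(hC1 hw).1, _, (hC1 hw).2⟩, ?_⟩
  have hL0 : 0 ≤ L := by simpa using (norm_nonneg _).trans (hL 0 (by simp [disk]))
  obtain ⟨K, hK0, hK⟩ := exists_deriv_smoothTransition_le
  obtain ⟨D, hD⟩ := (isCompact_closedBall (0 : ℂ) 1).exists_bound_of_continuousOn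
    (hw.continuous_fderiv (by simp)).continuousOn
  have hD0 : 0 ≤ D := (norm_nonneg _).trans (hD 0 (by simp))
  set f : ℕ → ℂ → ℂ := fun n x => (cutoff (n + 1) x : ℂ) * w x with hf
  have htest (n : ℕ) : IsTestFunction (f n) := isTestFunction_cutoff_mul (by positivity) hw
  set g : ℕ → ℂ → ℂ := fun n => w - f n with hg
  have hgs (n : ℕ) : ContDiff ℝ ∞ (g n) := hw.sub (htest n).1
  set J : ℕ → ℂ → JetVal := fun n => jetFun 1 (g n) (classicalGradient (g n)) with hJ
  have hJmem (n : ℕ) : MemLp (J n) 2 diskMeasure := memLp_jetFun (hC1 (hgs n)).1 (hC1 (hgs n)).2.1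
  have hJnorm (n : ℕ) (x : ℂ) : ‖J n x‖ ^ 2 = ‖g n x‖ ^ 2 + ‖partialDeriv 0 (g n) x‖ ^ 2 +
      ‖partialDeriv 1 (g n) x‖ ^ 2 := by
    simp [hJ, jetFun, classicalGradient, EuclideanSpace.norm_sq_eq, Fin.sum_univ_succ]
    ring
  have hnorm (n : ℕ) : normB 1 (w - f n) = Real.sqrt (∫ x, ‖J n x‖ ^ 2 ∂diskMeasure) := by
    rw [((hC1 (hgs n)).2.hasJet one_ne_zero (hC1 (hgs n)).1).normB_eq one_ne_zero,
      ← Real.sqrt_sq (norm_nonneg _), Lp_norm_sq]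
    congr 1
    refine integral_congr_ae ?_
    filter_upwards [(hJmem n).coeFn_toLp] with x hx
    rw [hx]
  -- the gradient of the cutoff is of size `n` where `w` is of size `1 / n`
  have hbound (n : ℕ) (x : ℂ) (hx : x ∈ disk) (j : Fin 2) :
      ‖partialDeriv j (g n) x‖ ≤ D + 4 * K * L := by
    have hx1 : ‖x‖ < 1 := mem_ball_zero_iff.mp hx
    have hχ := hasFDerivAt_cutoff (n + 1) x
    have hχ' : HasFDerivAt (fun x => (cutoff (n + 1) x : ℂ)) _ x :=
      Complex.ofRealCLM.hasFDerivAt.comp x hχ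
    have hwd := (hw.differentiable (by simp) x).hasFDerivAt
    have hgd : HasFDerivAt (g n) _ x := hwd.sub (hχ'.mul hwd)
    have hdir : ‖dir j‖ = 1 := by
      fin_cases j <;> simp [dir]
    have e : partialDeriv j (g n) x = ((1 - cutoff (n + 1) x : ℝ) : ℂ) * fderiv ℝ w x (dir j) +
        ((deriv Real.smoothTransition ((n + 1) * (1 - ‖x‖ ^ 2) - 1) *
          ((n + 1) * (2 * inner ℝ x (dir j))) : ℝ) : ℂ) * w x := by
      rw [partialDeriv, hgd.fderiv]
      simp [-Complex.inner]
      ring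
    rw [e]
    refine (norm_add_le _ _).trans (add_le_add ?_ ?_)
    · rw [norm_mul, Complex.norm_real, Real.norm_eq_abs]
      have h1 := abs_cutoff_le (n + 1) x
      have h2 : ‖fderiv ℝ w x (dir j)‖ ≤ D := by
        refine (ContinuousLinearMap.le_opNorm _ _).trans ?_
        rw [hdir, mul_one]
        exact hD x (Metric.ball_subset_closedBall hx)
      calc |1 - cutoff (n + 1) x| * ‖fderiv ℝ w x (dir j)‖ ≤ 1 * D := by gcongr
        _ = D := one_mul D
    · rw [norm_mul, Complex.norm_real, Real.norm_eq_abs, abs_mul, abs_mul, abs_mul]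
      by_cases h0 : deriv Real.smoothTransition ((n + 1) * (1 - ‖x‖ ^ 2) - 1) = 0
      · rw [h0]
        simp only [abs_zero, zero_mul]
        positivity
      · have h1 := (hK ((n + 1) * (1 - ‖x‖ ^ 2) - 1)).1
        have h2 := (hK ((n + 1) * (1 - ‖x‖ ^ 2) - 1)).2 h0
        have h3 : |inner ℝ x (dir j)| ≤ 1 := by
          refine (abs_real_inner_le_norm _ _).trans ?_
          rw [hdir, mul_one]
          exact hx1.le
        have hn1 : (0 : ℝ) < n + 1 := by positivity
        have h4 : ((n : ℝ) + 1) * ‖w x‖ ≤ 2 * L := by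
          have h5 : 1 - ‖x‖ ≤ 1 - ‖x‖ ^ 2 := by nlinarith [norm_nonneg x]
          calc ((n : ℝ) + 1) * ‖w x‖ ≤ (n + 1) * (L * (1 - ‖x‖ ^ 2)) := by
                gcongr
                exact (hL x hx).trans (by gcongr)
            _ = L * ((n + 1) * (1 - ‖x‖ ^ 2)) := by ring
            _ ≤ L * 2 := by gcongr; linarith
            _ = 2 * L := by ring
        rw [abs_of_pos hn1, abs_two]
        calc _ = |deriv Real.smoothTransition ((n + 1) * (1 - ‖x‖ ^ 2) - 1)| *
              (2 * |inner ℝ x (dir j)|) * ((n + 1) * ‖w x‖) := by ring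
          _ ≤ K * (2 * 1) * (2 * L) := by gcongr
          _ = 4 * K * L := by ring
  have hg0 (n : ℕ) (x : ℂ) (hx : x ∈ disk) : ‖g n x‖ ≤ L := by
    have hx1 : ‖x‖ < 1 := mem_ball_zero_iff.mp hx
    have e : g n x = ((1 - cutoff (n + 1) x : ℝ) : ℂ) * w x := by
      simp [hg, hf]
      ring
    rw [e, norm_mul, Complex.norm_real, Real.norm_eq_abs]
    calc |1 - cutoff (n + 1) x| * ‖w x‖ ≤ 1 * (L * (1 - ‖x‖)) :=
          mul_le_mul (abs_cutoff_le _ _) (hL x hx) (norm_nonneg _) zero_le_one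
      _ ≤ L := by nlinarith [norm_nonneg x]
  have hlim : Tendsto (fun n => ∫ x, ‖J n x‖ ^ 2 ∂diskMeasure) atTop (𝓝 0) := by
    rw [← integral_zero ℂ ℝ (μ := diskMeasure)]
    refine tendsto_integral_of_dominated_convergence
      (fun _ => L ^ 2 + (D + 4 * K * L) ^ 2 + (D + 4 * K * L) ^ 2)
      (fun n => (hJmem n).1.norm.pow 2) (integrable_const _) (fun n => ?_) ?_
    · filter_upwards [ae_restrict_mem Metric.isOpen_ball.measurableSet] with x hx
      rw [Real.norm_eq_abs, abs_of_nonneg (by positivity), hJnorm]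
      have h1 := hbound n x hx 0
      have h2 := hbound n x hx 1
      have h3 := hg0 n x hx
      gcongr
    · filter_upwards [ae_restrict_mem Metric.isOpen_ball.measurableSet] with x hx
      have hx1 : ‖x‖ < 1 := mem_ball_zero_iff.mp hx
      have hpos : 0 < 1 - ‖x‖ ^ 2 := by nlinarith [norm_nonneg x]
      obtain ⟨N, hN⟩ := exists_nat_gt (2 / (1 - ‖x‖ ^ 2))
      refine tendsto_const_nhds.congr' ?_
      filter_upwards [eventually_ge_atTop N] with n hn
      have hnN : (N : ℝ) ≤ n := by exact_mod_cast hn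
      have hgt : 1 < ((n : ℝ) + 1) * (1 - ‖x‖ ^ 2) - 1 := by
        have : 2 < (n : ℝ) * (1 - ‖x‖ ^ 2) := by
          rw [← div_lt_iff₀ hpos]
          linarith
        nlinarith
      have hev : g n =ᶠ[𝓝 x] fun _ => 0 := by
        have hcont : Continuous fun z : ℂ => ((n : ℝ) + 1) * (1 - ‖z‖ ^ 2) - 1 := by fun_prop
        filter_upwards [hcont.continuousAt.eventually (lt_mem_nhds hgt)] with z hz
        have : cutoff (n + 1) z = 1 := Real.smoothTransition.one_of_one_le (le_of_lt hz)
        simp [hg, hf, this]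
      have hfd : fderiv ℝ (g n) x = 0 := by
        rw [hev.fderiv_eq]
        simp
      rw [hJnorm, hev.eq_of_nhds, partialDeriv, partialDeriv, hfd]
      simp
  intro ε hε
  have hlim2 := hlim.sqrt
  rw [Real.sqrt_zero] at hlim2
  obtain ⟨n, hn⟩ := (hlim2.eventually (gt_mem_nhds hε)).exists
  exact ⟨f n, htest n, by rwa [hnorm]⟩

/-- If `J_n(κ) = 0`, then the circular wave of order `n` is a Dirichlet eigenfunction. -/
lemma isDirichletEigenvalue_of_besselJ_eq_zero {κ : ℝ} (hκ : 0 < κ) {n : ℕ}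
    (h : besselJ n κ = 0) : IsDirichletEigenvalue (κ ^ 2) := by
  refine ⟨circularWaveTilde κ n, ?_, ?_, fun f hf => integral_gradient_circularWaveTilde κ n hf⟩
  · have hw := contDiff_circularWaveTilde κ n
    obtain ⟨D, hD⟩ := (isCompact_closedBall (0 : ℂ) 1).exists_bound_of_continuousOn
      (hw.continuous_fderiv (by simp)).continuousOn
    refine memH10_of_vanishing hw (L := D) fun x hx => ?_
    have hx1 : ‖x‖ < 1 := mem_ball_zero_iff.mp hx
    have h1 : circularWaveTilde κ n 1 = 0 := by
      rw [← norm_eq_zero, norm_circularWaveTilde]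
      simp [h]
    have h2 : ‖circularWaveTilde κ n x‖ = ‖circularWaveTilde κ n (‖x‖ : ℂ)‖ := by
      simp [norm_circularWaveTilde]
    have h3 := (convex_closedBall (0 : ℂ) 1).norm_image_sub_le_of_norm_fderiv_le
      (𝕜 := ℝ) (fun z _ => hw.differentiable (by simp) z) hD
      (x := 1) (y := (‖x‖ : ℂ)) (by simp) (by simpa using hx1.le)
    rw [h1, sub_zero] at h3
    rw [h2]
    refine h3.trans_eq ?_
    congr 1
    rw [← norm_neg, neg_sub, ← Complex.ofReal_one, ← Complex.ofReal_sub, Complex.norm_real,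
      Real.norm_eq_abs, abs_of_pos (by linarith)]
  · intro h0
    have hm := circularMass_pos hκ n
    rw [circularMass, integral_eq_zero_of_ae] at hm
    · exact lt_irrefl _ hm
    · filter_upwards [h0] with x hx
      simp [hx]


/-! ### Boundary values -/

/-- Normalised circular waves of large order concentrate near the unit circle. -/
lemma exists_norm_circularWave_le {κ : ℝ} (hκ : 0 < κ) :
    ∃ K > 0, ∀ (p : ℤ) (x : ℂ), ‖x‖ ≤ 1 → ‖circularWave κ p x‖ ≤ K * ‖x‖ ^ p.natAbs := by
  obtain ⟨C, hC, h⟩ := exists_le_circularEnergy hκ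
  refine ⟨Real.sqrt (Real.exp (κ ^ 2 / 2) * C), by positivity, fun p x hx => ?_⟩
  have hB := normB_circularWaveTilde_pos hκ p
  rw [circularWave, norm_mul, Complex.norm_real, Real.norm_eq_abs, abs_of_pos (inv_pos.mpr hB),
    inv_mul_le_iff₀ hB]
  refine le_of_sq_le_sq ?_ (by positivity)
  rw [mul_pow, normB_circularWaveTilde_sq hκ.ne', mul_pow, Real.sq_sqrt (by positivity),
    norm_circularWaveTilde, circularEnergy_natAbs]
  set n := p.natAbs
  have h1 : besselLead κ n ≤ C * circularEnergy κ n := by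
    refine le_trans ?_ (h n)
    have := (besselLead_pos hκ n).le
    nlinarith [(Nat.cast_nonneg n : (0 : ℝ) ≤ n)]
  calc |besselJ n (κ * ‖x‖)| ^ 2 ≤ Real.exp (κ ^ 2 / 2) * besselLead κ n * ‖x‖ ^ (2 * n) :=
        besselJ_sq_le hκ n (norm_nonneg x) hx
    _ ≤ Real.exp (κ ^ 2 / 2) * (C * circularEnergy κ n) * ‖x‖ ^ (2 * n) := by gcongr
    _ = circularEnergy κ n * (Real.exp (κ ^ 2 / 2) * C * (‖x‖ ^ n) ^ 2) := by
        rw [← pow_mul, mul_comm n 2]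
        ring

lemma summable_pow_natAbs {r : ℝ} (h0 : 0 ≤ r) (h1 : r < 1) :
    Summable fun p : ℤ => r ^ p.natAbs := by
  refine Summable.of_nat_of_neg ?_ ?_ <;> simpa using summable_geometric_of_lt_one h0 h1

lemma continuous_circularWave (κ : ℝ) (p : ℤ) : Continuous (circularWave κ p) :=
  continuous_const.mul (continuous_circularWaveTilde κ p)

lemma norm_inner_circularJet_le {κ : ℝ} (hκ : 0 < κ) (p : ℤ) (F : JetSpace) :
    ‖inner ℂ (circularJet κ p) F‖ ≤ ‖F‖ := by
  simpa [(orthonormal_circularJet hκ).1 p] using norm_inner_le_norm (𝕜 := ℂ) (circularJet κ p) F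

lemma summable_norm_circularWave_series {κ : ℝ} (hκ : 0 < κ) (F : JetSpace) {x : ℂ}
    (hx : ‖x‖ < 1) :
    Summable fun p => ‖inner ℂ (circularJet κ p) F‖ * ‖circularWave κ p x‖ := by
  obtain ⟨K, hK, h⟩ := exists_norm_circularWave_le hκ
  refine Summable.of_nonneg_of_le (fun p => by positivity) (fun p => ?_)
    (((summable_pow_natAbs (norm_nonneg x) hx).mul_left K).mul_left ‖F‖)
  exact mul_le_mul (norm_inner_circularJet_le hκ p F) (h p x hx.le) (norm_nonneg _) (norm_nonneg _)

/-- A continuous element of `B` is the pointwise sum of its expansion in the open disk. -/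
lemma hasSum_circularWave {κ : ℝ} (hκ : 0 < κ) {u : ℂ → ℂ} {F : JetSpace}
    (hF : F ∈ circularSpace κ) (hJ : HasJet κ u F) (hu : ContinuousOn u disk) {x : ℂ}
    (hx : ‖x‖ < 1) :
    HasSum (fun p => inner ℂ (circularJet κ p) F * circularWave κ p x) (u x) := by
  set c : ℤ → ℂ := fun p => inner ℂ (circularJet κ p) F
  set U : ℂ → ℂ := fun x => ∑' p, c p * circularWave κ p x
  have hsum {x : ℂ} (hx : ‖x‖ < 1) : HasSum (fun p => c p * circularWave κ p x) (U x) := by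
    refine Summable.hasSum (Summable.of_norm ?_)
    simpa only [norm_mul] using summable_norm_circularWave_series hκ F hx
  have hcont : ContinuousOn U disk := by
    intro x hx
    have hx1 : ‖x‖ < 1 := mem_ball_zero_iff.mp hx
    obtain ⟨ρ, hxρ, hρ⟩ := exists_between hx1
    have hρ0 : 0 ≤ ρ := (norm_nonneg x).trans hxρ.le
    obtain ⟨K, hK, h⟩ := exists_norm_circularWave_le hκ
    have h2 : ContinuousOn U (Metric.ball 0 ρ) := by
      refine continuousOn_tsum (fun p => (continuous_const.mul
        (continuous_circularWave κ p)).continuousOn)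
        (((summable_pow_natAbs hρ0 hρ).mul_left K).mul_left ‖F‖) fun p z hz => ?_
      have hz1 : ‖z‖ < ρ := mem_ball_zero_iff.mp hz
      rw [norm_mul]
      refine mul_le_mul (norm_inner_circularJet_le hκ p F) ((h p z (hz1.trans hρ).le).trans ?_)
        (norm_nonneg _) (norm_nonneg _)
      gcongr
    exact (h2.continuousAt (Metric.isOpen_ball.mem_nhds (by simpa using hxρ))).continuousWithinAt
  have hser : Tendsto (fun s : Finset ℤ => ∑ p ∈ s, c p • circularJet κ p) atTop (𝓝 F) :=
    hasSum_of_mem_closure_span (orthonormal_circularJet hκ) hF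
  have hJU : HasJet κ U F := by
    refine HasJet.of_tendsto (v := fun s x => ∑ p ∈ s, c p * circularWave κ p x)
      (fun s => HasJet.sum s fun p _ => (hasJet_circularWave hκ.ne' p).smul (c p)) hser
      fun x hx => hsum (mem_ball_zero_iff.mp hx)
  have hae : u =ᵐ[volume.restrict disk] U := by
    filter_upwards [hJ.1, hJU.1] with x h1 h2
    rw [← h1, h2]
  have := Measure.eqOn_open_of_ae_eq hae Metric.isOpen_ball hu hcont
    (show x ∈ disk from mem_ball_zero_iff.mpr hx)
  rw [this]
  exact hsum hx

/-- `u` in polar coordinates. -/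
def polarFun {u : ℂ → ℂ} (hu : ContinuousOn u (Metric.closedBall 0 1)) :
    C(unitInterval × UnitAddCircle, ℂ) where
  toFun q := u ((q.1 : ℝ) * (AddCircle.toCircle q.2 : ℂ))
  continuous_toFun := by
    refine hu.comp_continuous ?_ fun q => ?_
    · have := AddCircle.continuous_toCircle (T := 1)
      fun_prop
    · have := q.1.2
      rw [mem_closedBall_zero_iff, norm_mul, Circle.norm_coe, mul_one, Complex.norm_real,
        Real.norm_eq_abs, abs_of_nonneg this.1]
      exact this.2

/-- The space `L²` of the unit circle, with the normalised measure. -/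
abbrev CircleSpace := Lp ℂ 2 (AddCircle.haarAddCircle (T := (1 : ℝ)))

/-- The restriction of `u` to the circle of radius `r`, as an element of `L²`. -/
def circleVec {u : ℂ → ℂ} (hu : ContinuousOn u (Metric.closedBall 0 1)) (r : unitInterval) :
    CircleSpace :=
  ContinuousMap.toLp 2 AddCircle.haarAddCircle ℂ ((polarFun hu).curry r)

lemma continuous_circleVec {u : ℂ → ℂ} (hu : ContinuousOn u (Metric.closedBall 0 1)) :
    Continuous (circleVec hu) :=
  (ContinuousMap.toLp 2 AddCircle.haarAddCircle ℂ).continuous.comp (polarFun hu).curry.continuous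

lemma circularWave_mul_toCircle (κ : ℝ) (p : ℤ) (z : ℂ) (t : UnitAddCircle) :
    circularWave κ p (z * AddCircle.toCircle t) = circularWave κ p z * fourier p t := by
  induction t using QuotientAddGroup.induction_on with | _ t =>
  have h1 : ((AddCircle.toCircle (t : UnitAddCircle) : Circle) : ℂ) =
      Complex.exp ((2 * Real.pi * t : ℝ) * Complex.I) := by
    rw [AddCircle.toCircle_apply_mk, Circle.coe_exp, div_one]
  have h2 : (fourier p (t : UnitAddCircle) : ℂ) =
      Complex.exp ((2 * Real.pi * t : ℝ) * Complex.I) ^ p := by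
    rw [fourier_coe_apply, ← Complex.exp_int_mul]
    congr 1
    push_cast
    ring
  rw [h1, h2, mul_comm z, circularWave, circularWaveTilde_rotate, circularWave]
  ring

/-- The Fourier coefficients of the boundary values of `u ∈ B`. -/
lemma inner_fourierLp_circleVec {κ : ℝ} (hκ : 0 < κ) {u : ℂ → ℂ} {F : JetSpace}
    (hF : F ∈ circularSpace κ) (hJ : HasJet κ u F) (hu : ContinuousOn u (Metric.closedBall 0 1))
    (p : ℤ) : inner ℂ (fourierLp 2 p : CircleSpace) (circleVec hu 1) =
      inner ℂ (circularJet κ p) F * circularWave κ p 1 := by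
  -- the expansion converges uniformly on the circles of radius `r < 1`; then `r` tends to `1`
  have key (r : unitInterval) (hr : (r : ℝ) < 1) :
      inner ℂ (fourierLp 2 p : CircleSpace) (circleVec hu r) =
        inner ℂ (circularJet κ p) F * circularWave κ p (r : ℝ) := by
    have hnorm : ‖((r : ℝ) : ℂ)‖ < 1 := by
      rw [Complex.norm_real, Real.norm_eq_abs, abs_of_nonneg r.2.1]
      exact hr
    set a : ℤ → ℂ := fun q => inner ℂ (circularJet κ q) F * circularWave κ q (r : ℝ)
    have hs : Summable fun q => a q • (fourier q : C(UnitAddCircle, ℂ)) := by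
      refine Summable.of_norm ?_
      refine (summable_norm_circularWave_series hκ F hnorm).congr fun q => ?_
      rw [norm_smul, fourier_norm, mul_one, norm_mul]
    have h1 : HasSum (fun q => a q • (fourier q : C(UnitAddCircle, ℂ)))
        ((polarFun hu).curry r) := by
      obtain ⟨g, hg⟩ := hs
      convert hg
      ext t
      have h2 := hg.mapL (ContinuousMap.evalCLM ℂ t)
      have hx : ‖((r : ℝ) : ℂ) * (AddCircle.toCircle t : ℂ)‖ < 1 := by
        rwa [norm_mul, Circle.norm_coe, mul_one]
      have h3 := hasSum_circularWave hκ hF hJ (hu.mono Metric.ball_subset_closedBall) hx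
      refine h3.unique ?_
      rw [ContinuousMap.evalCLM_apply] at h2
      convert h2 using 2 with q
      simp only [circularWave_mul_toCircle, ContinuousMap.evalCLM_apply, a,
        ContinuousMap.smul_apply, smul_eq_mul]
      ring
    exact inner_of_hasSum orthonormal_fourier
      (h1.mapL (ContinuousMap.toLp 2 AddCircle.haarAddCircle ℂ)) p
  have hc1 : Continuous fun r : unitInterval =>
      inner ℂ (fourierLp 2 p : CircleSpace) (circleVec hu r) :=
    continuous_const.inner (continuous_circleVec hu)
  have hc2 : Continuous fun r : unitInterval =>
      inner ℂ (circularJet κ p) F * circularWave κ p ((r : ℝ) : ℂ) := by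
    have := continuous_circularWave κ p
    fun_prop
  have hlim : Tendsto (fun n : ℕ => (unitInterval.symm ⟨1 / ((n : ℝ) + 1), by
      positivity, by
      rw [div_le_one (by positivity)]
      linarith [(Nat.cast_nonneg n : (0 : ℝ) ≤ n)]⟩ : unitInterval)) atTop (𝓝 1) := by
    rw [tendsto_subtype_rng]
    simpa using tendsto_const_nhds (x := (1 : ℝ)).sub tendsto_one_div_add_atTop_nhds_zero_nat
  have h1 := (hc1.tendsto 1).comp hlim
  have h2 := (hc2.tendsto 1).comp hlim
  have := tendsto_nhds_unique (h1.congr fun n => key _ (by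
    have : (0 : ℝ) < 1 / ((n : ℝ) + 1) := by positivity
    simpa using this)) h2
  simpa using this

lemma mem_closure_span_fourierLp (x : CircleSpace) :
    x ∈ (Submodule.span ℂ (range (fourierLp (T := (1 : ℝ)) 2))).topologicalClosure := by
  rw [span_fourierLp_closure_eq_top (p := 2) ENNReal.ofNat_ne_top]
  trivial

/-- The trace inequality in `B`. -/
lemma exists_norm_circleVec_le {κ : ℝ} (hκ : 0 < κ) :
    ∃ C > 0, ∀ (u : ℂ → ℂ) (hu : ContinuousOn u (Metric.closedBall 0 1)), MemB κ u →
      ‖circleVec hu 1‖ ≤ C * normB κ u := by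
  obtain ⟨K, hK, h⟩ := exists_norm_circularWave_le hκ
  refine ⟨K, hK, fun u hu hB => ?_⟩
  obtain ⟨F, hF, hJ⟩ := (memB_iff hκ.ne').mp hB
  rw [hJ.normB_eq hκ.ne']
  refine norm_le_of_coeff_le orthonormal_fourier (orthonormal_circularJet hκ)
    (mem_closure_span_fourierLp _) hF hK.le fun p => ?_
  rw [inner_fourierLp_circleVec hκ hF hJ, norm_mul, mul_comm]
  gcongr
  simpa using h p 1 (by simp)

/-- The circular wave `b̃_p`, normalised in `L²(B₁)`. -/
def massVec (κ : ℝ) (p : ℤ) : Lp ℂ 2 diskMeasure :=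
  (((Real.sqrt (circularMass κ p))⁻¹ : ℝ) : ℂ) • (memLp_circularWaveTilde κ p).toLp _

lemma inner_toLp_circularWaveTilde (κ : ℝ) (p q : ℤ) :
    inner ℂ ((memLp_circularWaveTilde κ p).toLp _) ((memLp_circularWaveTilde κ q).toLp _) =
      circularInner κ p q := by
  rw [L2.inner_def, circularInner]
  refine integral_congr_ae ?_
  filter_upwards [(memLp_circularWaveTilde κ p).coeFn_toLp,
    (memLp_circularWaveTilde κ q).coeFn_toLp] with x hp hq
  rw [hp, hq, RCLike.inner_apply, mul_comm]

lemma orthonormal_massVec {κ : ℝ} (hκ : 0 < κ) : Orthonormal ℂ (massVec κ) := by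
  refine ⟨fun p => ?_, fun p q hpq => ?_⟩
  · have h : inner ℂ (massVec κ p) (massVec κ p) = (1 : ℂ) := by
      have h0 := circularMass_pos hκ p
      rw [massVec, inner_smul_left, inner_smul_right, inner_toLp_circularWaveTilde,
        circularInner_self, Complex.conj_ofReal, ← mul_assoc]
      norm_cast
      rw [← mul_inv, Real.mul_self_sqrt h0.le, inv_mul_cancel₀ h0.ne']
    rw [inner_self_eq_norm_sq_to_K] at h
    have h2 : ‖massVec κ p‖ ^ 2 = 1 := Complex.ofReal_injective (by simpa using h)
    exact (pow_eq_one_iff_of_nonneg (norm_nonneg _) two_ne_zero).mp h2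
  · change inner ℂ (massVec κ p) (massVec κ q) = (0 : ℂ)
    rw [massVec, massVec, inner_smul_left, inner_smul_right, inner_toLp_circularWaveTilde,
      circularInner_eq_zero κ hpq, mul_zero, mul_zero]

/-- The expansion of `u ∈ B` in `L²(B₁)`. -/
lemma hasSum_massVec {κ : ℝ} (hκ : 0 < κ) {u : ℂ → ℂ} {F : JetSpace} (hF : F ∈ circularSpace κ)
    (hJ : HasJet κ u F) : HasSum (fun p => (inner ℂ (circularJet κ p) F *
      ((Real.sqrt (circularMass κ p) / normB κ (circularWaveTilde κ p) : ℝ) : ℂ)) • massVec κ p)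
      (hJ.memLp.toLp u) := by
  have h := (hasSum_of_mem_closure_span (orthonormal_circularJet hκ) hF).mapL
    ((EuclideanSpace.proj (𝕜 := ℂ) (0 : Fin 3)).compLpL 2 diskMeasure)
  have e {v : ℂ → ℂ} {G : JetSpace} (hG : HasJet κ v G) :
      (EuclideanSpace.proj (𝕜 := ℂ) (0 : Fin 3)).compLpL 2 diskMeasure G = hG.memLp.toLp v := by
    refine Lp.ext ?_
    refine (ContinuousLinearMap.coeFn_compLpL _ _).trans ?_
    filter_upwards [hG.1, hG.memLp.coeFn_toLp] with x h1 h2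
    rw [h2, ← h1]
    rfl
  rw [e hJ] at h
  convert h using 2 with p
  have h0 : ((Real.sqrt (circularMass κ p) : ℝ) : ℂ) ≠ 0 := by
    exact_mod_cast (Real.sqrt_pos.mpr (circularMass_pos hκ p)).ne'
  rw [map_smul, circularJet, map_smul, e (hasJet_circularWaveTilde hκ.ne' p), massVec, smul_smul,
    smul_smul]
  congr 1
  push_cast
  field_simp

lemma norm_toLp_eq_l2Norm {u : ℂ → ℂ} (hu : MemLp u 2 diskMeasure) : ‖hu.toLp u‖ = l2Norm u := by
  rw [l2Norm, ← Real.sqrt_sq (norm_nonneg _), Lp_norm_sq]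
  congr 1
  refine integral_congr_ae ?_
  filter_upwards [hu.coeFn_toLp] with x hx
  rw [hx]

/-- If no Bessel function `J_n` vanishes at `κ`, elements of `B` are controlled in `L²(B₁)` by
their boundary values. -/
lemma exists_l2Norm_le {κ : ℝ} (hκ : 0 < κ) (hn : ∀ n : ℕ, besselJ n κ ≠ 0) :
    ∃ C > 0, ∀ (u : ℂ → ℂ) (hu : ContinuousOn u (Metric.closedBall 0 1)), MemB κ u →
      l2Norm u ≤ C * ‖circleVec hu 1‖ := by
  obtain ⟨C, hC, h⟩ := exists_circularMass_le hκ hn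
  refine ⟨Real.sqrt C, Real.sqrt_pos.mpr hC, fun u hu hB => ?_⟩
  obtain ⟨F, hF, hJ⟩ := (memB_iff hκ.ne').mp hB
  have hs := hasSum_massVec hκ hF hJ
  have ho := orthonormal_massVec hκ
  rw [← norm_toLp_eq_l2Norm hJ.memLp]
  refine norm_le_of_coeff_le ho orthonormal_fourier ?_ (mem_closure_span_fourierLp _)
    (Real.sqrt_nonneg _) fun p => ?_
  · refine (Submodule.isClosed_topologicalClosure _).mem_of_tendsto hs (.of_forall fun s => ?_)
    exact Submodule.le_topologicalClosure _ (Submodule.sum_mem _ fun p _ =>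
      Submodule.smul_mem _ _ (Submodule.subset_span ⟨p, rfl⟩))
  · have hB := normB_circularWaveTilde_pos hκ p
    rw [inner_of_hasSum ho hs, inner_fourierLp_circleVec hκ hF hJ, norm_mul, norm_mul,
      mul_left_comm, circularWave, norm_mul, norm_circularWaveTilde, Complex.norm_real,
      Complex.norm_real, Real.norm_eq_abs, Real.norm_eq_abs, abs_of_pos (inv_pos.mpr hB),
      abs_of_nonneg (by positivity), div_eq_inv_mul, mul_left_comm (Real.sqrt C), norm_one, mul_one]
    gcongr
    rw [← Real.sqrt_sq (abs_nonneg (besselJ _ κ)), ← Real.sqrt_mul hC.le, circularMass_natAbs]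
    exact Real.sqrt_le_sqrt (h _)


/-! ### Regularised singular value decompositions -/

open Matrix in
lemma norm_toLp_mulVec {m n : ℕ} {U : Matrix (Fin m) (Fin n) ℂ} (hU : Uᴴ * U = 1)
    (v : Fin n → ℂ) : ‖WithLp.toLp 2 (U *ᵥ v)‖ = ‖WithLp.toLp 2 v‖ := by
  have e {k : ℕ} (w : Fin k → ℂ) : ((‖WithLp.toLp 2 w‖ ^ 2 : ℝ) : ℂ) = star w ⬝ᵥ w := by
    rw [EuclideanSpace.norm_sq_eq]
    push_cast
    refine Finset.sum_congr rfl fun i _ => ?_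
    simp [Complex.conj_mul']
  have h : ((‖WithLp.toLp 2 (U *ᵥ v)‖ ^ 2 : ℝ) : ℂ) = ((‖WithLp.toLp 2 v‖ ^ 2 : ℝ) : ℂ) := by
    rw [e, e, star_mulVec, ← dotProduct_mulVec, mulVec_mulVec, hU, one_mulVec]
  exact (sq_eq_sq₀ (norm_nonneg _) (norm_nonneg _)).mp (Complex.ofReal_injective h)

open Matrix in
lemma rectDiagonal_mulVec {S n : ℕ} (d : Fin n → ℝ) (x : Fin n → ℂ) (i : Fin S) :
    (rectDiagonal S d *ᵥ x) i = if h : (i : ℕ) < n then (d ⟨i, h⟩ : ℂ) * x ⟨i, h⟩ else 0 := by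
  simp only [mulVec, dotProduct, rectDiagonal, of_apply]
  split_ifs with h
  · rw [Finset.sum_eq_single ⟨i, h⟩]
    · simp
    · intro j _ hj
      have : ¬ (i : ℕ) = j := fun hij => hj (Fin.ext hij.symm)
      simp [this]
    · simp
  · refine Finset.sum_eq_zero fun j _ => ?_
    have : ¬ (i : ℕ) = j := fun hij => h (hij ▸ j.2)
    simp [this]

open Matrix in
lemma rectDiagonal_transpose_mulVec {S n : ℕ} (hn : n ≤ S) (d : Fin n → ℝ) (y : Fin S → ℂ)
    (j : Fin n) : ((rectDiagonal S d)ᵀ *ᵥ y) j = (d j : ℂ) * y (Fin.castLE hn j) := by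
  simp only [mulVec, dotProduct, rectDiagonal, of_apply, transpose_apply]
  rw [Finset.sum_eq_single (Fin.castLE hn j)]
  · simp
  · intro i _ hi
    have : ¬ (i : ℕ) = j := fun hij => hi (Fin.ext hij)
    simp [this]
  · simp

open Matrix in
lemma norm_rectDiagonal_mulVec_le {S n : ℕ} (hn : n ≤ S) {d : Fin n → ℝ} {c : ℝ} (hc : 0 ≤ c)
    (hd : ∀ j, |d j| ≤ c) (x : Fin n → ℂ) :
    ‖WithLp.toLp 2 (rectDiagonal S d *ᵥ x)‖ ≤ c * ‖WithLp.toLp 2 x‖ := by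
  refine le_of_sq_le_sq ?_ (by positivity)
  rw [mul_pow, EuclideanSpace.norm_sq_eq, EuclideanSpace.norm_sq_eq, Finset.mul_sum]
  rw [← Fintype.sum_of_injective (Fin.castLE hn) (Fin.castLE_injective hn)
    (fun j => ‖(d j : ℂ) * x j‖ ^ 2)]
  · refine Finset.sum_le_sum fun j _ => ?_
    rw [norm_mul, mul_pow, Complex.norm_real]
    gcongr
    exact hd j
  · intro i hi
    have : ¬ (i : ℕ) < n := fun h => hi ⟨⟨i, h⟩, Fin.ext rfl⟩
    simp [rectDiagonal_mulVec, this]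
  · intro j
    simp [rectDiagonal_mulVec]

open Matrix in
/-- The residual of the regularised solution exceeds the residual of any other vector `μ` by at
most the contribution of the discarded singular values. -/
lemma norm_residual_le {S n : ℕ} (hn : n ≤ S) {A : Matrix (Fin S) (Fin n) ℂ} {b : Fin S → ℂ}
    {ε : ℝ} (hε : 0 < ε) {ξ : EuclideanSpace ℂ (Fin n)} (hξ : IsRegularizedSolution A b ε ξ)
    (μ : EuclideanSpace ℂ (Fin n)) :
    ‖WithLp.toLp 2 (b - A *ᵥ ξ)‖ ≤ ‖WithLp.toLp 2 (b - A *ᵥ μ)‖ + ε * sigmaMax A * ‖μ‖ := by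
  obtain ⟨U, σ, V, ⟨hU, hV, -, hσ, hA⟩, rfl⟩ := hξ
  have hU1 : Uᴴ * U = 1 := mem_unitaryGroup_iff'.mp hU
  have hU2 : U * Uᴴ = 1 := mem_unitaryGroup_iff.mp hU
  have hV1 : Vᴴ * V = 1 := mem_unitaryGroup_iff'.mp hV
  have hV2 : V * Vᴴ = 1 := mem_unitaryGroup_iff.mp hV
  have hmax : 0 ≤ sigmaMax A := LinearMap.singularValues_nonneg _ _
  set c := ε * sigmaMax A
  have hc : 0 ≤ c := by positivity
  set e : Fin n → ℝ := fun j => if c ≤ σ j then (σ j)⁻¹ else 0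
  set f : Fin S → ℂ := Uᴴ *ᵥ (b - A *ᵥ μ)
  set x : Fin n → ℂ := Vᴴ *ᵥ μ
  set f' : Fin S → ℂ := fun i => if h : (i : ℕ) < n then ((1 - σ ⟨i, h⟩ * e ⟨i, h⟩ : ℝ) : ℂ) * f i
    else f i
  set τ : Fin n → ℝ := fun j => (1 - σ j * e j) * σ j
  -- in the singular bases the residual is diagonal
  have hres : Uᴴ *ᵥ (b - A *ᵥ ((V * (rectDiagonal S e)ᵀ * Uᴴ) *ᵥ b)) =
      f' + rectDiagonal S τ *ᵥ x := by
    have hb : Uᴴ *ᵥ b = f + rectDiagonal S σ *ᵥ x := by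
      have h1 : Uᴴ *ᵥ (A *ᵥ μ) = rectDiagonal S σ *ᵥ x := by
        simp only [x, mulVec_mulVec]
        rw [hA, ← Matrix.mul_assoc, ← Matrix.mul_assoc, hU1, Matrix.one_mul]
      rw [← h1, ← mulVec_add, sub_add_cancel]
    have h2 : Uᴴ *ᵥ (A *ᵥ ((V * (rectDiagonal S e)ᵀ * Uᴴ) *ᵥ b)) =
        rectDiagonal S σ *ᵥ ((rectDiagonal S e)ᵀ *ᵥ (Uᴴ *ᵥ b)) := by
      simp only [mulVec_mulVec]
      congr 1
      calc Uᴴ * (A * (V * (rectDiagonal S e)ᵀ * Uᴴ))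
          = (Uᴴ * U) * rectDiagonal S σ * (Vᴴ * V) * (rectDiagonal S e)ᵀ * Uᴴ := by
            rw [hA]
            simp only [Matrix.mul_assoc]
        _ = rectDiagonal S σ * ((rectDiagonal S e)ᵀ * Uᴴ) := by
            rw [hU1, hV1, Matrix.one_mul, Matrix.mul_one, Matrix.mul_assoc]
    rw [mulVec_sub, h2, hb]
    funext i
    simp only [Pi.sub_apply, Pi.add_apply, rectDiagonal_mulVec, f', τ]
    split_ifs with h
    · rw [rectDiagonal_transpose_mulVec hn]
      have : Fin.castLE hn ⟨i, h⟩ = i := rfl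
      rw [this, Pi.add_apply, rectDiagonal_mulVec, dif_pos h]
      push_cast
      ring
    · ring
  -- if `σ_max = 0`, vanishing singular values are kept, but their junk inverses are zero
  have hone (j : Fin n) : |1 - σ j * e j| ≤ 1 := by
    simp only [e]
    split_ifs with h
    · rcases eq_or_ne (σ j) 0 with h0 | h0
      · simp [h0]
      · simp [h0]
    · simp
  have hτ (j : Fin n) : |τ j| ≤ c := by
    simp only [τ, e]
    split_ifs with h
    · rcases eq_or_ne (σ j) 0 with h0 | h0
      · simpa [h0] using hc
      · simpa [h0] using hc
    · rw [mul_zero, sub_zero, one_mul, abs_of_nonneg (hσ j)]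
      exact (not_le.mp h).le
  have hf' : ‖WithLp.toLp 2 f'‖ ≤ ‖WithLp.toLp 2 f‖ := by
    refine le_of_sq_le_sq ?_ (norm_nonneg _)
    rw [EuclideanSpace.norm_sq_eq, EuclideanSpace.norm_sq_eq]
    refine Finset.sum_le_sum fun i _ => ?_
    refine pow_le_pow_left₀ (norm_nonneg _) ?_ 2
    simp only [f']
    split_ifs with h
    · rw [norm_mul, Complex.norm_real]
      exact mul_le_of_le_one_left (norm_nonneg _) (hone _)
    · exact le_rfl
  have hUH : Uᴴᴴ * Uᴴ = 1 := by rwa [conjTranspose_conjTranspose]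
  have hVH : Vᴴᴴ * Vᴴ = 1 := by rwa [conjTranspose_conjTranspose]
  rw [← norm_toLp_mulVec hUH, hres, WithLp.toLp_add]
  refine (norm_add_le _ _).trans (add_le_add ?_ ?_)
  · exact hf'.trans_eq (norm_toLp_mulVec hUH _)
  · exact (norm_rectDiagonal_mulVec_le hn hc hτ x).trans_eq (by rw [norm_toLp_mulVec hVH])

open Matrix in
/-- Every matrix with at least as many rows as columns has a singular value decomposition. -/
lemma exists_isSVD {S n : ℕ} (hn : n ≤ S) (A : Matrix (Fin S) (Fin n) ℂ) :
    ∃ U σ V, IsSVD A U σ V := by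
  set T := toEuclideanLin A
  have hsym := T.isSymmetric_adjoint_comp_self
  have hfr : Module.finrank ℂ (EuclideanSpace ℂ (Fin n)) = n := by simp
  set v := hsym.eigenvectorBasis hfr
  set σ : Fin n → ℝ := fun j => T.singularValues j
  have hσ (j : Fin n) : 0 ≤ σ j := T.singularValues_nonneg _
  have hinner (j k : Fin n) : inner ℂ (T (v j)) (T (v k)) = if j = k then (σ j : ℂ) ^ 2 else 0 := by
    rw [← LinearMap.adjoint_inner_right]
    have := hsym.apply_eigenvectorBasis hfr k
    rw [LinearMap.comp_apply] at this
    rw [this, inner_smul_right, orthonormal_iff_ite.mp v.orthonormal]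
    split_ifs with h
    · subst h
      rw [mul_one, ← T.sq_singularValues_fin hfr]
      simp [σ]
    · simp
  -- the normalised images of the right singular vectors, to be completed to a basis
  set w : Fin S → EuclideanSpace ℂ (Fin S) := fun i =>
    if h : (i : ℕ) < n then (((σ ⟨i, h⟩)⁻¹ : ℝ) : ℂ) • T (v ⟨i, h⟩) else 0
  set s : Set (Fin S) := {i | ∃ h : (i : ℕ) < n, σ ⟨i, h⟩ ≠ 0}
  have hw : Orthonormal ℂ (s.domRestrict w) := by
    rw [orthonormal_iff_ite]
    rintro ⟨i, hi, hi0⟩ ⟨k, hk, hk0⟩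
    change inner ℂ (w i) (w k) = _
    have e (i : Fin S) (hi : (i : ℕ) < n) :
        w i = (((σ ⟨i, hi⟩)⁻¹ : ℝ) : ℂ) • T (v ⟨i, hi⟩) := dif_pos hi
    rw [e i hi, e k hk, inner_smul_left, inner_smul_right, hinner, Complex.conj_ofReal]
    by_cases h : i = k
    · subst h
      have : (σ ⟨i, hi⟩ : ℂ) ≠ 0 := by exact_mod_cast hi0
      rw [if_pos rfl, if_pos rfl]
      push_cast
      field_simp
    · rw [if_neg fun h' => h (Fin.ext (Fin.mk.inj h')), if_neg fun h' => h (Subtype.ext_iff.mp h')]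
      simp
  obtain ⟨u, hu⟩ := hw.exists_orthonormalBasis_extension_of_card_eq (by simp)
  have hTv (j : Fin n) : T (v j) = (σ j : ℂ) • u (Fin.castLE hn j) := by
    by_cases h : σ j = 0
    · have := hinner j j
      rw [if_pos rfl, h] at this
      rw [h, Complex.ofReal_zero, zero_smul, ← inner_self_eq_zero (𝕜 := ℂ), this]
      simp
    · have h1 : ((Fin.castLE hn j : Fin S) : ℕ) < n := j.2
      rw [hu _ ⟨h1, h⟩]
      have h2 : (σ j : ℂ) ≠ 0 := by exact_mod_cast h
      simp only [w, h1, dif_pos, smul_smul]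
      have h3 : (⟨((Fin.castLE hn j : Fin S) : ℕ), h1⟩ : Fin n) = j := rfl
      rw [h3, Complex.ofReal_inv, mul_inv_cancel₀ h2, one_smul]
  refine ⟨(EuclideanSpace.basisFun (Fin S) ℂ).toBasis.toMatrix u, σ,
    (EuclideanSpace.basisFun (Fin n) ℂ).toBasis.toMatrix v,
    OrthonormalBasis.toMatrix_orthonormalBasis_mem_unitary _ _,
    OrthonormalBasis.toMatrix_orthonormalBasis_mem_unitary _ _,
    fun i j hij => T.singularValues_antitone hij, hσ, ?_⟩
  set U := (EuclideanSpace.basisFun (Fin S) ℂ).toBasis.toMatrix u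
  set V := (EuclideanSpace.basisFun (Fin n) ℂ).toBasis.toMatrix v
  have hV : V * Vᴴ = 1 := mem_unitaryGroup_iff.mp
    (OrthonormalBasis.toMatrix_orthonormalBasis_mem_unitary _ _)
  have hAV : A * V = U * rectDiagonal S σ := by
    ext i j
    have h1 := congrArg (fun z : EuclideanSpace ℂ (Fin S) => z i) (hTv j)
    have h2 : (A * V) i j = T (v j) i := rfl
    rw [h2]
    refine h1.trans ?_
    rw [Matrix.mul_apply, Finset.sum_eq_single (Fin.castLE hn j)]
    · simp only [rectDiagonal, of_apply, Fin.val_castLE, if_true, PiLp.smul_apply, smul_eq_mul]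
      rw [mul_comm]
      rfl
    · intro k _ hk
      have : ¬ (k : ℕ) = j := fun hkj => hk (Fin.ext hkj)
      simp [rectDiagonal, this]
    · simp
  rw [← hAV, Matrix.mul_assoc, hV, Matrix.mul_one]

lemma exists_isRegularizedSolution {S n : ℕ} (hn : n ≤ S) (A : Matrix (Fin S) (Fin n) ℂ)
    (b : Fin S → ℂ) (ε : ℝ) : ∃ ξ, IsRegularizedSolution A b ε ξ := by
  obtain ⟨U, σ, V, h⟩ := exists_isSVD hn A
  exact ⟨_, U, σ, V, h, rfl⟩


/-! ### Equispaced sampling on the circle -/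

/-- The parameter of a sampling point. -/
def samplingAngle (S : ℕ) (j : Fin S) : UnitAddCircle := (((j : ℕ) + 1 : ℝ) / S : ℝ)

lemma toCircle_samplingAngle (S : ℕ) (j : Fin S) :
    (AddCircle.toCircle (samplingAngle S j) : ℂ) = samplingPoint S j := by
  rw [samplingAngle, AddCircle.toCircle_apply_mk, Circle.coe_exp, samplingPoint]
  congr 1
  push_cast
  ring

/-- The mean square of the samples. -/
def meanSquare (S : ℕ) (f : UnitAddCircle → ℂ) : ℝ :=
  (S : ℝ)⁻¹ * ∑ j, ‖f (samplingAngle S j)‖ ^ 2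

/-- The error of a Riemann sum is bounded by the oscillation on the subintervals. -/
lemma abs_integral_sub_mean_le {f : ℝ → ℝ} (hf : Continuous f) {S : ℕ} (hS : 0 < S) {ε : ℝ}
    (h : ∀ j : Fin S, ∀ t ∈ Icc ((j : ℕ) / S : ℝ) (((j : ℕ) + 1) / S),
      |f t - f (((j : ℕ) + 1) / S)| ≤ ε) :
    |(∫ t in (0 : ℝ)..1, f t) - (S : ℝ)⁻¹ * ∑ j : Fin S, f (((j : ℕ) + 1) / S)| ≤ ε := by
  have hS0 : (0 : ℝ) < S := by exact_mod_cast hS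
  have h1 : (∫ t in (0 : ℝ)..1, f t) =
      ∑ j ∈ Finset.range S, ∫ t in (j / S : ℝ)..((j + 1 : ℕ) / S : ℝ), f t := by
    rw [intervalIntegral.sum_integral_adjacent_intervals
      (a := fun j : ℕ => (j / S : ℝ)) fun j _ => hf.intervalIntegrable _ _]
    simp [hS0.ne']
  have h2 (j : Fin S) : |(∫ t in ((j : ℕ) / S : ℝ)..((((j : ℕ) + 1 : ℕ) : ℝ) / S), f t) -
      (S : ℝ)⁻¹ * f (((j : ℕ) + 1) / S)| ≤ ε * (S : ℝ)⁻¹ := by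
    have hlen : ((((j : ℕ) + 1 : ℕ) : ℝ) / S) - (j : ℕ) / S = (S : ℝ)⁻¹ := by
      push_cast
      field_simp
      ring
    have hle : ((j : ℕ) / S : ℝ) ≤ (((j : ℕ) + 1 : ℕ) : ℝ) / S := by
      have : (0 : ℝ) < (S : ℝ)⁻¹ := by positivity
      linarith
    have e : (S : ℝ)⁻¹ * f (((j : ℕ) + 1) / S) =
        ∫ t in ((j : ℕ) / S : ℝ)..((((j : ℕ) + 1 : ℕ) : ℝ) / S), f (((j : ℕ) + 1) / S) := by
      rw [intervalIntegral.integral_const, hlen, smul_eq_mul]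
    rw [e, ← intervalIntegral.integral_sub (hf.intervalIntegrable _ _)
      intervalIntegrable_const]
    have h3 := intervalIntegral.norm_integral_le_of_norm_le_const
      (f := fun t => f t - f (((j : ℕ) + 1) / S)) (C := ε)
      (a := ((j : ℕ) / S : ℝ)) (b := ((((j : ℕ) + 1 : ℕ) : ℝ) / S)) fun t ht => by
        rw [uIoc_of_le hle] at ht
        refine h j t ⟨ht.1.le, ?_⟩
        simpa using ht.2
    rwa [hlen, abs_of_pos (by positivity : (0 : ℝ) < (S : ℝ)⁻¹)] at h3
  rw [h1, Finset.sum_range, Finset.mul_sum, ← Finset.sum_sub_distrib]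
  calc _ ≤ ∑ j : Fin S, ε * (S : ℝ)⁻¹ :=
        (Finset.abs_sum_le_sum_abs _ _).trans (Finset.sum_le_sum fun j _ => h2 j)
    _ = ε := by
        rw [Finset.sum_const, Finset.card_univ, Fintype.card_fin, nsmul_eq_mul]
        field_simp

lemma norm_toLp_circle_sq (f : C(UnitAddCircle, ℂ)) :
    ‖ContinuousMap.toLp 2 AddCircle.haarAddCircle ℂ f‖ ^ 2 = ∫ t in (0 : ℝ)..1, ‖f t‖ ^ 2 := by
  have h := UnitAddCircle.intervalIntegral_preimage 0 (fun t => ‖f t‖ ^ 2)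
  rw [zero_add] at h
  rw [h, Lp_norm_sq]
  have h2 := AddCircle.integral_haarAddCircle (T := 1) (f := fun t => ‖f t‖ ^ 2)
  rw [inv_one, one_smul] at h2
  rw [← h2]
  refine integral_congr_ae ?_
  filter_upwards [ContinuousMap.coeFn_toLp (p := 2) (𝕜 := ℂ) AddCircle.haarAddCircle f] with x hx
  rw [hx]

/-- On a finite-dimensional space of continuous functions, the mean square of sufficiently many
equispaced samples is equivalent to the square of the `L²` norm. -/
lemma exists_meanSquare_equiv (W : Submodule ℂ C(UnitAddCircle, ℂ)) [FiniteDimensional ℂ W] :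
    ∃ S₀ : ℕ, 0 < S₀ ∧ ∀ S, S₀ ≤ S → ∀ w ∈ W,
      ‖ContinuousMap.toLp 2 AddCircle.haarAddCircle ℂ w‖ ^ 2 ≤ 2 * meanSquare S w ∧
      meanSquare S w ≤ 2 * ‖ContinuousMap.toLp 2 AddCircle.haarAddCircle ℂ w‖ ^ 2 := by
  set N : C(UnitAddCircle, ℂ) → ℝ := fun w =>
    ‖ContinuousMap.toLp 2 AddCircle.haarAddCircle ℂ w‖ ^ 2
  have hN : Continuous N := by
    have := (ContinuousMap.toLp (E := ℂ) 2 (AddCircle.haarAddCircle (T := (1 : ℝ))) ℂ).continuous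
    fun_prop
  have : ProperSpace W := FiniteDimensional.proper ℂ W
  set K : Set C(UnitAddCircle, ℂ) := (Subtype.val '' Metric.closedBall (0 : W) 1) ∩ {w | ‖w‖ = 1}
  have hK : IsCompact K :=
    ((isCompact_closedBall (0 : W) 1).image continuous_subtype_val).inter_right
      (isClosed_eq continuous_norm continuous_const)
  have hmem {w : C(UnitAddCircle, ℂ)} (hw : w ∈ W) (h1 : ‖w‖ = 1) : w ∈ K := by
    refine ⟨⟨⟨w, hw⟩, ?_, rfl⟩, h1⟩
    have : dist w 0 ≤ 1 := by rw [dist_zero_right, h1]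
    exact this
  -- the `L²` norm is bounded from below on the unit sphere of the uniform norm
  obtain ⟨m, hm, hmN⟩ := hK.exists_forall_le' hN.continuousOn (a := 0) fun w hw => by
    have hw1 : ‖w‖ = 1 := hw.2
    refine pow_pos (norm_pos_iff.mpr fun h0 => ?_) 2
    have h1 : w = 0 := ContinuousMap.toLp_injective (𝕜 := ℂ) _ (by rw [h0, map_zero])
    rw [h1, norm_zero] at hw1
    exact zero_ne_one hw1
  have : CompactSpace K := isCompact_iff_compactSpace.mp hK
  -- the squared moduli of the functions of norm one are uniformly equicontinuous
  have huc : UniformContinuous fun q : K × unitInterval =>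
      ‖(q.1 : C(UnitAddCircle, ℂ)) ((q.2 : ℝ) : UnitAddCircle)‖ ^ 2 := by
    refine CompactSpace.uniformContinuous_of_continuous ?_
    have h1 : Continuous fun q : K × unitInterval => (q.1 : C(UnitAddCircle, ℂ)) := by fun_prop
    have h2 : Continuous fun q : K × unitInterval => ((q.2 : ℝ) : UnitAddCircle) :=
      (AddCircle.continuous_mk' 1).comp (by fun_prop)
    exact (h1.eval h2).norm.pow 2
  obtain ⟨d, hd, hosc⟩ := Metric.uniformContinuous_iff.mp huc (m / 2) (by positivity)
  obtain ⟨S₀, hS₀⟩ := exists_nat_gt (1 / d)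
  refine ⟨S₀ + 1, Nat.succ_pos _, fun S hS w hw => ?_⟩
  have hSpos : 0 < S := by omega
  have hS0 : (0 : ℝ) < S := by exact_mod_cast hSpos
  have hSd : (S : ℝ)⁻¹ < d := by
    have h1 : (S₀ : ℝ) < S := by exact_mod_cast hS
    rw [inv_lt_comm₀ hS0 hd, ← one_div]
    linarith
  have key {w : C(UnitAddCircle, ℂ)} (hw : w ∈ K) : |N w - meanSquare S w| ≤ m / 2 := by
    have h1 : N w = ∫ t in (0 : ℝ)..1, ‖w t‖ ^ 2 := norm_toLp_circle_sq _
    rw [h1]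
    have hc : Continuous fun t : ℝ => ‖w t‖ ^ 2 :=
      ((map_continuous w).comp (AddCircle.continuous_mk' (1 : ℝ))).norm.pow 2
    refine abs_integral_sub_mean_le hc hSpos fun j t ht => ?_
    have hj : ((j : ℕ) : ℝ) + 1 ≤ S := by exact_mod_cast j.2
    have hj1 : (((j : ℕ) : ℝ) + 1) / S ≤ 1 := by rwa [div_le_one hS0]
    have ht0 : 0 ≤ t := le_trans (by positivity) ht.1
    have hdist : |t - ((j : ℕ) + 1) / S| < d := by
      refine lt_of_le_of_lt ?_ hSd
      have h2 : (((j : ℕ) : ℝ) + 1) / S = (j : ℕ) / S + (S : ℝ)⁻¹ := by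
        field_simp
      rw [abs_le]
      have := ht.1
      have := ht.2
      constructor <;> linarith
    have h3 := @hosc (⟨w, hw⟩, ⟨t, ht0, ht.2.trans hj1⟩)
      (⟨w, hw⟩, ⟨((j : ℕ) + 1) / S, by positivity, hj1⟩)
      (by
        rw [Prod.dist_eq, dist_self]
        exact max_lt hd hdist)
    exact h3.le
  rcases eq_or_ne w 0 with rfl | hw0
  · simp [meanSquare]
  -- the general case follows by homogeneity
  set a : ℝ := ‖w‖
  have ha : 0 < a := norm_pos_iff.mpr hw0
  set w₁ : C(UnitAddCircle, ℂ) := ((a⁻¹ : ℝ) : ℂ) • w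
  have hw₁ : w₁ ∈ K := by
    refine hmem (W.smul_mem _ hw) ?_
    rw [norm_smul, Complex.norm_real, Real.norm_eq_abs, abs_of_pos (inv_pos.mpr ha)]
    exact inv_mul_cancel₀ ha.ne'
  have e1 : N w₁ = (a⁻¹) ^ 2 * N w := by
    simp only [N, w₁, map_smul, norm_smul, Complex.norm_real, mul_pow, Real.norm_eq_abs, sq_abs]
  have e2 : meanSquare S w₁ = (a⁻¹) ^ 2 * meanSquare S w := by
    simp only [meanSquare, w₁, ContinuousMap.smul_apply, norm_smul, Complex.norm_real, mul_pow,
      Real.norm_eq_abs, sq_abs, ← Finset.mul_sum]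
    ring
  have h1 := abs_le.mp (key hw₁)
  have h2 := hmN w₁ hw₁
  have ha2 : 0 < (a⁻¹) ^ 2 := by positivity
  constructor
  · refine le_of_mul_le_mul_left ?_ ha2
    change _ * N w ≤ _
    rw [← e1, mul_left_comm, ← e2]
    linarith [h1.2]
  · refine le_of_mul_le_mul_left ?_ ha2
    change _ ≤ _ * (2 * N w)
    rw [← e2, mul_left_comm, ← e1]
    linarith [h1.1]


/-! ### The error of the regularised reconstruction -/

lemma MemB.sub_synthesis {κ : ℝ} (hκ : κ ≠ 0) {u : ℂ → ℂ} (hu : MemB κ u) {n : ℕ}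
    {Φ : Fin n → ℂ → ℂ} (hΦ : ∀ l, MemB κ (Φ l)) (μ : EuclideanSpace ℂ (Fin n)) :
    MemB κ (u - synthesis Φ μ) := by
  obtain ⟨F, hF, hJ⟩ := (memB_iff hκ).mp hu
  choose G hG hGJ using fun l => (memB_iff hκ).mp (hΦ l)
  exact (memB_iff hκ).mpr ⟨_, Submodule.sub_mem _ hF
    (Submodule.sum_mem _ fun l _ => Submodule.smul_mem _ (μ l) (hG l)),
    hJ.sub (exists_jet_synthesis hGJ μ)⟩

lemma continuous_synthesis {n : ℕ} {Φ : Fin n → ℂ → ℂ} (hΦ : ∀ l, Continuous (Φ l))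
    (μ : EuclideanSpace ℂ (Fin n)) : Continuous (synthesis Φ μ) := by
  unfold synthesis
  fun_prop

open Matrix in
/-- The mean square of the samples of `u - ∑ₗ μₗ φₗ` is the scaled residual of `μ`. -/
lemma meanSquare_sub_synthesis {u : ℂ → ℂ} {n : ℕ} {Φ : Fin n → ℂ → ℂ}
    {μ : EuclideanSpace ℂ (Fin n)}
    (hw : ContinuousOn (u - synthesis Φ μ) (Metric.closedBall 0 1)) (S : ℕ) :
    meanSquare S ((polarFun hw).curry 1) = (S : ℝ)⁻¹ *
      ‖WithLp.toLp 2 (samplingVector u S - samplingMatrix Φ S *ᵥ μ)‖ ^ 2 := by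
  rw [meanSquare, EuclideanSpace.norm_sq_eq]
  congr 1
  refine Finset.sum_congr rfl fun j _ => ?_
  have h1 : (polarFun hw).curry 1 (samplingAngle S j) =
      (u - synthesis Φ μ) (samplingPoint S j) := by
    rw [← toCircle_samplingAngle]
    simp [polarFun]
  rw [h1]
  simp [samplingVector, samplingMatrix, mulVec, dotProduct, synthesis, mul_comm]

/-- Unless `κ²` is a Dirichlet eigenvalue, sufficiently many boundary samples yield a
reconstruction that is almost as good as any other element `∑ₗ μₗ φₗ` with moderate
coefficients. -/
lemma exists_l2Norm_sub_synthesis_le {κ : ℝ} (hκ : 0 < κ) : ∃ C > 0,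
    ¬ IsDirichletEigenvalue (κ ^ 2) → ∀ (n : ℕ) (Φ : Fin n → ℂ → ℂ), (∀ l, MemB κ (Φ l)) →
      (∀ l, Continuous (Φ l)) → ∀ u, MemB κ u → ContinuousOn u (Metric.closedBall 0 1) →
        ∃ S₀ : ℕ, 0 < S₀ ∧ ∀ S, S₀ ≤ S → n ≤ S → ∀ ε : ℝ, 0 < ε → ∀ ξ,
          IsRegularizedSolution (samplingMatrix Φ S) (samplingVector u S) ε ξ → ∀ μ,
            l2Norm (u - synthesis Φ ξ) ≤ C * (normB κ (u - synthesis Φ μ) +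
              ε * sigmaMax (samplingMatrix Φ S) * ‖μ‖ / Real.sqrt S) := by
  -- if some `J_n` vanishes at `κ`, then `κ²` is an eigenvalue
  by_cases hJ : ∀ n : ℕ, besselJ n κ ≠ 0
  swap
  · push Not at hJ
    obtain ⟨n, hn⟩ := hJ
    exact ⟨1, one_pos, fun h => absurd (isDirichletEigenvalue_of_besselJ_eq_zero hκ hn) h⟩
  obtain ⟨C₁, hC₁, hL2⟩ := exists_l2Norm_le hκ hJ
  obtain ⟨C₂, hC₂, htr⟩ := exists_norm_circleVec_le hκ
  refine ⟨C₁ * (2 * C₂ + 2), by positivity, fun _ n Φ hΦ hΦc u hu huc => ?_⟩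
  have hw (μ : EuclideanSpace ℂ (Fin n)) :
      ContinuousOn (u - synthesis Φ μ) (Metric.closedBall 0 1) :=
    huc.sub (continuous_synthesis hΦc μ).continuousOn
  set gu := (polarFun huc).curry 1
  set gΦ : Fin n → C(UnitAddCircle, ℂ) := fun l => (polarFun (hΦc l).continuousOn).curry 1
  set W := Submodule.span ℂ (insert gu (range gΦ))
  have : FiniteDimensional ℂ W := FiniteDimensional.span_of_finite ℂ ((finite_range gΦ).insert gu)
  have hmem (μ : EuclideanSpace ℂ (Fin n)) : (polarFun (hw μ)).curry 1 ∈ W := by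
    have e : (polarFun (hw μ)).curry 1 = gu - ∑ l, μ l • gΦ l := by
      ext t
      simp [gu, gΦ, polarFun, synthesis]
    rw [e]
    exact W.sub_mem (Submodule.subset_span (mem_insert _ _)) (W.sum_mem fun l _ =>
      W.smul_mem _ (Submodule.subset_span (mem_insert_of_mem _ ⟨l, rfl⟩)))
  obtain ⟨S₀, hS₀, hequiv⟩ := exists_meanSquare_equiv W
  refine ⟨S₀, hS₀, fun S hS hnS ε hε ξ hξ μ => ?_⟩
  have hSpos : (0 : ℝ) < S := by exact_mod_cast hS₀.trans_le hS
  have hs : 0 < Real.sqrt S := Real.sqrt_pos.mpr hSpos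
  have hres := norm_residual_le hnS hε hξ μ
  have h1 := (hequiv S hS _ (hmem ξ)).1
  have h2 := (hequiv S hS _ (hmem μ)).2
  rw [meanSquare_sub_synthesis (hw ξ)] at h1
  rw [meanSquare_sub_synthesis (hw μ)] at h2
  change ‖circleVec (hw ξ) 1‖ ^ 2 ≤ _ at h1
  change _ ≤ 2 * ‖circleVec (hw μ) 1‖ ^ 2 at h2
  set Rξ := ‖WithLp.toLp 2 (samplingVector u S - (samplingMatrix Φ S).mulVec ξ)‖
  set Rμ := ‖WithLp.toLp 2 (samplingVector u S - (samplingMatrix Φ S).mulVec μ)‖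
  set E := ε * sigmaMax (samplingMatrix Φ S) * ‖μ‖
  have hE : 0 ≤ E := mul_nonneg (mul_nonneg hε.le (LinearMap.singularValues_nonneg _ _))
    (norm_nonneg _)
  have hsS : (S : ℝ)⁻¹ = (Real.sqrt S)⁻¹ ^ 2 := by rw [inv_pow, Real.sq_sqrt hSpos.le]
  have h2' : (Real.sqrt S)⁻¹ * Rμ ≤ Real.sqrt 2 * ‖circleVec (hw μ) 1‖ := by
    refine le_of_sq_le_sq ?_ (by positivity)
    rwa [mul_pow, mul_pow, Real.sq_sqrt zero_le_two, ← hsS]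
  have h1' : ‖circleVec (hw ξ) 1‖ ≤ Real.sqrt 2 * ((Real.sqrt S)⁻¹ * Rξ) := by
    refine le_of_sq_le_sq ?_ (by positivity)
    rwa [mul_pow, mul_pow, Real.sq_sqrt zero_le_two, ← hsS]
  have h3 := htr _ (hw μ) (hu.sub_synthesis hκ.ne' hΦ μ)
  have hnB : 0 ≤ normB κ (u - synthesis Φ μ) := Real.sqrt_nonneg _
  have h22 : Real.sqrt 2 * Real.sqrt 2 = 2 := Real.mul_self_sqrt zero_le_two
  have h2le : Real.sqrt 2 ≤ 2 := by nlinarith [Real.sqrt_nonneg 2, Real.one_le_sqrt.mpr one_le_two]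
  calc l2Norm (u - synthesis Φ ξ) ≤ C₁ * ‖circleVec (hw ξ) 1‖ :=
        hL2 _ (hw ξ) (hu.sub_synthesis hκ.ne' hΦ ξ)
    _ ≤ C₁ * (Real.sqrt 2 * ((Real.sqrt S)⁻¹ * (Rμ + E))) := by
        gcongr
        exact h1'.trans (by gcongr)
    _ = C₁ * (Real.sqrt 2 * ((Real.sqrt S)⁻¹ * Rμ) + Real.sqrt 2 * (E / Real.sqrt S)) := by
        ring
    _ ≤ C₁ * (Real.sqrt 2 * (Real.sqrt 2 * (C₂ * normB κ (u - synthesis Φ μ))) +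
          2 * (E / Real.sqrt S)) := by
        have h4 : (Real.sqrt S)⁻¹ * Rμ ≤ Real.sqrt 2 * (C₂ * normB κ (u - synthesis Φ μ)) :=
          h2'.trans (by gcongr)
        have h5 := mul_le_mul_of_nonneg_left h4 (Real.sqrt_nonneg 2)
        have h6 : Real.sqrt 2 * (E / Real.sqrt S) ≤ 2 * (E / Real.sqrt S) := by gcongr
        exact mul_le_mul_of_nonneg_left (add_le_add h5 h6) hC₁.le
    _ = C₁ * (2 * C₂ * normB κ (u - synthesis Φ μ) + 2 * (E / Real.sqrt S)) := by
        rw [← mul_assoc (Real.sqrt 2), h22, mul_assoc]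
    _ ≤ C₁ * ((2 * C₂ + 2) * normB κ (u - synthesis Φ μ) +
          (2 * C₂ + 2) * (E / Real.sqrt S)) := by
        gcongr
        · linarith
        · linarith
    _ = C₁ * (2 * C₂ + 2) * (normB κ (u - synthesis Φ μ) + E / Real.sqrt S) := by ring

lemma continuous_planeWaveSet (κ : ℝ) (y : (P M : ℕ) → Fin M → ℝ × ℝ) (k : ℕ × ℕ) (l : Fin k.2) :
    Continuous (planeWaveSet κ y k l) := by
  unfold planeWaveSet planeWave
  fun_prop

/-- A stable approximation of tolerance `δ / (2 C)` yields a relative error of at most `δ`: one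
half comes from the approximation, the other from the regularisation. -/
lemma exists_reconstructsWithin {κ : ℝ} (hκ : 0 < κ) : ∃ Cerr > 0,
    ¬ IsDirichletEigenvalue (κ ^ 2) → ∀ (y : (P M : ℕ) → Fin M → ℝ × ℝ) (δ s C : ℝ), 0 < δ →
      IsStableWith κ Prod.snd (planeWaveSet κ y) (δ / (2 * Cerr)) s C →
      ∀ u, MemB κ u → ContinuousOn u (Metric.closedBall 0 1) →
        ∃ P M S₀ : ℕ, 0 < S₀ ∧ ∀ S : ℕ, S₀ ≤ S → M ≤ S → ∀ ε : ℝ, 0 < ε →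
          2 * Cerr * sigmaMax (samplingMatrix (planeWaveSet κ y (P, M)) S) * C * (M : ℝ) ^ s * ε
            ≤ δ * Real.sqrt S →
          ReconstructsWithin (planeWaveSet κ y (P, M)) u S ε (δ * normB κ u) := by
  obtain ⟨Cerr, hC0, h⟩ := exists_l2Norm_sub_synthesis_le hκ
  refine ⟨Cerr, hC0, fun hD y δ s C hδ hst u hu huc => ?_⟩
  obtain ⟨⟨P, M⟩, μ, herr, hμ⟩ := hst u hu
  change ‖μ‖ ≤ C * (M : ℝ) ^ s * normB κ u at hμ
  obtain ⟨S₀, hS₀, hrec⟩ := h hD M (planeWaveSet κ y (P, M))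
    (fun l => memB_smul_planeWave hκ _ _) (continuous_planeWaveSet κ y (P, M)) u hu huc
  refine ⟨P, M, S₀, hS₀, fun S hS hMS ε hε hcond => ⟨exists_isRegularizedSolution hMS _ _ _,
    fun ξ hξ => (hrec S hS hMS ε hε ξ hξ μ).trans ?_⟩⟩
  have hs : 0 < Real.sqrt S := Real.sqrt_pos.mpr (by exact_mod_cast hS₀.trans_le hS)
  have hσ : 0 ≤ sigmaMax (samplingMatrix (planeWaveSet κ y (P, M)) S) :=
    LinearMap.singularValues_nonneg _ _
  set σ := sigmaMax (samplingMatrix (planeWaveSet κ y (P, M)) S)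
  have hu0 : 0 ≤ normB κ u := Real.sqrt_nonneg _
  have h1 : 2 * Cerr * (ε * σ * ‖μ‖ / Real.sqrt S) ≤ δ * normB κ u := by
    rw [← mul_div_assoc, div_le_iff₀ hs]
    calc 2 * Cerr * (ε * σ * ‖μ‖) ≤ 2 * Cerr * (ε * σ * (C * (M : ℝ) ^ s * normB κ u)) := by
          gcongr
      _ = 2 * Cerr * σ * C * (M : ℝ) ^ s * ε * normB κ u := by ring
      _ ≤ δ * Real.sqrt S * normB κ u := by gcongr
      _ = δ * normB κ u * Real.sqrt S := by ring
  calc Cerr * (normB κ (u - synthesis (planeWaveSet κ y (P, M)) μ) + ε * σ * ‖μ‖ / Real.sqrt S)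
      ≤ Cerr * (δ / (2 * Cerr) * normB κ u + ε * σ * ‖μ‖ / Real.sqrt S) := by gcongr
    _ = δ * normB κ u / 2 + 2 * Cerr * (ε * σ * ‖μ‖ / Real.sqrt S) / 2 := by
        field_simp
    _ ≤ δ * normB κ u := by linarith

end

end EPW

theorem proposition6p1 (κ : ℝ) (hκ : 0 < κ) :
    ∃ Cerr : ℝ, 0 < Cerr ∧
      ∀ y : (P M : ℕ) → Fin M → ℝ × ℝ, (∀ P M m, y P M m ∈ EPW.cylinder) →
        EPW.SamplingConjecture κ y →
        EPW.IsStableApproximation κ Prod.snd (EPW.planeWaveSet κ y) ∧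
        (¬ EPW.IsDirichletEigenvalue (κ ^ 2) →
          ∀ δ : ℝ, 0 < δ →
            (∀ u : ℂ → ℂ, EPW.MemB κ u → ContinuousOn u (Metric.closedBall 0 1) →
              ∃ (P M S : ℕ) (ε : ℝ), 0 < S ∧ M ≤ S ∧ 0 < ε ∧ ε ≤ 1 ∧
                EPW.ReconstructsWithin (EPW.planeWaveSet κ y (P, M)) u S ε
                  (δ * EPW.normB κ u)) ∧
            (∀ s C : ℝ, 0 ≤ s → 0 ≤ C →
              EPW.IsStableWith κ Prod.snd (EPW.planeWaveSet κ y) (δ / (2 * Cerr)) s C →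
              ∀ u : ℂ → ℂ, EPW.MemB κ u → ContinuousOn u (Metric.closedBall 0 1) →
                ∃ P M S₀ : ℕ, 0 < S₀ ∧ ∀ S : ℕ, S₀ ≤ S → M ≤ S →
                  ∀ ε : ℝ, 0 < ε → ε ≤ 1 →
                    2 * Cerr * EPW.sigmaMax (EPW.samplingMatrix
                      (EPW.planeWaveSet κ y (P, M)) S) * C * (M : ℝ) ^ s * ε
                      ≤ δ * Real.sqrt S →
                    EPW.ReconstructsWithin (EPW.planeWaveSet κ y (P, M)) u S ε
                      (δ * EPW.normB κ u))) := by
  obtain ⟨Cerr, hC0, h⟩ := EPW.exists_reconstructsWithin hκ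
  refine ⟨Cerr, hC0, fun y hy hconj => ⟨EPW.isStableApproximation_planeWaveSet hκ hy hconj,
    fun hD δ hδ => ⟨fun u hu huc => ?_, fun s C _ _ hst u hu huc => ?_⟩⟩⟩
  · obtain ⟨s, C, -, hC, hst⟩ := EPW.exists_isStableWith hκ hy hconj
      (show 0 < δ / (2 * Cerr) by positivity)
    obtain ⟨P, M, S₀, hS₀, hrec⟩ := h hD y δ s C hδ hst u hu huc
    set S := max S₀ M
    have hS : 0 < S := hS₀.trans_le (le_max_left _ _)
    have hs : 0 < Real.sqrt S := Real.sqrt_pos.mpr (by exact_mod_cast hS)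
    have hσ : 0 ≤ EPW.sigmaMax (EPW.samplingMatrix (EPW.planeWaveSet κ y (P, M)) S) :=
      LinearMap.singularValues_nonneg _ _
    set D := 2 * Cerr * EPW.sigmaMax (EPW.samplingMatrix (EPW.planeWaveSet κ y (P, M)) S) * C *
      (M : ℝ) ^ s
    have hD0 : 0 ≤ D := by positivity
    -- the summand `1` keeps the quotient meaningful if `D = 0`
    have hε : 0 < min 1 (δ * Real.sqrt S / (D + 1)) := lt_min one_pos (by positivity)
    refine ⟨P, M, S, _, hS, le_max_right _ _, hε, min_le_left _ _,
      hrec S (le_max_left _ _) (le_max_right _ _) _ hε ?_⟩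
    calc D * min 1 (δ * Real.sqrt S / (D + 1)) ≤ (D + 1) * (δ * Real.sqrt S / (D + 1)) :=
          mul_le_mul (by linarith) (min_le_right _ _) hε.le (by positivity)
      _ = δ * Real.sqrt S := by field_simp
  · obtain ⟨P, M, S₀, hS₀, hrec⟩ := h hD y δ s C hδ hst u hu huc
    exact ⟨P, M, S₀, hS₀, fun S hS hMS ε hε _ => hrec S hS hMS ε hε⟩
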